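/- **Theorem (twisted $A_{q^2}$-bimodule structure of $B_{q^2}$).** Let $q$ be an odd prime power. For a matrix $X$ over $\mathbb F_{q^2}$ let $X^*$ be the transpose of the matrix obtained by raising every entry to the $q$-th power, and let $J_m$ be the $m\times m$ matrix with ones on the second diagonal and zeros elsewhere. Let $\mathrm U(m)=\{g\in \mathrm{GL}(m,\mathbb F_{q^2}) : g^*J_mg=J_m\}$ and $\mathfrak u(m)=\{X\in\mathfrak{gl}(m,\mathbb F_{q^2}) : X^*J_m+J_mX=0\}$. For $\mathcal G=\mathfrak{gl}(m,\mathbb F_{q^2})$ with $G=\mathrm{GL}(m,\mathbb F_{q^2})$, or $\mathcal G=\mathfrak u(m)$ with $G=\mathrm U(m)$, let $\mathcal C(\mathcal G)$ be the space of real functions on $\mathcal G$ invariant under conjugation by $G$. Put $$A=A_{q^2}=\bigoplus_{n\ge 0}\mathcal C(\mathfrak{gl}(n,\mathbb F_{q^2})),\qquad B=B_{q^2}=\bigoplus_{n\ge 0}\mathcal C(\mathfrak u(2n)).$$ For $i+j=n$, let $P\subset \mathrm{GL}(n,\mathbb F_{q^2})$ be the group of invertible block upper triangular matrices for the partition $n=i+j$.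 Its Lie algebra is $\mathcal P=\mathcal L\oplus\mathcal U$, where $\mathcal U$ consists of the strictly block upper triangular matrices and $\mathcal L=\{\operatorname{diag}(X,Y)\}\cong\mathfrak{gl}(i,\mathbb F_{q^2})\oplus\mathfrak{gl}(j,\mathbb F_{q^2})$. Similarly, let $P\subset \mathrm U(2n)$ be the subgroup of block upper triangular matrices for the partition $2n=i+2j+i$. Its Lie algebra is $\mathcal P=\mathcal L\oplus\mathcal U$, where $\mathcal U$ consists of the strictly block upper triangular elements of $\mathfrak u(2n)$ and $\mathcal L=\{\operatorname{diag}(X,Y,-J_iX^*J_i)\}\cong\mathfrak{gl}(i,\mathbb F_{q^2})\oplus\mathfrak u(2j)$. In both cases parabolic restriction and parabolic induction are $$(\downarrow\Psi)(Y)=\frac1{|\mathcal U|}\sum_{Z\in\mathcal U}\Psi(Y+Z)\quad (Y\in\mathcal L),\qquad (\uparrow\Phi)(X)=\sum_{g\in[G/P]}\Phi'(g^{-1}Xg)\quad (X\in\mathcal G),$$ where $[G/P]$ is a set of representatives of the cosets $gP$, and $\Phi'$ is $\Phi$ composed with the projection $\mathcal P\to\mathcal L$ along $\mathcal U$, extended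 by $0$ to $\mathcal G\setminus\mathcal P$. Identify functions on $\mathcal L$ invariant under the Levi subgroup with $\mathcal C(\mathfrak{gl}(i,\mathbb F_{q^2}))\otimes\mathcal C(\mathfrak{gl}(j,\mathbb F_{q^2}))$, respectively $\mathcal C(\mathfrak{gl}(i,\mathbb F_{q^2}))\otimes\mathcal C(\mathfrak u(2j))$. Summing over all $i+j=n$ and all $n$, restriction gives linear maps $$\Delta:A\to A\otimes A,\qquad \tilde\Delta:B\to A\otimes B,$$ and induction gives linear maps $$\nabla:A\otimes A\to A,\quad a\otimes a'\mapsto aa',\qquad \tilde\nabla:A\otimes B\to B,\quad a\otimes b\mapsto a\cdot b.$$ Let $\omega:A\to A$ be the graded linear map $f\mapsto f\circ\omega_n$ for $f\in\mathcal C(\mathfrak{gl}(n,\mathbb F_{q^2}))$, where $\omega_n(X)=-J_nX^*J_n$. Define the bilinear operation $\odot: A\times(A\otimes B)\to A\otimes B$ by $$a\odot(a'\otimes b)=\sum \bigl(a_{(1)}\,\omega(a_{(2)})\,a'\bigr)\otimes\bigl(a_{(3)}\cdot b\bigr),\qquad (\Delta\otimes\mathrm{id})\Delta(a)=\sum a_{(1)}\otimes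 a_{(2)}\otimes a_{(3)},$$ where $a_1a_2a_3=(a_1a_2)a_3$. Then for all $a\in A$ and $b\in B$, $$\tilde\Delta(a\cdot b)=a\odot\tilde\Delta(b).$$ -/

import Mathlib

open scoped TensorProduct Matrix

namespace LieInv

/-! ### Invariant functions and parabolic induction / restriction -/

section General

variable {G H 𝔤 𝔩 : Type*} [Group G] [Group H] [AddCommGroup 𝔤] [AddCommGroup 𝔩]

/-- The real vector space `𝒞(𝔤)` of real functions on `𝔤` that are constant on the orbits of the
(adjoint) action `Ad` of `G` on `𝔤`. -/
def InvFun (Ad : G →* AddMonoid.End 𝔤) : Submodule ℝ (𝔤 → ℝ) where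
  carrier := {f | ∀ g X, f (Ad g X) = f X}
  add_mem' := fun hf hg g X => by simp [hf g X, hg g X]
  zero_mem' := fun _ _ => rfl
  smul_mem' := fun c f hf g X => by simp [hf g X]

theorem ad_mul_apply (Ad : G →* AddMonoid.End 𝔤) (g h : G) (X : 𝔤) :
    Ad (g * h) X = Ad g (Ad h X) := by rw [map_mul]; rfl

@[simp] theorem ad_one_apply (Ad : G →* AddMonoid.End 𝔤) (X : 𝔤) : Ad 1 X = X := by
  rw [map_one]; rfl

@[simp] theorem ad_inv_ad (Ad : G →* AddMonoid.End 𝔤) (g : G) (X : 𝔤) : Ad g⁻¹ (Ad g X) = X := by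
  rw [← ad_mul_apply]; simp

@[simp] theorem ad_ad_inv (Ad : G →* AddMonoid.End 𝔤) (g : G) (X : 𝔤) : Ad g (Ad g⁻¹ X) = X := by
  rw [← ad_mul_apply]; simp

/-- The componentwise action of `G × H` on `𝔤 × 𝔩`. -/
def adProd (Ad₁ : G →* AddMonoid.End 𝔤) (Ad₂ : H →* AddMonoid.End 𝔩) : G × H →* AddMonoid.End (𝔤 × 𝔩) where
  toFun g := AddMonoidHom.prodMap (Ad₁ g.1) (Ad₂ g.2)
  map_one' := AddMonoidHom.ext fun X => by
    simp only [Prod.fst_one, Prod.snd_one, map_one]; rfl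
  map_mul' g h := AddMonoidHom.ext fun X => by
    simp only [Prod.fst_mul, Prod.snd_mul, map_mul]; rfl

@[simp] theorem adProd_apply (Ad₁ : G →* AddMonoid.End 𝔤) (Ad₂ : H →* AddMonoid.End 𝔩) (g : G × H)
    (X : 𝔤 × 𝔩) : adProd Ad₁ Ad₂ g X = (Ad₁ g.1 X.1, Ad₂ g.2 X.2) := rfl

/-- The canonical map `𝒞(𝔤) ⊗ 𝒞(𝔩) → 𝒞(𝔤 × 𝔩)`, `f ⊗ f' ↦ ((X, Y) ↦ f X * f' Y)`. -/
noncomputable def tensorToProd (Ad₁ : G →* AddMonoid.End 𝔤) (Ad₂ : H →* AddMonoid.End 𝔩) :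
    InvFun Ad₁ ⊗[ℝ] InvFun Ad₂ →ₗ[ℝ] InvFun (adProd Ad₁ Ad₂) :=
  TensorProduct.lift (LinearMap.mk₂ ℝ
    (fun f f' => ⟨fun X => f.1 X.1 * f'.1 X.2, fun g X => by
      simp [f.2 g.1 X.1, f'.2 g.2 X.2]⟩)
    (fun _ _ _ => by ext X; simp [add_mul])
    (fun _ _ _ => by ext X; simp [mul_assoc])
    (fun _ _ _ => by ext X; simp [mul_add])
    (fun _ _ _ => by ext X; simp [mul_left_comm]))

@[simp] theorem tensorToProd_tmul (Ad₁ : G →* AddMonoid.End 𝔤) (Ad₂ : H →* AddMonoid.End 𝔩)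
    (f : InvFun Ad₁) (f' : InvFun Ad₂) (X : 𝔤 × 𝔩) :
    (tensorToProd Ad₁ Ad₂ (f ⊗ₜ f')).1 X = f.1 X.1 * f'.1 X.2 := rfl

theorem tensorToProd_injective [Finite 𝔤] [Finite 𝔩]
    (Ad₁ : G →* AddMonoid.End 𝔤) (Ad₂ : H →* AddMonoid.End 𝔩) :
    Function.Injective (tensorToProd Ad₁ Ad₂) := by
  classical
  have := Fintype.ofFinite 𝔤
  have := Fintype.ofFinite 𝔩
  have h1 : Function.Injective
      (TensorProduct.map (InvFun Ad₁).subtype (InvFun Ad₂).subtype) :=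
    TensorProduct.map_injective_of_flat_flat _ _ (Submodule.injective_subtype _)
      (Submodule.injective_subtype _)
  have h2 := (TensorProduct.piScalarRight ℝ ℝ (𝔤 → ℝ) 𝔩).injective
  have key : ∀ t : InvFun Ad₁ ⊗[ℝ] InvFun Ad₂, ∀ X Y,
      (TensorProduct.piScalarRight ℝ ℝ (𝔤 → ℝ) 𝔩)
        (TensorProduct.map (InvFun Ad₁).subtype (InvFun Ad₂).subtype t) Y X =
      (tensorToProd Ad₁ Ad₂ t).1 (X, Y) := by
    intro t X Y
    induction t with
    | zero => simp
    | add s t hs ht =>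
      rw [map_add, map_add, map_add, Pi.add_apply, Pi.add_apply, hs, ht]
      rfl
    | tmul f f' => simp [mul_comm]
  intro s t hst
  apply h1
  apply h2
  funext Y X
  rw [key, key, hst]

theorem tensorToProd_surjective [Finite 𝔤] [Finite 𝔩]
    (Ad₁ : G →* AddMonoid.End 𝔤) (Ad₂ : H →* AddMonoid.End 𝔩) :
    Function.Surjective (tensorToProd Ad₁ Ad₂) := by
  classical
  intro F
  let S : Setoid 𝔤 :=
    { r := fun X Y => ∃ g, Ad₁ g X = Y
      iseqv := ⟨fun X => ⟨1, by simp⟩,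
        fun {X Y} ⟨g, h⟩ => ⟨g⁻¹, by rw [← h, ad_inv_ad]⟩,
        fun {X Y Z} ⟨g, h⟩ ⟨g', h'⟩ => ⟨g' * g, by rw [ad_mul_apply, h, h']⟩⟩ }
  have := Fintype.ofFinite (Quotient S)
  refine ⟨∑ c : Quotient S,
    (⟨fun X => if (Quotient.mk S X) = c then 1 else 0, fun g X => by
      have : Quotient.mk S (Ad₁ g X) = Quotient.mk S X :=
        (Quotient.sound (s := S) ⟨g, rfl⟩).symm
      simp only [this]⟩ : InvFun Ad₁) ⊗ₜ
    (⟨fun Y => F.1 (c.out, Y), fun g Y => by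
      simpa using F.2 (1, g) (c.out, Y)⟩ : InvFun Ad₂), ?_⟩
  ext ⟨X, Y⟩
  simp only [map_sum, Submodule.coe_sum, Finset.sum_apply, tensorToProd_tmul]
  simp only [ite_mul, one_mul, zero_mul, Finset.sum_ite_eq, Finset.mem_univ, if_true]
  obtain ⟨g, hg⟩ : ∃ g, Ad₁ g (Quotient.mk S X).out = X :=
    Quotient.exact (s := S) (Quotient.out_eq _)
  have := F.2 (g, 1) ((Quotient.mk S X).out, Y)
  simp only [adProd_apply, hg, ad_one_apply] at this
  exact this.symm

/-- The canonical isomorphism `𝒞(𝔤) ⊗ 𝒞(𝔩) ≃ 𝒞(𝔤 × 𝔩)` for finite `𝔤`, `𝔩`. -/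
noncomputable def tensorEquiv [Finite 𝔤] [Finite 𝔩]
    (Ad₁ : G →* AddMonoid.End 𝔤) (Ad₂ : H →* AddMonoid.End 𝔩) :
    InvFun Ad₁ ⊗[ℝ] InvFun Ad₂ ≃ₗ[ℝ] InvFun (adProd Ad₁ Ad₂) :=
  LinearEquiv.ofBijective (tensorToProd Ad₁ Ad₂)
    ⟨tensorToProd_injective Ad₁ Ad₂, tensorToProd_surjective Ad₁ Ad₂⟩

/-- The data used by parabolic induction and restriction: a parabolic subgroup `P` of `G`, its Lie
algebra `par`, the Lie algebra `nil` of its unipotent radical, the Lie algebra `𝔩` of the Levi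
subgroup `H`, embedded by `incl`, and the projection `proj` of `par = incl 𝔩 ⊕ nil` onto `𝔩`
(the value of `proj` off `par` is irrelevant). -/
structure Parabolic (Ad : G →* AddMonoid.End 𝔤) (AdL : H →* AddMonoid.End 𝔩) where
  P : Subgroup G
  par : Set 𝔤
  nil : AddSubgroup 𝔤
  incl : 𝔩 → 𝔤
  proj : 𝔤 → 𝔩
  proj_incl_add : ∀ Y, ∀ Z ∈ nil, proj (incl Y + Z) = Y
  mem_par_iff : ∀ X, X ∈ par ↔ ∃ Z ∈ nil, X = incl (proj X) + Z
  ad_mem_par : ∀ p ∈ P, ∀ X ∈ par, Ad p X ∈ par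
  ad_mem_nil : ∀ p ∈ P, ∀ Z ∈ nil, Ad p Z ∈ nil
  proj_ad : ∀ p ∈ P, ∃ h, ∀ X ∈ par, proj (Ad p X) = AdL h (proj X)
  ad_incl : ∀ h, ∃ p ∈ P, ∀ Y, Ad p (incl Y) = incl (AdL h Y)

namespace Parabolic

variable {Ad : G →* AddMonoid.End 𝔤} {AdL : H →* AddMonoid.End 𝔩} (D : Parabolic Ad AdL)

theorem resFun_ad (Ψ : InvFun Ad) (h : H) (Y : 𝔩) :
    ∑ᶠ Z : D.nil, Ψ.1 (D.incl (AdL h Y) + Z) = ∑ᶠ Z : D.nil, Ψ.1 (D.incl Y + Z) := by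
  obtain ⟨p, hp, hpY⟩ := D.ad_incl h
  let e : D.nil ≃ D.nil :=
    { toFun := fun Z => ⟨Ad p Z, D.ad_mem_nil p hp _ Z.2⟩
      invFun := fun Z => ⟨Ad p⁻¹ Z, D.ad_mem_nil p⁻¹ (inv_mem hp) _ Z.2⟩
      left_inv := fun Z => Subtype.ext (by simp)
      right_inv := fun Z => Subtype.ext (by simp) }
  rw [← finsum_comp_equiv e]
  refine finsum_congr fun Z => ?_
  have : D.incl (AdL h Y) + (e Z : 𝔤) = Ad p (D.incl Y + Z) := by
    rw [map_add, hpY]; rfl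
  rw [this, Ψ.2]

/-- Parabolic restriction: `(↓Ψ)(Y) = |𝔲|⁻¹ ∑_{Z ∈ 𝔲} Ψ(Y + Z)`. -/
noncomputable def res [Finite 𝔤] : InvFun Ad →ₗ[ℝ] InvFun AdL where
  toFun Ψ := ⟨fun Y => (Nat.card D.nil : ℝ)⁻¹ * ∑ᶠ Z : D.nil, Ψ.1 (D.incl Y + Z),
    fun h Y => congrArg _ (D.resFun_ad Ψ h Y)⟩
  map_add' Ψ Ψ' := by
    ext Y
    simp only [Submodule.coe_add, Pi.add_apply]
    rw [finsum_add_distrib (Set.toFinite _) (Set.toFinite _), mul_add]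
  map_smul' c Ψ := by
    ext Y
    simp only [Submodule.coe_smul, Pi.smul_apply, RingHom.id_apply]
    rw [← smul_finsum, mul_smul_comm]

open Classical in
/-- Extension of a function on the Levi subalgebra to the parabolic subalgebra via the projection,
and by zero to the whole Lie algebra. -/
noncomputable def extend (Φ : 𝔩 → ℝ) (X : 𝔤) : ℝ :=
  if X ∈ D.par then Φ (D.proj X) else 0

theorem extend_ad (Φ : InvFun AdL) (p : G) (hp : p ∈ D.P) (X : 𝔤) :
    D.extend Φ.1 (Ad p X) = D.extend Φ.1 X := by
  have hiff : Ad p X ∈ D.par ↔ X ∈ D.par := by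
    refine ⟨fun h => ?_, D.ad_mem_par p hp X⟩
    have := D.ad_mem_par p⁻¹ (inv_mem hp) _ h
    simpa using this
  unfold extend
  by_cases h : X ∈ D.par
  · obtain ⟨k, hk⟩ := D.proj_ad p hp
    rw [if_pos h, if_pos (hiff.2 h), hk X h, Φ.2]
  · rw [if_neg h, if_neg (fun h' => h (hiff.1 h'))]

/-- The summand of parabolic induction depends only on the coset. -/
theorem extend_out (Φ : InvFun AdL) (g : G) (X : 𝔤) :
    D.extend Φ.1 (Ad ((g : G ⧸ D.P).out)⁻¹ X) = D.extend Φ.1 (Ad g⁻¹ X) := by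
  obtain ⟨p, hp⟩ := QuotientGroup.mk_out_eq_mul D.P g
  rw [hp, mul_inv_rev, ad_mul_apply]
  exact D.extend_ad Φ _ (inv_mem p.2) _

theorem indFun_ad (Φ : InvFun AdL) (g : G) (X : 𝔤) :
    ∑ᶠ c : G ⧸ D.P, D.extend Φ.1 (Ad c.out⁻¹ (Ad g X)) =
      ∑ᶠ c : G ⧸ D.P, D.extend Φ.1 (Ad c.out⁻¹ X) := by
  rw [← finsum_comp_equiv (MulAction.toPerm g : Equiv.Perm (G ⧸ D.P))]
  refine finsum_congr fun c => ?_
  induction c using QuotientGroup.induction_on with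
  | H x =>
    have : (MulAction.toPerm g : Equiv.Perm (G ⧸ D.P)) (x : G ⧸ D.P) = ((g * x : G) : G ⧸ D.P) :=
      rfl
    rw [this, extend_out, extend_out, ← ad_mul_apply]
    simp

/-- Parabolic induction: `(↑Φ)(X) = ∑_{g ∈ [G/P]} Φ'(Ad(g⁻¹) X)`. -/
noncomputable def ind [Finite G] : InvFun AdL →ₗ[ℝ] InvFun Ad where
  toFun Φ := ⟨fun X => ∑ᶠ c : G ⧸ D.P, D.extend Φ.1 (Ad c.out⁻¹ X), fun g X => D.indFun_ad Φ g X⟩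
  map_add' Φ Φ' := by
    ext X
    simp only [Submodule.coe_add, Pi.add_apply]
    rw [← finsum_add_distrib (Set.toFinite _) (Set.toFinite _)]
    refine finsum_congr fun c => ?_
    unfold extend; split_ifs <;> simp
  map_smul' c Φ := by
    ext X
    simp only [Submodule.coe_smul, Pi.smul_apply, RingHom.id_apply]
    rw [smul_finsum]
    refine finsum_congr fun c => ?_
    unfold extend; split_ifs <;> simp

end Parabolic

end General

/-! ### Block triangular matrices -/

section Block

variable {F : Type*} [Field F] {N κ : Type*} [Fintype N] [Fintype κ]

/-- The additive group of strictly block upper triangular matrices. -/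
def strictUpper (F : Type*) [Field F] {N : Type*} (b : N → ℕ) : AddSubgroup (Matrix N N F) where
  carrier := {Z | ∀ r s, b s ≤ b r → Z r s = 0}
  add_mem' := fun hX hY r s h => by simp [hX r s h, hY r s h]
  zero_mem' := fun _ _ _ => rfl
  neg_mem' := fun hX r s h => by simp [hX r s h]

theorem mul_submatrix_of_blockTriangular {b : N → ℕ} {M M' : Matrix N N F}
    (hM : M.BlockTriangular b) (hM' : M'.BlockTriangular b) (k : ℕ) (f : κ → N)
    (hf : Function.Injective f) (hk : ∀ r, b r = k ↔ r ∈ Set.range f) :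
    (M * M').submatrix f f = M.submatrix f f * M'.submatrix f f := by
  ext r s
  simp only [Matrix.submatrix_apply, Matrix.mul_apply]
  symm
  refine Fintype.sum_of_injective f hf _ _ (fun t ht => ?_) (fun t => rfl)
  have hr := (hk (f r)).2 ⟨r, rfl⟩
  have hs := (hk (f s)).2 ⟨s, rfl⟩
  have ht' : b t ≠ k := fun h => ht ((hk t).1 h)
  rcases lt_or_gt_of_ne ht' with h | h
  · rw [hM (by omega : b t < b (f r)), zero_mul]
  · rw [hM' (by omega : b (f s) < b t), mul_zero]

theorem strictUpper_mul_left {b : N → ℕ} {M Z : Matrix N N F}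
    (hM : M.BlockTriangular b) (hZ : Z ∈ strictUpper F b) : M * Z ∈ strictUpper F b := by
  intro r s h
  rw [Matrix.mul_apply]
  refine Finset.sum_eq_zero fun t _ => ?_
  rcases lt_or_ge (b t) (b r) with h' | h'
  · rw [hM h', zero_mul]
  · rw [hZ t s (h.trans h'), mul_zero]

theorem strictUpper_mul_right {b : N → ℕ} {M Z : Matrix N N F}
    (hM : M.BlockTriangular b) (hZ : Z ∈ strictUpper F b) : Z * M ∈ strictUpper F b := by
  intro r s h
  rw [Matrix.mul_apply]
  refine Finset.sum_eq_zero fun t _ => ?_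
  rcases lt_or_ge (b s) (b t) with h' | h'
  · rw [hM h', mul_zero]
  · rw [hZ r t (h'.trans h), zero_mul]

variable [DecidableEq N]

theorem blockTriangular_inv {b : N → ℕ} {g : GL N F}
    (hg : (g : Matrix N N F).BlockTriangular b) :
    ((g⁻¹ : GL N F) : Matrix N N F).BlockTriangular b := by
  have : Invertible (g : Matrix N N F) := g.invertible
  rw [Matrix.coe_units_inv]
  exact Matrix.blockTriangular_inv_of_blockTriangular hg

/-- The subgroup of block upper triangular matrices of `GL`. -/
def blockUpper (F : Type*) [Field F] (b : N → ℕ) : Subgroup (GL N F) where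
  carrier := {g | (g : Matrix N N F).BlockTriangular b}
  mul_mem' := fun hg hh => by
    simp only [Set.mem_ofPred_eq, Units.val_mul] at *
    exact hg.mul hh
  one_mem' := by
    simp only [Set.mem_ofPred_eq, Units.val_one]
    exact Matrix.blockTriangular_one
  inv_mem' := fun hg => blockTriangular_inv hg

/-- The adjoint action `X ↦ g X g⁻¹` of the general linear group on all matrices. -/
def adGL (F : Type*) [Field F] (N : Type*) [Fintype N] [DecidableEq N] :
    GL N F →* AddMonoid.End (Matrix N N F) where
  toFun g :=
    { toFun := fun X => (g : Matrix N N F) * X * ((g⁻¹ : GL N F) : Matrix N N F)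
      map_zero' := by simp
      map_add' := fun X Y => by simp only [mul_add, add_mul] }
  map_one' := AddMonoidHom.ext fun X => by
    change ((1 : GL N F) : Matrix N N F) * X * ((1⁻¹ : GL N F) : Matrix N N F) = X
    simp
  map_mul' g h := AddMonoidHom.ext fun X => by
    change ((g * h : GL N F) : Matrix N N F) * X * (((g * h)⁻¹ : GL N F) : Matrix N N F) =
      (g : Matrix N N F) * (h * X * ((h⁻¹ : GL N F) : Matrix N N F)) *
        ((g⁻¹ : GL N F) : Matrix N N F)
    rw [mul_inv_rev, Units.val_mul, Units.val_mul]
    simp only [mul_assoc]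

theorem adGL_apply (g : GL N F) (X : Matrix N N F) :
    adGL F N g X = (g : Matrix N N F) * X * ((g⁻¹ : GL N F) : Matrix N N F) := rfl

/-- The diagonal block of a block upper triangular invertible matrix, as an invertible matrix. -/
def diagBlock [DecidableEq κ] {b : N → ℕ} (g : GL N F)
    (hg : (g : Matrix N N F).BlockTriangular b) (k : ℕ) (f : κ → N)
    (hf : Function.Injective f) (hk : ∀ r, b r = k ↔ r ∈ Set.range f) : GL κ F where
  val := (g : Matrix N N F).submatrix f f
  inv := ((g⁻¹ : GL N F) : Matrix N N F).submatrix f f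
  val_inv := by
    rw [← mul_submatrix_of_blockTriangular hg (blockTriangular_inv hg) k f hf hk]
    simp [Matrix.submatrix_one _ hf]
  inv_val := by
    rw [← mul_submatrix_of_blockTriangular (blockTriangular_inv hg) hg k f hf hk]
    simp [Matrix.submatrix_one _ hf]

theorem adGL_submatrix [DecidableEq κ] {b : N → ℕ} (g : GL N F)
    (hg : (g : Matrix N N F).BlockTriangular b) (k : ℕ) (f : κ → N)
    (hf : Function.Injective f) (hk : ∀ r, b r = k ↔ r ∈ Set.range f) (X : Matrix N N F)
    (hX : X.BlockTriangular b) :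
    (adGL F N g X).submatrix f f = adGL F κ (diagBlock g hg k f hf hk) (X.submatrix f f) := by
  rw [adGL_apply, mul_submatrix_of_blockTriangular (hg.mul hX) (blockTriangular_inv hg) k f hf hk,
    mul_submatrix_of_blockTriangular hg hX k f hf hk]
  rfl

end Block

/-! ### General linear groups -/

section GLPart

variable (F : Type*) [Field F] {i j n : ℕ}

/-- The partition of `n` rows and columns into consecutive blocks of sizes `i`, `j`. -/
def glEquiv (h : i + j = n) : Fin i ⊕ Fin j ≃ Fin n :=
  finSumFinEquiv.trans (finCongr h)

/-- The number (`0` or `1`) of the block of a row. -/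
def glBlk (h : i + j = n) (r : Fin n) : ℕ :=
  Sum.elim (fun _ => 0) (fun _ => 1) ((glEquiv h).symm r)

theorem glBlk_zero (h : i + j = n) (r : Fin n) :
    glBlk h r = 0 ↔ r ∈ Set.range (fun a => glEquiv h (Sum.inl a)) := by
  obtain ⟨x, rfl⟩ := (glEquiv h).surjective r
  rcases x with x | x <;> simp [glBlk]

theorem glBlk_one (h : i + j = n) (r : Fin n) :
    glBlk h r = 1 ↔ r ∈ Set.range (fun a => glEquiv h (Sum.inr a)) := by
  obtain ⟨x, rfl⟩ := (glEquiv h).surjective r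
  rcases x with x | x <;> simp [glBlk]

/-- The block diagonal matrix `diag(A, B)`. -/
def glDiag (h : i + j = n) (Y : Matrix (Fin i) (Fin i) F × Matrix (Fin j) (Fin j) F) :
    Matrix (Fin n) (Fin n) F :=
  (Matrix.fromBlocks Y.1 0 0 Y.2).submatrix (glEquiv h).symm (glEquiv h).symm

theorem glDiag_mul (h : i + j = n) (Y Y' : Matrix (Fin i) (Fin i) F × Matrix (Fin j) (Fin j) F) :
    glDiag F h Y * glDiag F h Y' = glDiag F h (Y * Y') := by
  simp [glDiag, Matrix.submatrix_mul_equiv, Matrix.fromBlocks_multiply]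

theorem glDiag_one (h : i + j = n) : glDiag F h 1 = 1 := by
  simp [glDiag, Matrix.fromBlocks_one]

/-- The diagonal blocks of a matrix. -/
def glBlocks (h : i + j = n) (X : Matrix (Fin n) (Fin n) F) :
    Matrix (Fin i) (Fin i) F × Matrix (Fin j) (Fin j) F :=
  (X.submatrix (fun a => glEquiv h (Sum.inl a)) (fun a => glEquiv h (Sum.inl a)),
    X.submatrix (fun a => glEquiv h (Sum.inr a)) (fun a => glEquiv h (Sum.inr a)))

/-- The maximal parabolic subgroup `P_{i,j}` of `GL(n, F)` of block upper triangular matrices, with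
Levi subgroup `GL(i, F) × GL(j, F)` and unipotent radical `[[1, C], [0, 1]]`. -/
def glParabolic (h : i + j = n) :
    Parabolic (adGL F (Fin n)) (adProd (adGL F (Fin i)) (adGL F (Fin j))) where
  P := blockUpper F (glBlk h)
  par := {X | X.BlockTriangular (glBlk h)}
  nil := strictUpper F (glBlk h)
  incl := glDiag F h
  proj := glBlocks F h
  proj_incl_add := fun Y Z hZ => by
    refine Prod.ext ?_ ?_
    · ext r s
      simp [glBlocks, glDiag, hZ (glEquiv h (Sum.inl r)) (glEquiv h (Sum.inl s)) (by simp [glBlk])]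
    · ext r s
      simp [glBlocks, glDiag, hZ (glEquiv h (Sum.inr r)) (glEquiv h (Sum.inr s)) (by simp [glBlk])]
  mem_par_iff := fun X => by
    constructor
    · intro hX
      refine ⟨X - glDiag F h (glBlocks F h X), fun r s hrs => ?_, by abel⟩
      obtain ⟨x, rfl⟩ := (glEquiv h).surjective r
      obtain ⟨y, rfl⟩ := (glEquiv h).surjective s
      rcases x with x | x <;> rcases y with y | y
      · simp [glDiag, glBlocks]
      · simp [glBlk] at hrs
      · simpa [glDiag, glBlocks] using hX (show glBlk h _ < glBlk h _ by simp [glBlk])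
      · simp [glDiag, glBlocks]
    · rintro ⟨Z, hZ, hX⟩ r s hrs
      rw [hX]
      have h0 := hZ r s hrs.le
      obtain ⟨x, rfl⟩ := (glEquiv h).surjective r
      obtain ⟨y, rfl⟩ := (glEquiv h).surjective s
      rw [Matrix.add_apply, h0, add_zero]
      rcases x with x | x <;> rcases y with y | y <;> simp [glBlk] at hrs <;> simp [glDiag]
  ad_mem_par := fun p hp X hX => (hp.mul hX).mul (blockTriangular_inv hp)
  ad_mem_nil := fun p hp Z hZ =>
    strictUpper_mul_right (blockTriangular_inv hp) (strictUpper_mul_left hp hZ)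
  proj_ad := fun p hp => ⟨(diagBlock p hp 0 _ (fun a b hab => by simpa using hab) (glBlk_zero h),
      diagBlock p hp 1 _ (fun a b hab => by simpa using hab) (glBlk_one h)), fun X hX => by
    rw [adProd_apply]
    refine Prod.ext ?_ ?_
    · exact adGL_submatrix p hp 0 _ (fun a b hab => by simpa using hab) (glBlk_zero h) X hX
    · exact adGL_submatrix p hp 1 _ (fun a b hab => by simpa using hab) (glBlk_one h) X hX⟩
  ad_incl := fun g => by
    refine ⟨⟨glDiag F h (g.1, g.2), glDiag F h ((g.1⁻¹ : GL _ F), (g.2⁻¹ : GL _ F)), ?_, ?_⟩,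
      ?_, ?_⟩
    · rw [glDiag_mul, ← glDiag_one F h]; congr 1; simp [Prod.ext_iff]
    · rw [glDiag_mul, ← glDiag_one F h]; congr 1; simp [Prod.ext_iff]
    · intro r s hrs
      obtain ⟨x, rfl⟩ := (glEquiv h).surjective r
      obtain ⟨y, rfl⟩ := (glEquiv h).surjective s
      rcases x with x | x <;> rcases y with y | y <;> simp [glBlk, glDiag] at hrs ⊢
    · intro Y
      change glDiag F h _ * glDiag F h Y * glDiag F h _ = _
      rw [glDiag_mul, glDiag_mul]
      rfl

end GLPart

/-! ### Unitary groups -/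

section UIndex

variable {i j n : ℕ}

/-- The partition of `2n` rows and columns into consecutive blocks of sizes `i`, `2j`, `i`. -/
def uEquiv (h : i + j = n) : Fin i ⊕ (Fin (2 * j) ⊕ Fin i) ≃ Fin (2 * n) :=
  (((Equiv.refl _).sumCongr finSumFinEquiv).trans finSumFinEquiv).trans
    (finCongr (by omega))

/-- Positions of the rows of the first block. -/
def uFst (h : i + j = n) (a : Fin i) : Fin (2 * n) := uEquiv h (Sum.inl a)

/-- Positions of the rows of the middle block. -/
def uMid (h : i + j = n) (a : Fin (2 * j)) : Fin (2 * n) := uEquiv h (Sum.inr (Sum.inl a))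

/-- Positions of the rows of the last block. -/
def uLst (h : i + j = n) (a : Fin i) : Fin (2 * n) := uEquiv h (Sum.inr (Sum.inr a))

theorem rev_uFst (h : i + j = n) (a : Fin i) : (uFst h a).rev = uLst h a.rev := by
  ext; simp [uFst, uLst, uEquiv, Fin.val_rev]; omega

theorem rev_uMid (h : i + j = n) (a : Fin (2 * j)) : (uMid h a).rev = uMid h a.rev := by
  ext; simp [uMid, uEquiv, Fin.val_rev]; omega

theorem rev_uLst (h : i + j = n) (a : Fin i) : (uLst h a).rev = uFst h a.rev := by
  ext; simp [uFst, uLst, uEquiv, Fin.val_rev]; omega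

theorem u_cases (h : i + j = n) (r : Fin (2 * n)) :
    (∃ a, r = uFst h a) ∨ (∃ a, r = uMid h a) ∨ (∃ a, r = uLst h a) := by
  obtain ⟨x, rfl⟩ := (uEquiv h).surjective r
  rcases x with x | x | x
  · exact Or.inl ⟨x, rfl⟩
  · exact Or.inr (Or.inl ⟨x, rfl⟩)
  · exact Or.inr (Or.inr ⟨x, rfl⟩)

/-- The number (`0`, `1` or `2`) of the block of a row. -/
def uBlk (h : i + j = n) (r : Fin (2 * n)) : ℕ :=
  Sum.elim (fun _ => 0) (Sum.elim (fun _ => 1) (fun _ => 2)) ((uEquiv h).symm r)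

@[simp] theorem uBlk_uFst (h : i + j = n) (a : Fin i) : uBlk h (uFst h a) = 0 := by
  simp [uBlk, uFst]

@[simp] theorem uBlk_uMid (h : i + j = n) (a : Fin (2 * j)) : uBlk h (uMid h a) = 1 := by
  simp [uBlk, uMid]

@[simp] theorem uBlk_uLst (h : i + j = n) (a : Fin i) : uBlk h (uLst h a) = 2 := by
  simp [uBlk, uLst]

theorem uFst_injective (h : i + j = n) : Function.Injective (uFst h) := fun a b hab => by
  simpa [uFst] using hab

theorem uMid_injective (h : i + j = n) : Function.Injective (uMid h) := fun a b hab => by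
  simpa [uMid] using hab

theorem uBlk_zero (h : i + j = n) (r : Fin (2 * n)) : uBlk h r = 0 ↔ r ∈ Set.range (uFst h) := by
  obtain ⟨x, rfl⟩ := (uEquiv h).surjective r
  rcases x with x | x | x <;> simp [uBlk, uFst]

theorem uBlk_one (h : i + j = n) (r : Fin (2 * n)) : uBlk h r = 1 ↔ r ∈ Set.range (uMid h) := by
  obtain ⟨x, rfl⟩ := (uEquiv h).surjective r
  rcases x with x | x | x <;> simp [uBlk, uMid]

end UIndex

section UPart

variable (F : Type*) [Field F]

/-- The matrix `J_m` with ones on the second diagonal. -/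
def J (m : ℕ) : Matrix (Fin m) (Fin m) F :=
  Matrix.of fun r s => if s = Fin.rev r then 1 else 0

variable {m i j n : ℕ}

theorem J_mul (X : Matrix (Fin m) (Fin m) F) (r s : Fin m) : (J F m * X) r s = X r.rev s := by
  simp [J, Matrix.mul_apply]

theorem mul_J (X : Matrix (Fin m) (Fin m) F) (r s : Fin m) : (X * J F m) r s = X r s.rev := by
  have h : ∀ t : Fin m, (s = t.rev) ↔ (s.rev = t) := fun t => by rw [Fin.rev_eq_iff]
  simp [J, Matrix.mul_apply, h]

theorem J_mul_J : J F m * J F m = 1 := by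
  ext r s
  rw [J_mul]
  simp [J, Matrix.one_apply, eq_comm]

/-- The block diagonal matrix `diag(A, B, C)`. -/
def uDiag (h : i + j = n) (A : Matrix (Fin i) (Fin i) F) (B : Matrix (Fin (2 * j)) (Fin (2 * j)) F)
    (C : Matrix (Fin i) (Fin i) F) : Matrix (Fin (2 * n)) (Fin (2 * n)) F :=
  (Matrix.fromBlocks A 0 0 (Matrix.fromBlocks B 0 0 C)).submatrix (uEquiv h).symm (uEquiv h).symm

theorem uDiag_mul (h : i + j = n) (A A' C C' : Matrix (Fin i) (Fin i) F)
    (B B' : Matrix (Fin (2 * j)) (Fin (2 * j)) F) :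
    uDiag F h A B C * uDiag F h A' B' C' = uDiag F h (A * A') (B * B') (C * C') := by
  simp [uDiag, Matrix.submatrix_mul_equiv, Matrix.fromBlocks_multiply]

theorem uDiag_one (h : i + j = n) : uDiag F h 1 1 1 = 1 := by
  simp [uDiag, Matrix.fromBlocks_one]

theorem uDiag_blockTriangular (h : i + j = n) (A C : Matrix (Fin i) (Fin i) F)
    (B : Matrix (Fin (2 * j)) (Fin (2 * j)) F) :
    (uDiag F h A B C).BlockTriangular (uBlk h) := by
  intro r s hrs
  rcases u_cases h r with ⟨a, rfl⟩ | ⟨a, rfl⟩ | ⟨a, rfl⟩ <;>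
  rcases u_cases h s with ⟨b, rfl⟩ | ⟨b, rfl⟩ | ⟨b, rfl⟩ <;>
  simp at hrs <;> simp [uDiag, uFst, uMid, uLst]

theorem neg_uDiag (h : i + j = n) (A C : Matrix (Fin i) (Fin i) F)
    (B : Matrix (Fin (2 * j)) (Fin (2 * j)) F) :
    -uDiag F h A B C = uDiag F h (-A) (-B) (-C) := by
  ext r s
  rcases u_cases h r with ⟨a, rfl⟩ | ⟨a, rfl⟩ | ⟨a, rfl⟩ <;>
  rcases u_cases h s with ⟨b, rfl⟩ | ⟨b, rfl⟩ | ⟨b, rfl⟩ <;>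
  simp [uDiag, uFst, uMid, uLst]

variable [StarRing F]

/-- The antilinear antiautomorphism `X ↦ J X^* J` of the matrix algebra. -/
def tau (X : Matrix (Fin m) (Fin m) F) : Matrix (Fin m) (Fin m) F := J F m * Xᴴ * J F m

theorem tau_apply (X : Matrix (Fin m) (Fin m) F) (r s : Fin m) :
    tau F X r s = star (X s.rev r.rev) := by
  rw [tau, mul_J, J_mul]; rfl

theorem tau_mul (X Y : Matrix (Fin m) (Fin m) F) : tau F (X * Y) = tau F Y * tau F X := by
  have h : tau F Y * tau F X = J F m * Yᴴ * (J F m * J F m) * Xᴴ * J F m := by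
    simp only [tau, mul_assoc]
  rw [h, J_mul_J, tau, Matrix.conjTranspose_mul]
  simp only [mul_assoc, one_mul]

theorem tau_one : tau F (1 : Matrix (Fin m) (Fin m) F) = 1 := by
  simp [tau, J_mul_J]

theorem tau_tau (X : Matrix (Fin m) (Fin m) F) : tau F (tau F X) = X := by
  ext r s; simp [tau_apply]

/-- `ω_m(X) = - J_m X^* J_m`. -/
def omegaMat (X : Matrix (Fin m) (Fin m) F) : Matrix (Fin m) (Fin m) F := -(J F m * Xᴴ * J F m)

theorem omegaMat_eq (X : Matrix (Fin m) (Fin m) F) : omegaMat F X = -tau F X := rfl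

theorem omegaMat_apply (X : Matrix (Fin m) (Fin m) F) (r s : Fin m) :
    omegaMat F X r s = -star (X s.rev r.rev) := by
  rw [omegaMat_eq, Matrix.neg_apply, tau_apply]

/-- The invertible matrix `J (g^*)⁻¹ J`. -/
def tauInv (g : GL (Fin m) F) : GL (Fin m) F where
  val := tau F ((g⁻¹ : GL (Fin m) F) : Matrix (Fin m) (Fin m) F)
  inv := tau F (g : Matrix (Fin m) (Fin m) F)
  val_inv := by rw [← tau_mul, Units.mul_inv, tau_one]
  inv_val := by rw [← tau_mul, Units.inv_mul, tau_one]

theorem omegaMat_ad (g : GL (Fin m) F) (X : Matrix (Fin m) (Fin m) F) :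
    omegaMat F (adGL F (Fin m) g X) = adGL F (Fin m) (tauInv F g) (omegaMat F X) := by
  change _ = tau F ((g⁻¹ : GL (Fin m) F) : Matrix (Fin m) (Fin m) F) * omegaMat F X *
    tau F (g : Matrix (Fin m) (Fin m) F)
  rw [adGL_apply, omegaMat_eq, omegaMat_eq, tau_mul, tau_mul]
  simp [mul_assoc]

/-- The finite unitary group `{g | g^* J g = J}`. -/
def unitaryGrp (m : ℕ) : Subgroup (GL (Fin m) F) where
  carrier := {g | (g : Matrix (Fin m) (Fin m) F)ᴴ * J F m * (g : Matrix (Fin m) (Fin m) F) = J F m}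
  mul_mem' := fun {g h} hg hh => by
    simp only [Set.mem_ofPred_eq, Units.val_mul, Matrix.conjTranspose_mul] at *
    calc _ = (h : Matrix (Fin m) (Fin m) F)ᴴ * ((g : Matrix (Fin m) (Fin m) F)ᴴ * J F m *
          (g : Matrix (Fin m) (Fin m) F)) * (h : Matrix (Fin m) (Fin m) F) := by
          simp only [mul_assoc]
      _ = _ := by rw [hg, hh]
  one_mem' := by simp
  inv_mem' := fun {g} hg => by
    simp only [Set.mem_ofPred_eq] at *
    have h1 : (g : Matrix (Fin m) (Fin m) F) * ((g⁻¹ : GL (Fin m) F) : Matrix (Fin m) (Fin m) F)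
      = 1 := Units.mul_inv g
    have h2 : ((g⁻¹ : GL (Fin m) F) : Matrix (Fin m) (Fin m) F)ᴴ *
        (g : Matrix (Fin m) (Fin m) F)ᴴ = 1 := by
      rw [← Matrix.conjTranspose_mul, h1, Matrix.conjTranspose_one]
    calc _ = ((g⁻¹ : GL (Fin m) F) : Matrix (Fin m) (Fin m) F)ᴴ *
          ((g : Matrix (Fin m) (Fin m) F)ᴴ * J F m * (g : Matrix (Fin m) (Fin m) F)) *
          ((g⁻¹ : GL (Fin m) F) : Matrix (Fin m) (Fin m) F) := by rw [hg]
      _ = (((g⁻¹ : GL (Fin m) F) : Matrix (Fin m) (Fin m) F)ᴴ *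
          (g : Matrix (Fin m) (Fin m) F)ᴴ) * J F m * ((g : Matrix (Fin m) (Fin m) F) *
          ((g⁻¹ : GL (Fin m) F) : Matrix (Fin m) (Fin m) F)) := by simp only [mul_assoc]
      _ = _ := by rw [h1, h2, one_mul, mul_one]

theorem mem_unitaryGrp (g : GL (Fin m) F) : g ∈ unitaryGrp F m ↔
    tau F (g : Matrix (Fin m) (Fin m) F) * (g : Matrix (Fin m) (Fin m) F) = 1 := by
  have hJ := J_mul_J F (m := m)
  change _ = _ ↔ _
  rw [tau]
  constructor
  · intro h
    rw [mul_assoc, mul_assoc, ← mul_assoc _ (J F m), h, hJ]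
  · intro h
    have := congrArg (J F m * ·) h
    simp only [mul_one] at this
    rw [mul_assoc (J F m), mul_assoc (J F m), ← mul_assoc (J F m) (J F m), hJ, one_mul] at this
    exact this

/-- The unitary Lie algebra `{X | X^* J + J X = 0}`. -/
def unitaryLie (m : ℕ) : AddSubgroup (Matrix (Fin m) (Fin m) F) where
  carrier := {X | Xᴴ * J F m + J F m * X = 0}
  add_mem' := fun {X Y} hX hY => by
    simp only [Set.mem_ofPred_eq, Matrix.conjTranspose_add, add_mul, mul_add] at *
    rw [add_add_add_comm, hX, hY, add_zero]
  zero_mem' := by simp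
  neg_mem' := fun {X} hX => by
    simp only [Set.mem_ofPred_eq, Matrix.conjTranspose_neg, neg_mul, mul_neg] at *
    rw [← neg_add, hX, neg_zero]

theorem mem_unitaryLie (X : Matrix (Fin m) (Fin m) F) :
    X ∈ unitaryLie F m ↔ omegaMat F X = X := by
  have hJ := J_mul_J F (m := m)
  change _ = _ ↔ _
  rw [omegaMat, neg_eq_iff_add_eq_zero]
  constructor
  · intro h
    have := congrArg (J F m * ·) h
    simpa [mul_add, ← mul_assoc, hJ] using this
  · intro h
    have := congrArg (J F m * ·) h
    simpa [mul_add, ← mul_assoc, hJ] using this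

theorem ad_mem_unitaryLie {g : GL (Fin m) F} (hg : g ∈ unitaryGrp F m)
    {X : Matrix (Fin m) (Fin m) F} (hX : X ∈ unitaryLie F m) :
    adGL F (Fin m) g X ∈ unitaryLie F m := by
  rw [mem_unitaryLie] at *
  rw [omegaMat_ad, hX]
  have : tauInv F g = g := by
    exact inv_mul_eq_one.1 (Units.ext ((mem_unitaryGrp F g).1 hg))
  rw [this]

/-- The adjoint action `X ↦ g X g⁻¹` of the unitary group on its Lie algebra. -/
def adU (m : ℕ) : unitaryGrp F m →* AddMonoid.End (unitaryLie F m) where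
  toFun g :=
    { toFun := fun X => ⟨adGL F (Fin m) g X, ad_mem_unitaryLie F g.2 X.2⟩
      map_zero' := Subtype.ext (by simp)
      map_add' := fun X Y => Subtype.ext (by simp) }
  map_one' := AddMonoidHom.ext fun X => Subtype.ext (ad_one_apply (adGL F (Fin m)) X.1)
  map_mul' g h := AddMonoidHom.ext fun X => Subtype.ext
    (ad_mul_apply (adGL F (Fin m)) g.1 h.1 X.1)

theorem tau_uDiag (h : i + j = n) (A C : Matrix (Fin i) (Fin i) F)
    (B : Matrix (Fin (2 * j)) (Fin (2 * j)) F) :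
    tau F (uDiag F h A B C) = uDiag F h (tau F C) (tau F B) (tau F A) := by
  ext r s
  rcases u_cases h r with ⟨a, rfl⟩ | ⟨a, rfl⟩ | ⟨a, rfl⟩ <;>
  rcases u_cases h s with ⟨b, rfl⟩ | ⟨b, rfl⟩ | ⟨b, rfl⟩ <;>
  simp only [tau_apply, rev_uFst, rev_uMid, rev_uLst] <;>
  simp [uDiag, uFst, uMid, uLst, tau_apply]

theorem uDiag_mem (h : i + j = n) (A : Matrix (Fin i) (Fin i) F) (B : unitaryLie F (2 * j)) :
    uDiag F h A B.1 (omegaMat F A) ∈ unitaryLie F (2 * n) := by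
  rw [mem_unitaryLie, omegaMat_eq, tau_uDiag, neg_uDiag, ← omegaMat_eq, ← omegaMat_eq,
    ← omegaMat_eq, (mem_unitaryLie F _).1 B.2, omegaMat_eq F (omegaMat F A), omegaMat_eq F A]
  congr 1
  ext r s
  simp [tau_apply]

theorem tau_submatrix_uMid (h : i + j = n) (X : Matrix (Fin (2 * n)) (Fin (2 * n)) F) :
    tau F (X.submatrix (uMid h) (uMid h)) = (tau F X).submatrix (uMid h) (uMid h) := by
  ext r s
  simp [tau_apply, rev_uMid]

theorem uMid_mem (h : i + j = n) {X : Matrix (Fin (2 * n)) (Fin (2 * n)) F}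
    (hX : X ∈ unitaryLie F (2 * n)) : X.submatrix (uMid h) (uMid h) ∈ unitaryLie F (2 * j) := by
  rw [mem_unitaryLie] at *
  rw [omegaMat_eq, tau_submatrix_uMid]
  exact congrArg (fun M : Matrix _ _ F => M.submatrix (uMid h) (uMid h)) hX

/-- The element `diag(A, B, ω(A))` of the unitary Lie algebra. -/
def uIncl (h : i + j = n) (Y : Matrix (Fin i) (Fin i) F × unitaryLie F (2 * j)) :
    unitaryLie F (2 * n) :=
  ⟨uDiag F h Y.1 Y.2.1 (omegaMat F Y.1), uDiag_mem F h Y.1 Y.2⟩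

/-- The first and the middle diagonal blocks of an element of the unitary Lie algebra. -/
def uBlocks (h : i + j = n) (X : unitaryLie F (2 * n)) :
    Matrix (Fin i) (Fin i) F × unitaryLie F (2 * j) :=
  (X.1.submatrix (uFst h) (uFst h), ⟨X.1.submatrix (uMid h) (uMid h), uMid_mem F h X.2⟩)

theorem uLst_entry (h : i + j = n) {X : Matrix (Fin (2 * n)) (Fin (2 * n)) F}
    (hX : X ∈ unitaryLie F (2 * n)) (a b : Fin i) :
    X (uLst h a) (uLst h b) = omegaMat F (X.submatrix (uFst h) (uFst h)) a b := by
  rw [mem_unitaryLie] at hX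
  conv_lhs => rw [← hX]
  simp [omegaMat_apply, rev_uLst]

theorem diagBlock_mem (h : i + j = n) (p : unitaryGrp F (2 * n))
    (hp : (p.1 : Matrix (Fin (2 * n)) (Fin (2 * n)) F).BlockTriangular (uBlk h)) :
    diagBlock p.1 hp 1 (uMid h) (uMid_injective h) (uBlk_one h) ∈ unitaryGrp F (2 * j) := by
  rw [mem_unitaryGrp]
  have h1 : tau F (p.1 : Matrix (Fin (2 * n)) (Fin (2 * n)) F) =
      ((p.1⁻¹ : GL (Fin (2 * n)) F) : Matrix (Fin (2 * n)) (Fin (2 * n)) F) :=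
    eq_comm.1 (Units.inv_eq_of_mul_eq_one_left ((mem_unitaryGrp F p.1).1 p.2))
  change tau F ((p.1 : Matrix (Fin (2 * n)) (Fin (2 * n)) F).submatrix (uMid h) (uMid h)) * _ = 1
  rw [tau_submatrix_uMid, h1]
  exact (diagBlock p.1 hp 1 (uMid h) (uMid_injective h) (uBlk_one h)).inv_val

/-- The element `diag(A, B, J (A^*)⁻¹ J)` of the unitary group. -/
def uLevi (h : i + j = n) (g : GL (Fin i) F × unitaryGrp F (2 * j)) : unitaryGrp F (2 * n) :=
  ⟨⟨uDiag F h g.1 g.2.1 (tauInv F g.1), uDiag F h (g.1⁻¹ : GL (Fin i) F)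
      (g.2.1⁻¹ : GL (Fin (2 * j)) F) ((tauInv F g.1)⁻¹ : GL (Fin i) F),
    by simp [uDiag_mul, uDiag_one], by simp [uDiag_mul, uDiag_one]⟩, by
    rw [mem_unitaryGrp]
    change tau F (uDiag F h _ _ _) * uDiag F h _ _ _ = 1
    rw [tau_uDiag, uDiag_mul, (mem_unitaryGrp F g.2.1).1 g.2.2, ← uDiag_one F h]
    congr 1
    · change tau F (tau F _) * _ = 1
      rw [tau_tau]; exact Units.inv_mul g.1
    · exact Units.inv_mul (tauInv F g.1)⟩

/-- The maximal parabolic subgroup of `U(2n)` of block upper triangular matrices with respect to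
`2n = i + 2j + i`, with Levi subgroup `GL(i) × U(2j)` embedded by `diag(A, B, J (A^*)⁻¹ J)`. -/
def uParabolic (h : i + j = n) :
    Parabolic (adU F (2 * n)) (adProd (adGL F (Fin i)) (adU F (2 * j))) where
  P := (blockUpper F (uBlk h)).subgroupOf (unitaryGrp F (2 * n))
  par := {X | X.1.BlockTriangular (uBlk h)}
  nil := (strictUpper F (uBlk h)).addSubgroupOf (unitaryLie F (2 * n))
  incl := uIncl F h
  proj := uBlocks F h
  proj_incl_add := fun Y Z hZ => by
    refine Prod.ext ?_ (Subtype.ext ?_)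
    · ext r s
      have : Z.1 (uFst h r) (uFst h s) = 0 := hZ (uFst h r) (uFst h s) (by simp)
      change uDiag F h _ _ _ (uFst h r) (uFst h s) + Z.1 (uFst h r) (uFst h s) = _
      rw [this]
      simp [uDiag, uFst]
    · ext r s
      have : Z.1 (uMid h r) (uMid h s) = 0 := hZ (uMid h r) (uMid h s) (by simp)
      change uDiag F h _ _ _ (uMid h r) (uMid h s) + Z.1 (uMid h r) (uMid h s) = _
      rw [this]
      simp [uDiag, uMid]
  mem_par_iff := fun X => by
    constructor
    · intro hX
      refine ⟨X - uIncl F h (uBlocks F h X), fun r s hrs => ?_, by abel⟩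
      change X.1 r s - uDiag F h _ _ _ r s = 0
      rcases u_cases h r with ⟨a, rfl⟩ | ⟨a, rfl⟩ | ⟨a, rfl⟩ <;>
      rcases u_cases h s with ⟨b, rfl⟩ | ⟨b, rfl⟩ | ⟨b, rfl⟩
      · simp [uDiag, uBlocks, uFst]
      · simp at hrs
      · simp at hrs
      · rw [hX (by simp)]; simp [uDiag, uFst, uMid]
      · simp [uDiag, uBlocks, uMid]
      · simp at hrs
      · rw [hX (by simp)]; simp [uDiag, uFst, uLst]
      · rw [hX (by simp)]; simp [uDiag, uMid, uLst]
      · rw [uLst_entry F h X.2]; simp [uDiag, uBlocks, uLst]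
    · rintro ⟨Z, hZ, hX⟩ r s hrs
      have h0 : Z.1 r s = 0 := hZ r s hrs.le
      rw [hX]
      change uDiag F h _ _ _ r s + Z.1 r s = 0
      rw [h0, uDiag_blockTriangular F h _ _ _ hrs, add_zero]
  ad_mem_par := fun p hp X hX => by
    change (adGL F _ p.1 X.1).BlockTriangular _
    exact (Matrix.BlockTriangular.mul (Matrix.BlockTriangular.mul hp hX) (blockTriangular_inv hp))
  ad_mem_nil := fun p hp Z hZ =>
    strictUpper_mul_right (blockTriangular_inv hp) (strictUpper_mul_left hp hZ)
  proj_ad := fun p hp => ⟨(diagBlock p.1 hp 0 _ (uFst_injective h) (uBlk_zero h),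
      ⟨diagBlock p.1 hp 1 _ (uMid_injective h) (uBlk_one h), diagBlock_mem F h p hp⟩),
    fun X hX => by
      rw [adProd_apply]
      refine Prod.ext ?_ (Subtype.ext ?_)
      · exact adGL_submatrix p.1 hp 0 _ (uFst_injective h) (uBlk_zero h) X.1 hX
      · exact adGL_submatrix p.1 hp 1 _ (uMid_injective h) (uBlk_one h) X.1 hX⟩
  ad_incl := fun g => ⟨uLevi F h g, uDiag_blockTriangular F h _ _ _, fun Y => Subtype.ext (by
    change uDiag F h _ _ _ * uDiag F h _ _ _ * uDiag F h _ _ _ =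
      uDiag F h _ _ (omegaMat F (adGL F _ g.1 Y.1))
    rw [uDiag_mul, uDiag_mul, omegaMat_ad]
    rfl)⟩

end UPart

/-! ### The bialgebra `A` and the comodule `B` -/

section AB

variable (F : Type*) [Field F]

/-- `A = ⨁ₙ 𝒞(𝔤𝔩(n, F))`. -/
abbrev AlgA : Type _ := DirectSum ℕ fun n => InvFun (adGL F (Fin n))

/-- `B = ⨁ₙ 𝒞(𝔲(2n, F))`. -/
abbrev ModB [StarRing F] : Type _ := DirectSum ℕ fun n => InvFun (adU F (2 * n))

variable [Finite F]

/-- The multiplication `∇ : A ⊗ A → A`, given by parabolic induction. -/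
noncomputable def nabla : AlgA F ⊗[ℝ] AlgA F →ₗ[ℝ] AlgA F :=
  TensorProduct.lift (DirectSum.toModule ℝ ℕ _ fun i => LinearMap.flip
    (DirectSum.toModule ℝ ℕ _ fun j => LinearMap.flip (TensorProduct.curry
      (DirectSum.lof ℝ ℕ (fun n => InvFun (adGL F (Fin n))) (i + j) ∘ₗ
        (glParabolic F (rfl : i + j = i + j)).ind ∘ₗ
        (tensorEquiv (adGL F (Fin i)) (adGL F (Fin j))).toLinearMap))))

/-- The comultiplication `Δ : A → A ⊗ A`, given by parabolic restriction. -/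
noncomputable def delta : AlgA F →ₗ[ℝ] AlgA F ⊗[ℝ] AlgA F :=
  DirectSum.toModule ℝ ℕ _ fun n => ∑ x : Finset.HasAntidiagonal.antidiagonal n,
    TensorProduct.map
        (DirectSum.lof ℝ ℕ (fun n => InvFun (adGL F (Fin n))) x.1.1)
        (DirectSum.lof ℝ ℕ (fun n => InvFun (adGL F (Fin n))) x.1.2) ∘ₗ
      (tensorEquiv (adGL F (Fin x.1.1)) (adGL F (Fin x.1.2))).symm.toLinearMap ∘ₗ
      (glParabolic F (Finset.HasAntidiagonal.mem_antidiagonal.1 x.2)).res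

variable [StarRing F]

/-- The action `∇̃ : A ⊗ B → B`, `a ⊗ b ↦ a · b`, given by parabolic induction. -/
noncomputable def nablaTilde : AlgA F ⊗[ℝ] ModB F →ₗ[ℝ] ModB F :=
  TensorProduct.lift (DirectSum.toModule ℝ ℕ _ fun i => LinearMap.flip
    (DirectSum.toModule ℝ ℕ _ fun j => LinearMap.flip (TensorProduct.curry
      (DirectSum.lof ℝ ℕ (fun n => InvFun (adU F (2 * n))) (i + j) ∘ₗ
        (uParabolic F (rfl : i + j = i + j)).ind ∘ₗ
        (tensorEquiv (adGL F (Fin i)) (adU F (2 * j))).toLinearMap))))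

/-- The coaction `Δ̃ : B → A ⊗ B`, given by parabolic restriction. -/
noncomputable def deltaTilde : ModB F →ₗ[ℝ] AlgA F ⊗[ℝ] ModB F :=
  DirectSum.toModule ℝ ℕ _ fun n => ∑ x : Finset.HasAntidiagonal.antidiagonal n,
    TensorProduct.map
        (DirectSum.lof ℝ ℕ (fun n => InvFun (adGL F (Fin n))) x.1.1)
        (DirectSum.lof ℝ ℕ (fun n => InvFun (adU F (2 * n))) x.1.2) ∘ₗ
      (tensorEquiv (adGL F (Fin x.1.1)) (adU F (2 * x.1.2))).symm.toLinearMap ∘ₗ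
      (uParabolic F (Finset.HasAntidiagonal.mem_antidiagonal.1 x.2)).res

end AB

/-! ### The twist -/

section Twist

variable (F : Type*) [Field F] [StarRing F]

/-- The map `f ↦ f ∘ ω_n` on `𝒞(𝔤𝔩(n, F))` induced by the involution `ω_n`. -/
def omegaInv (n : ℕ) : InvFun (adGL F (Fin n)) →ₗ[ℝ] InvFun (adGL F (Fin n)) where
  toFun f := ⟨fun X => f.1 (omegaMat F X), fun g X => by
    change f.1 (omegaMat F (adGL F (Fin n) g X)) = f.1 (omegaMat F X)
    rw [omegaMat_ad, f.2]⟩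
  map_add' _ _ := rfl
  map_smul' _ _ := rfl

/-- The graded linear map `ω : A → A`. -/
noncomputable def omega : AlgA F →ₗ[ℝ] AlgA F :=
  DirectSum.toModule ℝ ℕ _ fun n =>
    DirectSum.lof ℝ ℕ (fun n => InvFun (adGL F (Fin n))) n ∘ₗ omegaInv F n

variable [Finite F]

/-- The linear map sending `(a₁ ⊗ a₂) ⊗ a₃` to the endomorphism
`a' ⊗ b ↦ a₁ ω(a₂) a' ⊗ a₃ · b` of `A ⊗ B`. -/
noncomputable def twistedTriple : (AlgA F ⊗[ℝ] AlgA F) ⊗[ℝ] AlgA F →ₗ[ℝ]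
    (AlgA F ⊗[ℝ] ModB F →ₗ[ℝ] AlgA F ⊗[ℝ] ModB F) :=
  TensorProduct.homTensorHomMap (RingHom.id ℝ) (AlgA F) (ModB F) (AlgA F) (ModB F) ∘ₗ
    TensorProduct.map
      (TensorProduct.curry (nabla F) ∘ₗ nabla F ∘ₗ TensorProduct.map LinearMap.id (omega F))
      (TensorProduct.curry (nablaTilde F))

theorem twistedTriple_tmul (a₁ a₂ a₃ a' : AlgA F) (b : ModB F) :
    twistedTriple F ((a₁ ⊗ₜ a₂) ⊗ₜ a₃) (a' ⊗ₜ b) =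
      nabla F (nabla F (a₁ ⊗ₜ omega F a₂) ⊗ₜ a') ⊗ₜ nablaTilde F (a₃ ⊗ₜ b) := rfl

/-- The twisted action `⊙ : A ⊗ (A ⊗ B) → A ⊗ B`,
`a ⊙ (a' ⊗ b) = ∑ a₍₁₎ ω(a₍₂₎) a' ⊗ a₍₃₎ · b`, with `(Δ ⊗ id) Δ(a) = ∑ a₍₁₎ ⊗ a₍₂₎ ⊗ a₍₃₎`. -/
noncomputable def odot : AlgA F ⊗[ℝ] (AlgA F ⊗[ℝ] ModB F) →ₗ[ℝ] AlgA F ⊗[ℝ] ModB F :=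
  TensorProduct.lift
    (twistedTriple F ∘ₗ TensorProduct.map (delta F) LinearMap.id ∘ₗ delta F)

end Twist

/-! ### The involution of a field with `q²` elements -/

section Frobenius

variable {F : Type*} [Field F] [Finite F]

/-- The structure of a ring with involution `x^* = x^q` on a field with `q²` elements. -/
@[reducible] def frobeniusStar (q : ℕ) (hF : Nat.card F = q ^ 2) : StarRing F where
  star x := x ^ q
  star_involutive x := by
    have := Fintype.ofFinite F
    change (x ^ q) ^ q = x
    rw [← pow_mul, ← sq, ← hF, Nat.card_eq_fintype_card, FiniteField.pow_card]
  star_mul x y := by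
    change (x * y) ^ q = y ^ q * x ^ q
    rw [mul_pow, mul_comm]
  star_add x y := by
    have := Fintype.ofFinite F
    obtain ⟨p, hp⟩ := CharP.exists F
    obtain ⟨k, hprime, hk⟩ := FiniteField.card F p
    have : Fact p.Prime := ⟨hprime⟩
    have hdvd : q ∣ p ^ (k : ℕ) := by
      rw [← hk, ← Nat.card_eq_fintype_card, hF]
      exact dvd_pow_self q two_ne_zero
    obtain ⟨l, -, rfl⟩ := (Nat.dvd_prime_pow hprime).1 hdvd
    change (x + y) ^ p ^ l = x ^ p ^ l + y ^ p ^ l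
    exact add_pow_char_pow x y p l

end Frobenius

end LieInv

/-! The theorem is a Mackey formula. Let `P` be the parabolic of `U(2n)` of type `(i, 2j, i)`, from
which one induces, and `P'` the one of type `(k, 2l, k)`, to which one restricts. Both operations
are averages (`Parabolic.ind_apply`, `Parabolic.res_apply`), so the restriction of an induced
function is an average over `g` in `U(2n)` and over `Z` in the nilradical of `P'`. It splits into
one term for each double coset `P' w P` (`res_ind_apply`).

These double cosets are the relative positions of an isotropic subspace `W` of dimension `i` and an
isotropic subspace `E` of dimension `k`. A position is given by `r = dim (W ⊓ E)`, `r + s = dim (W ⊓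
E^⊥)` and `t = i - r - s`, and has a permutation matrix `w` as representative. Each position is
reached by choosing hyperbolic pairs adapted to `E` and `W` at once (`exists_adaptedBasis`,
`position_exists`). Different positions are told apart by counting vectors (`position_unique`).

For a fixed position, the part of the nilradical of `P'` lying in `w P w⁻¹` maps onto the product of
the nilradical of type `(r, s, t)` in `gl(i)` and the nilradical of type `(j₁, 2j₂, j₁)` in `u(2j)`.
The average over `Z` therefore becomes a product of restrictions of `a` and of `b`
(`Position.avg_nil_extend`). The average over the Levi quotient of `P'` then induces from sizes `r,
j₁, t` to `gl(k)` and from sizes `s, j₂` to `u(2l)`. The block of size `t` travels from the first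
diagonal block to the last one, where a Levi element carries `ω` of its first block. This is the
source of the twist `ω(a₍₂₎)`. The numerical factors cancel because the unipotent groups have as
many elements as their Lie algebras, by the Cayley transform (`card_unipotent_eq`).

One discrepancy remains: the double coset produces the orders `r, s, t` and `r, j₁, t`, while the
theorem uses `r, t, s` and `r, t, j₁`. It disappears because `A` is commutative and cocommutative.
Every matrix is conjugate to its transpose (`exists_conj_transpose`), so invariant functions do not
notice transposition in the second diagonal, which reverses the order of the blocks (`res3_perm`,
`ind3_perm`). Oddness of `q` enters through the Cayley transform and through the choice of isotropic
dual vectors. -/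

namespace LieInv

/-! ### Averages over finite types -/

section Avg

variable {α β γ : Type*}

/-- The average of a real function over a finite type. -/
noncomputable def avg (f : α → ℝ) : ℝ := (Nat.card α : ℝ)⁻¹ * ∑ᶠ x, f x

theorem avg_eq_sum [Fintype α] (f : α → ℝ) : avg f = (Nat.card α : ℝ)⁻¹ * ∑ x, f x := by
  rw [avg, finsum_eq_sum_of_fintype]

theorem card_mul_avg [Finite α] [Nonempty α] (f : α → ℝ) : (Nat.card α : ℝ) * avg f = ∑ᶠ x, f x := by
  rw [avg, mul_inv_cancel_left₀]
  exact_mod_cast Nat.card_pos.ne'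

theorem avg_congr {f g : α → ℝ} (h : ∀ x, f x = g x) : avg f = avg g := by
  rw [funext h]

theorem avg_comp_equiv (e : α ≃ β) (f : β → ℝ) : avg (fun x => f (e x)) = avg f := by
  rw [avg, avg, finsum_comp_equiv, Nat.card_congr e]

theorem avg_zero : avg (fun _ : α => (0 : ℝ)) = 0 := by simp [avg]

theorem avg_const [Finite α] [Nonempty α] (c : ℝ) : avg (fun _ : α => c) = c := by
  have := Fintype.ofFinite α
  rw [avg_eq_sum]
  simp

theorem avg_add [Finite α] (f g : α → ℝ) : avg (fun x => f x + g x) = avg f + avg g := by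
  have := Fintype.ofFinite α
  simp only [avg_eq_sum, Finset.sum_add_distrib, mul_add]

theorem avg_sum [Finite α] (s : Finset β) (f : β → α → ℝ) :
    avg (fun x => ∑ i ∈ s, f i x) = ∑ i ∈ s, avg (f i) := by
  have := Fintype.ofFinite α
  simp only [avg_eq_sum, Finset.mul_sum]
  rw [Finset.sum_comm]

theorem avg_const_mul [Finite α] (c : ℝ) (f : α → ℝ) : avg (fun x => c * f x) = c * avg f := by
  have := Fintype.ofFinite α
  simp only [avg_eq_sum, ← Finset.mul_sum]
  ring

theorem avg_mul_const [Finite α] (c : ℝ) (f : α → ℝ) : avg (fun x => f x * c) = avg f * c := by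
  simp only [mul_comm _ c, avg_const_mul]

theorem avg_prod [Finite α] [Finite β] (f : α × β → ℝ) :
    avg f = avg fun x => avg fun y => f (x, y) := by
  have := Fintype.ofFinite α
  have := Fintype.ofFinite β
  simp only [avg_eq_sum, Fintype.sum_prod_type, Nat.card_prod, Finset.mul_sum, Nat.cast_mul, mul_inv,
    mul_assoc]

theorem avg_comm [Finite α] [Finite β] (f : α → β → ℝ) :
    (avg fun x => avg fun y => f x y) = avg fun y => avg fun x => f x y := by
  rw [← avg_prod (fun p : α × β => f p.1 p.2), ← avg_prod (fun p : β × α => f p.2 p.1),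
    ← avg_comp_equiv (Equiv.prodComm α β)]
  rfl

theorem avg_mul_avg [Finite α] [Finite β] (f : α → ℝ) (g : β → ℝ) :
    avg f * avg g = avg fun x => avg fun y => f x * g y := by
  simp only [avg_const_mul, avg_mul_const]

/-- Right translation in the group makes the left side independent of the base point, so it may be
averaged over all base points. After exchanging the two averages, each group element only permutes
the set. No stabilizer has to be counted. -/
theorem avg_smul_of_isPretransitive {G : Type*} [Group G] [Finite G] [MulAction G β] [Finite β]
    [MulAction.IsPretransitive G β] (b : β) (f : β → ℝ) : avg (fun g : G => f (g • b)) = avg f := by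
  have : Nonempty β := ⟨b⟩
  calc avg (fun g : G => f (g • b)) = avg fun c : β => avg fun g : G => f (g • c) := by
        rw [← avg_const (α := β) (avg fun g : G => f (g • b))]
        refine avg_congr fun c => ?_
        obtain ⟨k, rfl⟩ := MulAction.exists_smul_eq G b c
        rw [← avg_comp_equiv (Equiv.mulRight k)]
        simp [mul_smul]
    _ = avg fun g : G => avg fun c : β => f (g • c) := avg_comm _
    _ = avg fun g : G => avg f := avg_congr fun g => avg_comp_equiv (MulAction.toPerm g) f
    _ = avg f := avg_const _

/-- Through `φ` the target becomes a transitive set for the source group. -/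
theorem avg_comp_of_surjective_hom {G H : Type*} [Group G] [Group H] [Finite G] (φ : G →* H)
    (hφ : Function.Surjective φ) (f : H → ℝ) : avg (fun x => f (φ x)) = avg f := by
  have : Finite H := Finite.of_surjective φ hφ
  let _ : MulAction G H := MulAction.compHom H φ
  have : MulAction.IsPretransitive G H := ⟨fun x y => by
    obtain ⟨g, hg⟩ := hφ (y * x⁻¹)
    exact ⟨g, by change φ g * x = y; rw [hg, inv_mul_cancel_right]⟩⟩
  rw [← avg_smul_of_isPretransitive (G := G) (1 : H)]
  refine avg_congr fun g => ?_
  change _ = f (φ g * 1)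
  rw [mul_one]

theorem avg_comp_of_surjective_addHom {G H : Type*} [AddGroup G] [AddGroup H] [Finite G]
    (φ : G →+ H) (hφ : Function.Surjective φ) (f : H → ℝ) : avg (fun x => f (φ x)) = avg f :=
  avg_comp_of_surjective_hom (G := Multiplicative G) (H := Multiplicative H)
    (AddMonoidHom.toMultiplicative φ) hφ f

/-- The average of a function extended by zero from a subset. -/
theorem avg_ite [Finite α] (p : α → Prop) [DecidablePred p] (f : α → ℝ) :
    (avg fun x => if p x then f x else 0) =
      (Nat.card {x // p x} : ℝ) / Nat.card α * avg fun x : {x // p x} => f x := by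
  have := Fintype.ofFinite α
  rcases isEmpty_or_nonempty {x // p x} with h | h
  · have : ∀ x, ¬ p x := fun x hx => h.false ⟨x, hx⟩
    simp [this, avg_zero]
  · rw [avg_eq_sum, avg_eq_sum, ← Finset.sum_filter, Finset.sum_subtype (p := p) _ (by simp)]
    have : (Nat.card {x // p x} : ℝ) ≠ 0 := by exact_mod_cast Nat.card_pos.ne'
    field_simp

end Avg

/-! ### Induction and restriction as averages -/

namespace Parabolic

variable {G H 𝔤 𝔩 : Type*} [Group G] [Group H] [AddCommGroup 𝔤] [AddCommGroup 𝔩]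
variable {Ad : G →* AddMonoid.End 𝔤} {AdL : H →* AddMonoid.End 𝔩} (D : Parabolic Ad AdL)

theorem res_apply [Finite 𝔤] (Ψ : InvFun Ad) (Y : 𝔩) :
    (D.res Ψ).1 Y = avg fun Z : D.nil => Ψ.1 (D.incl Y + Z) := rfl

/-- The summand is constant on each coset `gP`, so summing over representatives is the same as
averaging over the whole group, up to the index. In this form, substitutions in the group replace
choices of representatives. -/
theorem ind_apply [Finite G] (Φ : InvFun AdL) (X : 𝔤) :
    (D.ind Φ).1 X = (D.P.index : ℝ) * avg fun g => D.extend Φ.1 (Ad g⁻¹ X) := by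
  have h1 : avg (fun g => D.extend Φ.1 (Ad g⁻¹ X)) =
      avg fun c : G ⧸ D.P => D.extend Φ.1 (Ad c.out⁻¹ X) := by
    rw [← avg_smul_of_isPretransitive (G := G) ((1 : G) : G ⧸ D.P)]
    refine avg_congr fun g => ?_
    rw [MulAction.Quotient.smul_coe, smul_eq_mul, mul_one, D.extend_out]
  rw [h1, Subgroup.index, card_mul_avg]
  rfl

end Parabolic

/-! ### Every matrix is conjugate to its transpose -/

section Transpose

open Polynomial

variable (F : Type*) [Field F]

/-- The existence of a non-degenerate bilinear form for which all elements of `F[X]` act by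
self-adjoint operators. -/
def HasSelfAdjointForm (M : Type*) [AddCommGroup M] [Module F M] [Module F[X] M] : Prop :=
  ∃ β : M →ₗ[F] M →ₗ[F] F, (∀ (a : F[X]) u v, β (a • u) v = β u (a • v)) ∧
    ∀ u, (∀ v, β u v = 0) → u = 0

variable {F}

theorem HasSelfAdjointForm.of_equiv {M M' : Type*} [AddCommGroup M] [Module F M] [Module F[X] M]
    [IsScalarTower F F[X] M] [AddCommGroup M'] [Module F M'] [Module F[X] M']
    [IsScalarTower F F[X] M'] (e : M ≃ₗ[F[X]] M') (h : HasSelfAdjointForm F M') :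
    HasSelfAdjointForm F M := by
  obtain ⟨β, h1, h2⟩ := h
  refine ⟨β.compl₁₂ ((e : M →ₗ[F[X]] M').restrictScalars F)
    ((e : M →ₗ[F[X]] M').restrictScalars F), fun a u v => ?_, fun u hu => ?_⟩
  · simp [h1]
  · refine (map_eq_zero_iff e e.injective).1 (h2 _ fun v => ?_)
    simpa using hu (e.symm v)

theorem HasSelfAdjointForm.directSum {ι : Type*} [Fintype ι] [DecidableEq ι] (M : ι → Type*)
    [∀ i, AddCommGroup (M i)] [∀ i, Module F (M i)] [∀ i, Module F[X] (M i)]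
    (h : ∀ i, HasSelfAdjointForm F (M i)) : HasSelfAdjointForm F (DirectSum ι M) := by
  choose β h1 h2 using h
  refine ⟨∑ i, (β i).compl₁₂ (DirectSum.component F ι M i) (DirectSum.component F ι M i),
    fun a u v => ?_, fun u hu => ?_⟩
  · simp only [LinearMap.sum_apply, LinearMap.compl₁₂_apply]
    exact Finset.sum_congr rfl fun i _ => h1 i a _ _
  · refine DFinsupp.ext fun i => h2 i _ fun v => ?_
    have := hu (DirectSum.lof F ι M i v)
    simp only [LinearMap.sum_apply, LinearMap.compl₁₂_apply] at this
    rw [Finset.sum_eq_single i] at this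
    · rw [DirectSum.component.lof_self] at this
      exact this
    · intro j _ hj
      rw [DirectSum.component.of, dif_neg hj.symm, map_zero]
    · simp

/-- The form is `(u, v) ↦ l (u * v)`, where the functional `l` does not vanish on the class of `p ^
(e - 1)`. Every nonzero ideal of this quotient contains that class, so the radical of the form is
zero. -/
theorem hasSelfAdjointForm_quotient {p : F[X]} (hp : Irreducible p) (e : ℕ) :
    HasSelfAdjointForm F (F[X] ⧸ Submodule.span F[X] {p ^ e}) := by
  rcases Nat.eq_zero_or_pos e with rfl | he
  · refine ⟨0, by simp, fun u _ => ?_⟩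
    have : Subsingleton (F[X] ⧸ Submodule.span F[X] {p ^ 0}) := by
      rw [Submodule.Quotient.subsingleton_iff]
      simp
    exact Subsingleton.elim _ _
  · have hne : (Ideal.Quotient.mk (Ideal.span {p ^ e}) (p ^ (e - 1))) ≠ 0 := by
      rw [Ne, Ideal.Quotient.eq_zero_iff_mem, Ideal.mem_span_singleton,
        pow_dvd_pow_iff hp.ne_zero hp.not_isUnit]
      omega
    obtain ⟨l, hl⟩ : ∃ l : Module.Dual F (F[X] ⧸ Ideal.span {p ^ e}),
        l (Ideal.Quotient.mk (Ideal.span {p ^ e}) (p ^ (e - 1))) ≠ 0 := by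
      by_contra! h
      exact hne ((Module.forall_dual_apply_eq_zero_iff F _).1 h)
    refine ⟨(LinearMap.mul F (F[X] ⧸ Ideal.span {p ^ e})).compr₂ l, fun a u v => ?_, fun u hu => ?_⟩
    · simp only [LinearMap.compr₂_apply, LinearMap.mul_apply']
      congr 1
      obtain ⟨u, rfl⟩ := Ideal.Quotient.mk_surjective u
      obtain ⟨v, rfl⟩ := Ideal.Quotient.mk_surjective v
      change Ideal.Quotient.mk _ (a * u) * _ = _ * Ideal.Quotient.mk _ (a * v)
      simp only [map_mul]
      ring
    · obtain ⟨u, rfl⟩ := Ideal.Quotient.mk_surjective u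
      by_contra hne'
      apply hl
      have hu0 : u ≠ 0 := by rintro rfl; exact hne' (map_zero _)
      obtain ⟨a, w, hw, rfl⟩ := WfDvdMonoid.max_power_factor hu0 hp
      have ha : a ≤ e - 1 := by
        by_contra! ha
        apply hne'
        change Ideal.Quotient.mk _ _ = 0
        rw [Ideal.Quotient.eq_zero_iff_mem, Ideal.mem_span_singleton]
        exact Dvd.dvd.mul_right (pow_dvd_pow p (by omega)) w
      -- Write the element as `p ^ a * w` with `w` prime to `p`. A Bézout inverse `b` of `w` modulo
      -- `p ^ e`, multiplied by `p ^ (e - 1 - a)`, is a partner whose product with the element is `p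
      -- ^ (e - 1)`.
      obtain ⟨b, c, hbc⟩ := (IsCoprime.pow_right (n := e) ((hp.coprime_iff_not_dvd.2 hw).symm))
      have := hu (Ideal.Quotient.mk _ (b * p ^ (e - 1 - a)))
      simp only [LinearMap.compr₂_apply, LinearMap.mul_apply'] at this
      rw [← this]
      congr 1
      change _ = Ideal.Quotient.mk _ _ * _
      rw [← map_mul, Ideal.Quotient.mk_eq_mk_iff_sub_mem, Ideal.mem_span_singleton]
      refine ⟨p ^ (e - 1) * c, ?_⟩
      have h3 : p ^ a * w * (b * p ^ (e - 1 - a)) = p ^ (e - 1) * (b * w) := by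
        have : p ^ (e - 1) = p ^ a * p ^ (e - 1 - a) := by rw [← pow_add]; congr 1; omega
        rw [this]; ring
      rw [h3]
      linear_combination (-p ^ (e - 1)) * hbc

/-- Every square matrix over a field is conjugate to its transpose. -/
theorem exists_conj_transpose {N : Type*} [Fintype N] [DecidableEq N] (X : Matrix N N F) :
    ∃ S : GL N F, (S : Matrix N N F) * X = Xᵀ * S := by
  -- The vector space with `X` acting through the matrix is a finitely generated torsion module,
  -- hence a direct sum of quotients by prime powers.
  have key : HasSelfAdjointForm F (Module.AEval' (Matrix.toLin' X)) := by
    have htors : Module.IsTorsion F[X] (Module.AEval' (Matrix.toLin' X)) :=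
      Module.AEval.isTorsion_of_finiteDimensional _ _ _
    have : Module.Finite F[X] (Module.AEval' (Matrix.toLin' X)) := inferInstance
    obtain ⟨ι, _, p, hp, e, ⟨f⟩⟩ := Module.equiv_directSum_of_isTorsion htors
    classical
    exact (HasSelfAdjointForm.directSum _ fun i => hasSelfAdjointForm_quotient (hp i) (e i)).of_equiv f
  obtain ⟨β, h1, h2⟩ := key
  let ι := Module.AEval'.of (Matrix.toLin' X)
  let γ : LinearMap.BilinForm F (N → F) := β.compl₁₂ ι.toLinearMap ι.toLinearMap
  have hγ : ∀ u v, γ (X *ᵥ u) v = γ u (X *ᵥ v) := by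
    intro u v
    have := h1 Polynomial.X (ι u) (ι v)
    rw [Module.AEval'.X_smul_of, Module.AEval'.X_smul_of] at this
    exact this
  -- The Gram matrix of the form is the required `S`: self-adjointness is the intertwining relation,
  -- and nondegeneracy is invertibility.
  have hrep : γ = Matrix.toLinearMap₂' F (LinearMap.toMatrix₂' F γ) := by simp
  have hdet : (LinearMap.toMatrix₂' F γ).det ≠ 0 := by
    rw [← LinearMap.separatingLeft_toLinearMap₂'_iff_det_ne_zero, ← hrep]
    intro u hu
    refine (map_eq_zero_iff ι ι.injective).1 (h2 _ fun v => ?_)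
    obtain ⟨v, rfl⟩ := ι.surjective v
    exact hu v
  refine ⟨Matrix.GeneralLinearGroup.mkOfDetNeZero _ hdet, ?_⟩
  change LinearMap.toMatrix₂' F γ * X = Xᵀ * LinearMap.toMatrix₂' F γ
  have h3 := LinearMap.toMatrix₂'_compl₁₂ (R := F) γ (Matrix.toLin' X) LinearMap.id
  have h4 := LinearMap.toMatrix₂'_compl₁₂ (R := F) γ LinearMap.id (Matrix.toLin' X)
  simp only [LinearMap.toMatrix'_toLin', LinearMap.toMatrix'_id, Matrix.transpose_one, mul_one,
    one_mul] at h3 h4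
  rw [← h3, ← h4]
  congr 1
  refine LinearMap.ext₂ fun u v => ?_
  simpa using (hγ u v).symm

end Transpose

/-! ### Numerical description of the block structure -/

section Index

variable {i j n : ℕ}

theorem val_glEquiv_inl (h : i + j = n) (a : Fin i) : (glEquiv h (Sum.inl a)).val = a := by
  simp [glEquiv]

theorem val_glEquiv_inr (h : i + j = n) (a : Fin j) : (glEquiv h (Sum.inr a)).val = i + a := by
  simp [glEquiv]

theorem gl_cases (h : i + j = n) (r : Fin n) :
    (∃ a, r = glEquiv h (Sum.inl a)) ∨ (∃ a, r = glEquiv h (Sum.inr a)) := by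
  obtain ⟨x, rfl⟩ := (glEquiv h).surjective r
  rcases x with x | x
  · exact Or.inl ⟨x, rfl⟩
  · exact Or.inr ⟨x, rfl⟩

theorem glBlk_eq (h : i + j = n) (r : Fin n) : glBlk h r = if r.1 < i then 0 else 1 := by
  rcases gl_cases h r with ⟨a, rfl⟩ | ⟨a, rfl⟩
  · simp [glBlk, val_glEquiv_inl]
  · simp [glBlk, val_glEquiv_inr]

theorem rev_glEquiv_inl (h : i + j = n) (h' : j + i = n) (a : Fin i) :
    (glEquiv h (Sum.inl a)).rev = glEquiv h' (Sum.inr a.rev) := by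
  ext; rw [Fin.val_rev, val_glEquiv_inl, val_glEquiv_inr, Fin.val_rev]; omega

theorem rev_glEquiv_inr (h : i + j = n) (h' : j + i = n) (a : Fin j) :
    (glEquiv h (Sum.inr a)).rev = glEquiv h' (Sum.inl a.rev) := by
  ext; rw [Fin.val_rev, val_glEquiv_inl, val_glEquiv_inr, Fin.val_rev]; omega

/-- The number of the block of a row with respect to a partition into three consecutive blocks,
the first two of which have sizes `i` and `j`. -/
def blk3 (i j : ℕ) {n : ℕ} (r : Fin n) : ℕ := if r.1 < i then 0 else if r.1 < i + j then 1 else 2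

theorem glEquiv_assoc_inl_inl {n₁ n₂ n₃ c d : ℕ} (h₁₂ : n₁ + n₂ = c) (h : c + n₃ = n)
    (h' : n₁ + d = n) (a : Fin n₁) :
    glEquiv h (Sum.inl (glEquiv h₁₂ (Sum.inl a))) = glEquiv h' (Sum.inl a) := by
  ext; simp only [val_glEquiv_inl]

theorem glEquiv_assoc_inl_inr {n₁ n₂ n₃ c d : ℕ} (h₁₂ : n₁ + n₂ = c) (h : c + n₃ = n)
    (h₂₃ : n₂ + n₃ = d) (h' : n₁ + d = n) (a : Fin n₂) :
    glEquiv h (Sum.inl (glEquiv h₁₂ (Sum.inr a))) =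
      glEquiv h' (Sum.inr (glEquiv h₂₃ (Sum.inl a))) := by
  ext; simp only [val_glEquiv_inl, val_glEquiv_inr]

theorem glEquiv_assoc_inr {n₁ n₂ n₃ c d : ℕ} (h₁₂ : n₁ + n₂ = c) (h : c + n₃ = n)
    (h₂₃ : n₂ + n₃ = d) (h' : n₁ + d = n) (a : Fin n₃) :
    glEquiv h (Sum.inr a) = glEquiv h' (Sum.inr (glEquiv h₂₃ (Sum.inr a))) := by
  ext; simp only [val_glEquiv_inr]; omega

end Index

/-! ### Transposition in the second diagonal -/

section Flip

variable {F : Type*} {m i j n : ℕ}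

/-- The transposition of a matrix with respect to the second diagonal. -/
def flip (X : Matrix (Fin m) (Fin m) F) : Matrix (Fin m) (Fin m) F :=
  (X.submatrix Fin.rev Fin.rev)ᵀ

@[simp] theorem flip_apply (X : Matrix (Fin m) (Fin m) F) (r s : Fin m) :
    flip X r s = X s.rev r.rev := rfl

@[simp] theorem flip_flip (X : Matrix (Fin m) (Fin m) F) : flip (flip X) = X := by
  ext r s; simp

theorem glBlocks_flip (h : i + j = n) (h' : j + i = n) (X : Matrix (Fin n) (Fin n) F) :
    glBlocks F h (flip X) = (flip (glBlocks F h' X).2, flip (glBlocks F h' X).1) := by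
  refine Prod.ext ?_ ?_ <;> ext r s <;>
  simp [rev_glEquiv_inl h h', rev_glEquiv_inr h h', glBlocks]

variable [Field F]

theorem flip_mul (X Y : Matrix (Fin m) (Fin m) F) : flip (X * Y) = flip Y * flip X := by
  ext r s
  simp only [flip_apply, Matrix.mul_apply]
  rw [← Equiv.sum_comp Fin.revPerm]
  simp [mul_comm]

theorem flip_one : flip (1 : Matrix (Fin m) (Fin m) F) = 1 := by
  ext r s
  simp [Matrix.one_apply, eq_comm]

theorem flip_add (X Y : Matrix (Fin m) (Fin m) F) : flip (X + Y) = flip X + flip Y := rfl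

/-- The automorphism `g ↦ (g^t)⁻¹` of the general linear group, where `g^t` denotes the transpose
with respect to the second diagonal. -/
def flipGL : GL (Fin m) F ≃* GL (Fin m) F where
  toFun g := ⟨flip ((g⁻¹ : GL (Fin m) F) : Matrix (Fin m) (Fin m) F), flip g,
    by rw [← flip_mul, Units.mul_inv, flip_one], by rw [← flip_mul, Units.inv_mul, flip_one]⟩
  invFun g := ⟨flip ((g⁻¹ : GL (Fin m) F) : Matrix (Fin m) (Fin m) F), flip g,
    by rw [← flip_mul, Units.mul_inv, flip_one], by rw [← flip_mul, Units.inv_mul, flip_one]⟩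
  left_inv g := Units.ext (flip_flip _)
  right_inv g := Units.ext (flip_flip _)
  map_mul' g h := Units.ext (by
    change flip (((g * h)⁻¹ : GL (Fin m) F) : Matrix (Fin m) (Fin m) F) = flip _ * flip _
    rw [mul_inv_rev, Units.val_mul, flip_mul])

theorem flip_ad (g : GL (Fin m) F) (X : Matrix (Fin m) (Fin m) F) :
    flip (adGL F (Fin m) g X) = adGL F (Fin m) (flipGL g) (flip X) := by
  rw [adGL_apply, flip_mul, flip_mul, ← mul_assoc]
  rfl

/-- Transposition in the second diagonal is ordinary transposition followed by conjugation with `J`,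
and `J` is its own inverse. -/
theorem exists_ad_eq_flip (X : Matrix (Fin m) (Fin m) F) :
    ∃ g, adGL F (Fin m) g X = flip X := by
  obtain ⟨S, hS⟩ := exists_conj_transpose X
  let w : GL (Fin m) F := ⟨J F m, J F m, J_mul_J F, J_mul_J F⟩
  refine ⟨w * S, ?_⟩
  rw [ad_mul_apply, adGL_apply S, hS, mul_assoc, Units.mul_inv, mul_one]
  change J F m * Xᵀ * J F m = _
  ext r s
  rw [mul_J, J_mul]
  rfl

/-- This is what makes `A` commutative and cocommutative: an antiautomorphism that exchanges the
blocks of a parabolic is invisible to invariant functions. -/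
theorem InvFun.apply_flip (f : InvFun (adGL F (Fin m))) (X : Matrix (Fin m) (Fin m) F) :
    f.1 (flip X) = f.1 X := by
  obtain ⟨g, hg⟩ := exists_ad_eq_flip X
  rw [← hg, f.2]

theorem flip_blockTriangular {b b' : Fin m → ℕ}
    (hb : ∀ r s, b r < b s ↔ b' s.rev < b' r.rev) (X : Matrix (Fin m) (Fin m) F) :
    (flip X).BlockTriangular b' ↔ X.BlockTriangular b := by
  constructor
  · intro h r s hrs
    have := h ((hb s r).1 hrs)
    simpa using this
  · intro h r s hrs
    refine h ((hb r.rev s.rev).2 ?_)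
    simpa using hrs

theorem flip_mem_strictUpper {b b' : Fin m → ℕ}
    (hb : ∀ r s, b r < b s ↔ b' s.rev < b' r.rev) (X : Matrix (Fin m) (Fin m) F) :
    flip X ∈ strictUpper F b' ↔ X ∈ strictUpper F b := by
  constructor
  · intro h r s hrs
    have := h s.rev r.rev (by have := hb r s; omega)
    simpa using this
  · intro h r s hrs
    refine h _ _ ?_
    have := hb s.rev r.rev
    simp only [Fin.rev_rev] at this
    omega

theorem glBlk_rev (h : i + j = n) (h' : j + i = n) (r s : Fin n) :
    glBlk h r < glBlk h s ↔ glBlk h' s.rev < glBlk h' r.rev := by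
  simp only [glBlk_eq, Fin.val_rev]
  split_ifs <;> omega

theorem blk3_rev {n₁ n₂ n₃ : ℕ} (h : n₁ + n₂ + n₃ = n) (r s : Fin n) :
    blk3 n₁ n₂ r < blk3 n₁ n₂ s ↔ blk3 n₃ n₂ s.rev < blk3 n₃ n₂ r.rev := by
  simp only [blk3, Fin.val_rev]
  split_ifs <;> omega

section
variable (h : i + j = n) (Y : Matrix (Fin i) (Fin i) F × Matrix (Fin j) (Fin j) F)

@[simp] theorem glDiag_inl_inl (a b : Fin i) :
    glDiag F h Y (glEquiv h (Sum.inl a)) (glEquiv h (Sum.inl b)) = Y.1 a b := by simp [glDiag]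

@[simp] theorem glDiag_inl_inr (a : Fin i) (b : Fin j) :
    glDiag F h Y (glEquiv h (Sum.inl a)) (glEquiv h (Sum.inr b)) = 0 := by simp [glDiag]

@[simp] theorem glDiag_inr_inl (a : Fin j) (b : Fin i) :
    glDiag F h Y (glEquiv h (Sum.inr a)) (glEquiv h (Sum.inl b)) = 0 := by simp [glDiag]

@[simp] theorem glDiag_inr_inr (a b : Fin j) :
    glDiag F h Y (glEquiv h (Sum.inr a)) (glEquiv h (Sum.inr b)) = Y.2 a b := by simp [glDiag]

end

theorem flip_glDiag (h : i + j = n) (h' : j + i = n)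
    (A : Matrix (Fin i) (Fin i) F) (B : Matrix (Fin j) (Fin j) F) :
    flip (glDiag F h (A, B)) = glDiag F h' (flip B, flip A) := by
  ext r s
  rcases gl_cases h' r with ⟨a, rfl⟩ | ⟨a, rfl⟩ <;> rcases gl_cases h' s with ⟨b, rfl⟩ | ⟨b, rfl⟩ <;>
  simp [rev_glEquiv_inl h' h, rev_glEquiv_inr h' h, glDiag]

theorem glDiag_assoc {n₁ n₂ n₃ c d : ℕ} (h₁₂ : n₁ + n₂ = c) (h : c + n₃ = n)
    (h₂₃ : n₂ + n₃ = d) (h' : n₁ + d = n) (A : Matrix (Fin n₁) (Fin n₁) F)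
    (B : Matrix (Fin n₂) (Fin n₂) F) (C : Matrix (Fin n₃) (Fin n₃) F) :
    glDiag F h' (A, glDiag F h₂₃ (B, C)) = glDiag F h (glDiag F h₁₂ (A, B), C) := by
  have e (r : Fin n) : (∃ a, r = glEquiv h (Sum.inl (glEquiv h₁₂ (Sum.inl a)))) ∨
      (∃ a, r = glEquiv h (Sum.inl (glEquiv h₁₂ (Sum.inr a)))) ∨
      (∃ a, r = glEquiv h (Sum.inr a)) := by
    rcases gl_cases h r with ⟨a, rfl⟩ | ⟨a, rfl⟩
    · rcases gl_cases h₁₂ a with ⟨a, rfl⟩ | ⟨a, rfl⟩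
      · exact Or.inl ⟨a, rfl⟩
      · exact Or.inr (Or.inl ⟨a, rfl⟩)
    · exact Or.inr (Or.inr ⟨a, rfl⟩)
  have e1 := glEquiv_assoc_inl_inl h₁₂ h h'
  have e2 := glEquiv_assoc_inl_inr h₁₂ h h₂₃ h'
  have e3 := glEquiv_assoc_inr h₁₂ h h₂₃ h'
  ext r s
  rcases e r with ⟨a, rfl⟩ | ⟨a, rfl⟩ | ⟨a, rfl⟩ <;>
  rcases e s with ⟨b, rfl⟩ | ⟨b, rfl⟩ | ⟨b, rfl⟩ <;>
  -- The nine pairs of blocks are treated separately: the positions are written in the bracketing on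
  -- the right side and have to be rewritten for the left side.
  [refine (congrArg₂ (glDiag F h' _) (e1 a) (e1 b)).trans ?_;
    refine (congrArg₂ (glDiag F h' _) (e1 a) (e2 b)).trans ?_;
    refine (congrArg₂ (glDiag F h' _) (e1 a) (e3 b)).trans ?_;
    refine (congrArg₂ (glDiag F h' _) (e2 a) (e1 b)).trans ?_;
    refine (congrArg₂ (glDiag F h' _) (e2 a) (e2 b)).trans ?_;
    refine (congrArg₂ (glDiag F h' _) (e2 a) (e3 b)).trans ?_;
    refine (congrArg₂ (glDiag F h' _) (e3 a) (e1 b)).trans ?_;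
    refine (congrArg₂ (glDiag F h' _) (e3 a) (e2 b)).trans ?_;
    refine (congrArg₂ (glDiag F h' _) (e3 a) (e3 b)).trans ?_] <;>
  simp

end Flip

/-! ### Slices of invariant functions on a product -/

section General

variable {G H 𝔤 𝔩 : Type*} [Group G] [Group H] [AddCommGroup 𝔤] [AddCommGroup 𝔩]
variable {Ad₁ : G →* AddMonoid.End 𝔤} {Ad₂ : H →* AddMonoid.End 𝔩}

/-- The restriction of an invariant function on a product to a slice. -/
def InvFun.slice (f : InvFun (adProd Ad₁ Ad₂)) (Y : 𝔩) : InvFun Ad₁ :=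
  ⟨fun X => f.1 (X, Y), fun g X => by simpa using f.2 (g, 1) (X, Y)⟩

theorem InvFun.apply_ad_right (f : InvFun (adProd Ad₁ Ad₂)) (g : H) (X : 𝔤) (Y : 𝔩) :
    f.1 (X, Ad₂ g Y) = f.1 (X, Y) := by simpa using f.2 (1, g) (X, Y)

end General

/-! ### Three diagonal blocks and averages over nilradicals -/

section Blocks

variable {F : Type*} [Field F] {n i j n₁ n₂ n₃ c d : ℕ}

theorem blk3_eq_of_lt (h₁₂ : n₁ + n₂ = c) (h : c + n₃ = n) (r : Fin n) :
    blk3 n₁ n₂ r = if hr : r.1 < c then glBlk h₁₂ ⟨r, hr⟩ else 2 := by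
  simp only [blk3, glBlk_eq]
  split_ifs <;> omega

@[simp] theorem blk3_inl (h₁₂ : n₁ + n₂ = c) (h : c + n₃ = n) (a : Fin c) :
    blk3 n₁ n₂ (glEquiv h (Sum.inl a)) = glBlk h₁₂ a := by
  simp [blk3_eq_of_lt h₁₂ h, val_glEquiv_inl]

@[simp] theorem blk3_inr (h₁₂ : n₁ + n₂ = c) (h : c + n₃ = n) (a : Fin n₃) :
    blk3 n₁ n₂ (glEquiv h (Sum.inr a)) = 2 := by
  simp [blk3_eq_of_lt h₁₂ h, val_glEquiv_inr]

@[simp] theorem glBlk_inl (h : i + j = n) (a : Fin i) : glBlk h (glEquiv h (Sum.inl a)) = 0 := by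
  simp [glBlk]

@[simp] theorem glBlk_inr (h : i + j = n) (a : Fin j) : glBlk h (glEquiv h (Sum.inr a)) = 1 := by
  simp [glBlk]

theorem glBlk_lt_two (h : i + j = n) (r : Fin n) : glBlk h r < 2 := by
  rw [glBlk_eq]; split_ifs <;> omega

/-- The nilradical for three blocks is the direct sum of the nilradical inside the first Levi factor
of the coarser parabolic and the nilradical of that parabolic. This underlies transitivity of
restriction. -/
theorem strictUpper_blk3_iff (h₁₂ : n₁ + n₂ = c) (h : c + n₃ = n) (X : Matrix (Fin n) (Fin n) F) :
    X ∈ strictUpper F (blk3 n₁ n₂ : Fin n → ℕ) ↔ (glBlocks F h X).1 ∈ strictUpper F (glBlk h₁₂) ∧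
      X - glDiag F h ((glBlocks F h X).1, 0) ∈ strictUpper F (glBlk h) := by
  constructor
  · intro hX
    refine ⟨fun r s hrs => hX _ _ (by simpa [h₁₂] using hrs), fun r s hrs => ?_⟩
    rcases gl_cases h r with ⟨a, rfl⟩ | ⟨a, rfl⟩ <;> rcases gl_cases h s with ⟨b, rfl⟩ | ⟨b, rfl⟩
    · simp [glBlocks]
    · simp at hrs
    · simp only [Matrix.sub_apply, glDiag_inr_inl, sub_zero]
      exact hX _ _ (by simpa [h₁₂, h] using (glBlk_lt_two h₁₂ b).le)
    · simp only [Matrix.sub_apply, glDiag_inr_inr, Matrix.zero_apply, sub_zero]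
      exact hX _ _ (by simp [blk3_inr h₁₂ h])
  · rintro ⟨h1, h2⟩ r s hrs
    rcases gl_cases h r with ⟨a, rfl⟩ | ⟨a, rfl⟩ <;> rcases gl_cases h s with ⟨b, rfl⟩ | ⟨b, rfl⟩
    · exact h1 a b (by simpa [h₁₂] using hrs)
    · have := glBlk_lt_two h₁₂ a
      simp [blk3_inl h₁₂ h, blk3_inr h₁₂ h] at hrs
      omega
    · simpa using h2 (glEquiv h (Sum.inr a)) (glEquiv h (Sum.inl b)) (by simp)
    · simpa using h2 (glEquiv h (Sum.inr a)) (glEquiv h (Sum.inr b)) (by simp)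

theorem glDiag_add (h : i + j = n) (Y Y' : Matrix (Fin i) (Fin i) F × Matrix (Fin j) (Fin j) F) :
    glDiag F h (Y + Y') = glDiag F h Y + glDiag F h Y' := by
  ext r s
  rcases gl_cases h r with ⟨a, rfl⟩ | ⟨a, rfl⟩ <;> rcases gl_cases h s with ⟨b, rfl⟩ | ⟨b, rfl⟩ <;>
  simp

theorem glBlocks_glDiag (h : i + j = n) (Y : Matrix (Fin i) (Fin i) F × Matrix (Fin j) (Fin j) F) :
    glBlocks F h (glDiag F h Y) = Y := by
  refine Prod.ext ?_ ?_ <;> ext r s <;> simp [glBlocks]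

theorem glBlocks_add (h : i + j = n) (X Y : Matrix (Fin n) (Fin n) F) :
    glBlocks F h (X + Y) = glBlocks F h X + glBlocks F h Y := rfl

theorem glBlocks_eq_zero (h : i + j = n) {X : Matrix (Fin n) (Fin n) F}
    (hX : X ∈ strictUpper F (glBlk h)) : glBlocks F h X = 0 := by
  refine Prod.ext ?_ ?_ <;> ext r s <;> exact hX _ _ (by simp)

/-- The average of a function over a translate of the group of strictly block upper triangular
matrices. -/
noncomputable def avgNil (b : Fin n → ℕ) (f : Matrix (Fin n) (Fin n) F → ℝ)
    (Y : Matrix (Fin n) (Fin n) F) : ℝ :=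
  avg fun Z : strictUpper F b => f (Y + Z)

theorem avgNil_flip {b b' : Fin n → ℕ} (hb : ∀ r s, b r < b s ↔ b' s.rev < b' r.rev)
    (f : InvFun (adGL F (Fin n))) (Y : Matrix (Fin n) (Fin n) F) :
    avgNil b' f.1 (flip Y) = avgNil b f.1 Y := by
  let e : strictUpper F b ≃ strictUpper F b' :=
    { toFun := fun Z => ⟨flip Z.1, (flip_mem_strictUpper hb _).2 Z.2⟩
      invFun := fun Z => ⟨flip Z.1, (flip_mem_strictUpper hb _).1 (by simp)⟩
      left_inv := fun Z => Subtype.ext (flip_flip _)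
      right_inv := fun Z => Subtype.ext (flip_flip _) }
  rw [avgNil, ← avg_comp_equiv e]
  refine avg_congr fun Z => ?_
  change f.1 (flip Y + flip Z.1) = _
  rw [← flip_add, InvFun.apply_flip f]

end Blocks

/-! ### Symmetry of iterated parabolic restriction -/

section Res

variable {F : Type*} [Field F] [Finite F] {n i j : ℕ}

/-- Flipping carries one nilradical to the other and exchanges the diagonal blocks at the price of
flipping them. The flips of `A` and `B` are then undone by conjugation in the Levi subgroup. -/
theorem res_comm (h : i + j = n) (h' : j + i = n) (f : InvFun (adGL F (Fin n)))
    (A : Matrix (Fin i) (Fin i) F) (B : Matrix (Fin j) (Fin j) F) :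
    ((glParabolic F h).res f).1 (A, B) = ((glParabolic F h').res f).1 (B, A) := by
  obtain ⟨g, hg⟩ := exists_ad_eq_flip A
  obtain ⟨k, hk⟩ := exists_ad_eq_flip B
  rw [← ((glParabolic F h').res f).2 (k, g), adProd_apply, hg, hk, Parabolic.res_apply,
    Parabolic.res_apply]
  change avgNil (glBlk h) f.1 (glDiag F h (A, B)) =
    avgNil (glBlk h') f.1 (glDiag F h' (flip B, flip A))
  rw [← flip_glDiag h h', avgNil_flip (glBlk_rev h h')]

variable {n₁ n₂ n₃ c d : ℕ}

/-- Iterated parabolic restriction of a function to three diagonal blocks. -/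
noncomputable def res3 (h₁₂ : n₁ + n₂ = c) (h : c + n₃ = n) (f : InvFun (adGL F (Fin n)))
    (X₁ : Matrix (Fin n₁) (Fin n₁) F) (X₂ : Matrix (Fin n₂) (Fin n₂) F)
    (X₃ : Matrix (Fin n₃) (Fin n₃) F) : ℝ :=
  ((glParabolic F h₁₂).res (InvFun.slice ((glParabolic F h).res f) X₃)).1 (X₁, X₂)

theorem res3_swap (h₁₂ : n₁ + n₂ = c) (h₂₁ : n₂ + n₁ = c) (h : c + n₃ = n)
    (f : InvFun (adGL F (Fin n))) (X₁ : Matrix (Fin n₁) (Fin n₁) F)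
    (X₂ : Matrix (Fin n₂) (Fin n₂) F) (X₃ : Matrix (Fin n₃) (Fin n₃) F) :
    res3 h₁₂ h f X₁ X₂ X₃ = res3 h₂₁ h f X₂ X₁ X₃ :=
  res_comm h₁₂ h₂₁ _ _ _

theorem res3_ad (h₁₂ : n₁ + n₂ = c) (h : c + n₃ = n) (f : InvFun (adGL F (Fin n)))
    (g₁ : GL (Fin n₁) F) (g₂ : GL (Fin n₂) F) (g₃ : GL (Fin n₃) F)
    (X₁ : Matrix (Fin n₁) (Fin n₁) F)
    (X₂ : Matrix (Fin n₂) (Fin n₂) F) (X₃ : Matrix (Fin n₃) (Fin n₃) F) :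
    res3 h₁₂ h f (adGL F _ g₁ X₁) (adGL F _ g₂ X₂) (adGL F _ g₃ X₃) = res3 h₁₂ h f X₁ X₂ X₃ := by
  have : InvFun.slice ((glParabolic F h).res f) (adGL F _ g₃ X₃) = InvFun.slice ((glParabolic F h).res f) X₃ :=
    Subtype.ext (funext fun X => InvFun.apply_ad_right ((glParabolic F h).res f) g₃ X X₃)
  rw [res3, this]
  exact ((glParabolic F h₁₂).res (InvFun.slice ((glParabolic F h).res f) X₃)).2 (g₁, g₂) (X₁, X₂)

/-- Transitivity of restriction: the two successive averages combine into one, because the two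
nilradicals together parametrize the nilradical for three blocks. -/
theorem res3_eq_avgNil (h₁₂ : n₁ + n₂ = c) (h : c + n₃ = n) (f : InvFun (adGL F (Fin n)))
    (X₁ : Matrix (Fin n₁) (Fin n₁) F) (X₂ : Matrix (Fin n₂) (Fin n₂) F)
    (X₃ : Matrix (Fin n₃) (Fin n₃) F) :
    res3 h₁₂ h f X₁ X₂ X₃ =
      avgNil (blk3 n₁ n₂) f.1 (glDiag F h (glDiag F h₁₂ (X₁, X₂), X₃)) := by
  have hb (p : strictUpper F (glBlk h₁₂) × strictUpper F (glBlk h)) :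
      glDiag F h (p.1.1, 0) + p.2.1 ∈ strictUpper F (blk3 n₁ n₂ : Fin n → ℕ) := by
    rw [strictUpper_blk3_iff h₁₂ h, glBlocks_add, glBlocks_glDiag, glBlocks_eq_zero h p.2.2]
    simp
  let φ : strictUpper F (glBlk h₁₂) × strictUpper F (glBlk h) →+
      strictUpper F (blk3 n₁ n₂ : Fin n → ℕ) :=
    { toFun := fun p => ⟨glDiag F h (p.1.1, 0) + p.2.1, hb p⟩
      map_zero' := Subtype.ext (by
        change glDiag F h 0 + 0 = 0
        simp [glDiag])
      map_add' := fun p p' => Subtype.ext (by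
        change glDiag F h (p.1.1 + p'.1.1, 0) + (p.2.1 + p'.2.1) = _ + _ + (_ + _)
        have := glDiag_add h (p.1.1, 0) (p'.1.1, 0)
        rw [Prod.mk_add_mk, add_zero] at this
        rw [this]; abel) }
  have hφ : Function.Surjective φ := by
    rintro ⟨Z, hZ⟩
    obtain ⟨h1, h2⟩ := (strictUpper_blk3_iff h₁₂ h Z).1 hZ
    exact ⟨(⟨_, h1⟩, ⟨_, h2⟩), Subtype.ext (add_sub_cancel _ _)⟩
  rw [avgNil, ← avg_comp_of_surjective_addHom φ hφ, avg_prod]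
  refine avg_congr fun Z => avg_congr fun Z' => ?_
  change f.1 (glDiag F h (glDiag F h₁₂ (X₁, X₂) + Z.1, X₃) + Z'.1) =
    f.1 (glDiag F h (glDiag F h₁₂ (X₁, X₂), X₃) + (glDiag F h (Z.1, 0) + Z'.1))
  rw [← add_assoc, ← glDiag_add, Prod.mk_add_mk, add_zero]

/-- The flip reverses three blocks just as it exchanges two. Written as a single average, the
restriction no longer depends on the bracketing, so this also accounts for coassociativity. -/
theorem res3_rev (h₁₂ : n₁ + n₂ = c) (h : c + n₃ = n) (h₃₂ : n₃ + n₂ = d) (h' : d + n₁ = n)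
    (f : InvFun (adGL F (Fin n))) (X₁ : Matrix (Fin n₁) (Fin n₁) F)
    (X₂ : Matrix (Fin n₂) (Fin n₂) F) (X₃ : Matrix (Fin n₃) (Fin n₃) F) :
    res3 h₁₂ h f X₁ X₂ X₃ = res3 h₃₂ h' f X₃ X₂ X₁ := by
  obtain ⟨g₁, hg₁⟩ := exists_ad_eq_flip X₁
  obtain ⟨g₂, hg₂⟩ := exists_ad_eq_flip X₂
  obtain ⟨g₃, hg₃⟩ := exists_ad_eq_flip X₃
  rw [← res3_ad h₃₂ h' f g₃ g₂ g₁, hg₁, hg₂, hg₃, res3_eq_avgNil, res3_eq_avgNil,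
    ← avgNil_flip (blk3_rev (by omega : n₁ + n₂ + n₃ = n)),
    flip_glDiag h (by omega : n₃ + c = n), flip_glDiag h₁₂ (by omega : n₂ + n₁ = c),
    glDiag_assoc h₃₂ h']

/-- The swap of the first two blocks and the full reversal generate all permutations; here the
orders are `123`, `213`, `312`, `132`. -/
theorem res3_perm (h₁₂ : n₁ + n₂ = c) (h : c + n₃ = n) (h₁₃ : n₁ + n₃ = d) (h' : d + n₂ = n)
    (f : InvFun (adGL F (Fin n))) (X₁ : Matrix (Fin n₁) (Fin n₁) F)
    (X₂ : Matrix (Fin n₂) (Fin n₂) F) (X₃ : Matrix (Fin n₃) (Fin n₃) F) :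
    res3 h₁₂ h f X₁ X₂ X₃ = res3 h₁₃ h' f X₁ X₃ X₂ := by
  rw [res3_swap h₁₂ (by omega) h, res3_rev _ h (by omega : n₃ + n₁ = d) h', res3_swap]

end Res

/-! ### Symmetry of iterated parabolic induction -/

section Ind

variable {F : Type*} [Field F] {n i j n₁ n₂ n₃ c d : ℕ}

/-- The adjoint action of an element of a block upper triangular group preserves the block upper
triangular matrices. -/
theorem ad_blockTriangular_iff {b : Fin n → ℕ} {g : GL (Fin n) F}
    (hg : (g : Matrix (Fin n) (Fin n) F).BlockTriangular b) (X : Matrix (Fin n) (Fin n) F) :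
    (adGL F (Fin n) g X).BlockTriangular b ↔ X.BlockTriangular b := by
  have key {g : GL (Fin n) F} (hg : (g : Matrix (Fin n) (Fin n) F).BlockTriangular b)
      {X : Matrix (Fin n) (Fin n) F} (hX : X.BlockTriangular b) :
      (adGL F (Fin n) g X).BlockTriangular b := (hg.mul hX).mul (blockTriangular_inv hg)
  refine ⟨fun h => ?_, key hg⟩
  simpa using key (blockTriangular_inv hg) h

/-- The block diagonal embedding of `GL(i) × GL(j)`. -/
def glLevi (h : i + j = n) (g : GL (Fin i) F × GL (Fin j) F) : GL (Fin n) F :=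
  ⟨glDiag F h (g.1, g.2), glDiag F h ((g.1⁻¹ : GL _ F), (g.2⁻¹ : GL _ F)),
    by rw [glDiag_mul, ← glDiag_one F h]; congr 1; simp [Prod.ext_iff],
    by rw [glDiag_mul, ← glDiag_one F h]; congr 1; simp [Prod.ext_iff]⟩

theorem glDiag_blockTriangular (h : i + j = n)
    (Y : Matrix (Fin i) (Fin i) F × Matrix (Fin j) (Fin j) F) :
    (glDiag F h Y).BlockTriangular (glBlk h) := by
  intro r s hrs
  rcases gl_cases h r with ⟨a, rfl⟩ | ⟨a, rfl⟩ <;> rcases gl_cases h s with ⟨b, rfl⟩ | ⟨b, rfl⟩ <;>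
  simp at hrs ⊢

theorem glBlocks_mul (h : i + j = n) {X Y : Matrix (Fin n) (Fin n) F}
    (hX : X.BlockTriangular (glBlk h)) (hY : Y.BlockTriangular (glBlk h)) :
    glBlocks F h (X * Y) = glBlocks F h X * glBlocks F h Y :=
  Prod.ext
    (mul_submatrix_of_blockTriangular hX hY 0 _ (fun a b hab => by simpa using hab) (glBlk_zero h))
    (mul_submatrix_of_blockTriangular hX hY 1 _ (fun a b hab => by simpa using hab) (glBlk_one h))

/-- The projection of a parabolic subgroup of `GL(n)` to the first factor of its Levi quotient. -/
def glFst (h : i + j = n) : blockUpper F (glBlk h) →* GL (Fin i) F where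
  toFun p := diagBlock p.1 p.2 0 _ (fun a b hab => by simpa using hab) (glBlk_zero h)
  map_one' := Units.ext (by
    change (glBlocks F h 1).1 = 1
    rw [← glDiag_one F h, glBlocks_glDiag]; rfl)
  map_mul' p q := Units.ext (congrArg Prod.fst (glBlocks_mul h p.2 q.2))

theorem glFst_surjective (h : i + j = n) : Function.Surjective (glFst (F := F) h) := by
  intro g
  refine ⟨⟨glLevi h (g, 1), glDiag_blockTriangular h _⟩, Units.ext ?_⟩
  change (glBlocks F h (glDiag F h (g.1, _))).1 = g.1
  rw [glBlocks_glDiag]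

theorem blk3_blockTriangular_iff (h₁₂ : n₁ + n₂ = c) (h : c + n₃ = n)
    (X : Matrix (Fin n) (Fin n) F) :
    X.BlockTriangular (blk3 n₁ n₂) ↔ X.BlockTriangular (glBlk h) ∧
      (glBlocks F h X).1.BlockTriangular (glBlk h₁₂) := by
  constructor
  · intro hX
    refine ⟨fun r s hrs => ?_, fun r s hrs => hX (by simpa [h₁₂] using hrs)⟩
    rcases gl_cases h r with ⟨a, rfl⟩ | ⟨a, rfl⟩ <;> rcases gl_cases h s with ⟨b, rfl⟩ | ⟨b, rfl⟩
    · simp at hrs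
    · simp at hrs
    · exact hX (by simpa [blk3_inl h₁₂ h, blk3_inr h₁₂ h] using glBlk_lt_two h₁₂ b)
    · simp at hrs
  · rintro ⟨h1, h2⟩ r s hrs
    rcases gl_cases h r with ⟨a, rfl⟩ | ⟨a, rfl⟩ <;> rcases gl_cases h s with ⟨b, rfl⟩ | ⟨b, rfl⟩
    · exact h2 (by simpa [h₁₂] using hrs)
    · have := glBlk_lt_two h₁₂ a
      simp [blk3_inl h₁₂ h, blk3_inr h₁₂ h] at hrs
      omega
    · exact h1 (by simp)
    · simp [blk3_inr h₁₂ h] at hrs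

/-- Inside the coarser parabolic, the finer one is the full preimage of a parabolic of `GL(c)` under
the surjection `glFst`, so its relative index is the index in `GL(c)`. -/
theorem index_blockUpper_blk3 (h₁₂ : n₁ + n₂ = c) (h : c + n₃ = n) :
    (blockUpper F (blk3 n₁ n₂ : Fin n → ℕ)).index =
      (blockUpper F (glBlk h₁₂)).index * (blockUpper F (glBlk h)).index := by
  have hle : blockUpper F (blk3 n₁ n₂ : Fin n → ℕ) ≤ blockUpper F (glBlk h) :=
    fun g hg => ((blk3_blockTriangular_iff h₁₂ h _).1 hg).1
  rw [← Subgroup.relIndex_mul_index hle, Subgroup.relIndex,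
    ← Subgroup.index_comap_of_surjective _ (glFst_surjective h)]
  congr 2
  ext p
  rw [Subgroup.mem_subgroupOf, Subgroup.mem_comap]
  exact (blk3_blockTriangular_iff h₁₂ h p.1.1).trans (and_iff_right p.2)

open Classical in
/-- Parabolic induction of a function on the block upper triangular matrices. -/
noncomputable def indFun (b : Fin n → ℕ) (Φ : Matrix (Fin n) (Fin n) F → ℝ)
    (X : Matrix (Fin n) (Fin n) F) : ℝ :=
  ((blockUpper F b).index : ℝ) * avg fun g => if (adGL F (Fin n) g⁻¹ X).BlockTriangular b then
    Φ (adGL F (Fin n) g⁻¹ X) else 0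

theorem glInd_apply [Finite F] (h : i + j = n) (Φ : InvFun (adProd (adGL F (Fin i)) (adGL F (Fin j))))
    (X : Matrix (Fin n) (Fin n) F) :
    ((glParabolic F h).ind Φ).1 X = indFun (glBlk h) (fun Y => Φ.1 (glBlocks F h Y)) X := by
  rw [Parabolic.ind_apply, indFun]
  refine congrArg _ (avg_congr fun g => ?_)
  unfold Parabolic.extend
  classical
  exact if_congr Iff.rfl rfl rfl

theorem index_blockUpper_rev {b b' : Fin n → ℕ} (hb : ∀ r s, b r < b s ↔ b' s.rev < b' r.rev) :
    (blockUpper F b').index = (blockUpper F b).index := by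
  rw [← Subgroup.index_comap_of_surjective _
    (f := (flipGL (F := F) (m := n)).toMonoidHom) flipGL.surjective]
  congr 1
  ext g
  rw [Subgroup.mem_comap, ← inv_mem_iff (x := g)]
  exact flip_blockTriangular hb _

/-- With `S` conjugating `X` to its flip, the substitution `g ↦ S⁻¹ * flipGL g` turns each conjugate
of `X` in the average into the flip of a conjugate of `X`. -/
theorem indFun_flip [Finite F] {b b' : Fin n → ℕ} (hb : ∀ r s, b r < b s ↔ b' s.rev < b' r.rev)
    (Φ : Matrix (Fin n) (Fin n) F → ℝ) (X : Matrix (Fin n) (Fin n) F) :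
    indFun b (fun Y => Φ (flip Y)) X = indFun b' Φ X := by
  obtain ⟨S, hS⟩ := exists_ad_eq_flip X
  rw [indFun, indFun, index_blockUpper_rev hb,
    ← avg_comp_equiv ((flipGL (F := F) (m := n)).toEquiv.trans (Equiv.mulLeft S⁻¹))]
  congr 1
  refine avg_congr fun g => ?_
  have : adGL F (Fin n) ((flipGL.toEquiv.trans (Equiv.mulLeft S⁻¹)) g)⁻¹ X =
      flip (adGL F (Fin n) g⁻¹ X) := by
    change adGL F (Fin n) (S⁻¹ * flipGL g)⁻¹ X = _
    rw [flip_ad, ← hS, ← ad_mul_apply, map_inv flipGL, mul_inv_rev, inv_inv]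
  rw [this, flip_flip]
  classical
  exact if_congr (flip_blockTriangular (fun r s => by simpa using (hb s.rev r.rev).symm) _) rfl rfl

theorem glInd_comm [Finite F] (h : i + j = n) (h' : j + i = n) (f₁ : InvFun (adGL F (Fin i)))
    (f₂ : InvFun (adGL F (Fin j))) :
    (glParabolic F h).ind (tensorToProd _ _ (f₁ ⊗ₜ f₂)) =
      (glParabolic F h').ind (tensorToProd _ _ (f₂ ⊗ₜ f₁)) := by
  refine Subtype.ext (funext fun X => ?_)
  rw [glInd_apply, glInd_apply, ← indFun_flip (glBlk_rev h h')]
  congr 1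
  funext Y
  rw [glBlocks_flip h' h, tensorToProd_tmul, tensorToProd_tmul, InvFun.apply_flip,
    InvFun.apply_flip, mul_comm]

/-- The product of three functions, bracketed from the left. -/
noncomputable def ind3 [Finite F] (h₁₂ : n₁ + n₂ = c) (h : c + n₃ = n)
    (f₁ : InvFun (adGL F (Fin n₁))) (f₂ : InvFun (adGL F (Fin n₂)))
    (f₃ : InvFun (adGL F (Fin n₃))) : InvFun (adGL F (Fin n)) :=
  (glParabolic F h).ind (tensorToProd _ _
    ((glParabolic F h₁₂).ind (tensorToProd _ _ (f₁ ⊗ₜ f₂)) ⊗ₜ f₃))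

theorem ad_glLevi (h : i + j = n) (g : GL (Fin i) F) (X : Matrix (Fin n) (Fin n) F)
    (hX : X.BlockTriangular (glBlk h)) :
    glBlocks F h (adGL F (Fin n) (glLevi h (g, 1)) X) =
      (adGL F (Fin i) g (glBlocks F h X).1, (glBlocks F h X).2) := by
  have h1 := glDiag_blockTriangular (F := F) h (g.1, 1)
  have h2 := glDiag_blockTriangular (F := F) h ((g⁻¹ : GL (Fin i) F).1, 1)
  rw [adGL_apply]
  change glBlocks F h (glDiag F h (g.1, 1) * X * glDiag F h ((g⁻¹ : GL (Fin i) F).1, 1)) = _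
  rw [glBlocks_mul h (h1.mul hX) h2, glBlocks_mul h h1 hX, glBlocks_glDiag, glBlocks_glDiag]
  simp [Prod.ext_iff, adGL_apply]

/-- Transitivity of induction: the inner average over `GL(c)` can be performed by translating `g`
with Levi elements, and the average over `g` absorbs such translations. The index is multiplicative
by `index_blockUpper_blk3`. -/
theorem ind3_apply [Finite F] (h₁₂ : n₁ + n₂ = c) (h : c + n₃ = n)
    (f₁ : InvFun (adGL F (Fin n₁))) (f₂ : InvFun (adGL F (Fin n₂)))
    (f₃ : InvFun (adGL F (Fin n₃))) (X : Matrix (Fin n) (Fin n) F) :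
    (ind3 h₁₂ h f₁ f₂ f₃).1 X = indFun (blk3 n₁ n₂) (fun Y =>
      f₁.1 (glBlocks F h₁₂ (glBlocks F h Y).1).1 * f₂.1 (glBlocks F h₁₂ (glBlocks F h Y).1).2 *
        f₃.1 (glBlocks F h Y).2) X := by
  classical
  rw [ind3, glInd_apply]
  simp only [tensorToProd_tmul, glInd_apply]
  rw [indFun, indFun, index_blockUpper_blk3 h₁₂ h, mul_comm (blockUpper F (glBlk h₁₂)).index,
    Nat.cast_mul, mul_assoc, ← avg_const_mul (((blockUpper F (glBlk h₁₂)).index : ℕ) : ℝ)]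
  congr 1
  set K := fun Y => f₁.1 (glBlocks F h₁₂ (glBlocks F h Y).1).1 *
    f₂.1 (glBlocks F h₁₂ (glBlocks F h Y).1).2 * f₃.1 (glBlocks F h Y).2 with hK
  set k := (((blockUpper F (glBlk h₁₂)).index : ℕ) : ℝ) with hk
  let T : Matrix (Fin n) (Fin n) F → ℝ := fun Y =>
    k * if Y.BlockTriangular (blk3 n₁ n₂) then K Y else 0
  -- Conjugation by a Levi element preserves the outer parabolic. Inside it, this conjugation acts
  -- on the first diagonal block as in the inner induction; outside it both sides vanish.
  have h1 (Y : Matrix (Fin n) (Fin n) F) : (if Y.BlockTriangular (glBlk h) then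
      indFun (glBlk h₁₂) (fun Y => f₁.1 (glBlocks F h₁₂ Y).1 * f₂.1 (glBlocks F h₁₂ Y).2)
        (glBlocks F h Y).1 * f₃.1 (glBlocks F h Y).2 else 0) =
      avg fun g' : GL (Fin c) F => T (adGL F (Fin n) (glLevi h (g'⁻¹, 1)) Y) := by
    by_cases hY : Y.BlockTriangular (glBlk h)
    · rw [if_pos hY, indFun, ← avg_const_mul, ← avg_mul_const]
      refine avg_congr fun g' => ?_
      simp only [T, blk3_blockTriangular_iff h₁₂ h, ad_glLevi h _ _ hY,
        ad_blockTriangular_iff (g := glLevi h (g'⁻¹, 1)) (glDiag_blockTriangular h _), hY, true_and,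
        hK]
      split_ifs <;> ring
    · rw [if_neg hY, ← avg_zero (α := GL (Fin c) F)]
      refine avg_congr fun g' => ?_
      simp only [T, blk3_blockTriangular_iff h₁₂ h,
        ad_blockTriangular_iff (g := glLevi h (g'⁻¹, 1)) (glDiag_blockTriangular h _), hY, false_and,
        if_false, mul_zero]
  simp only [h1]
  -- With the average over `g'` outermost, each of its terms equals the right side after the
  -- translation of `g` by the inverse Levi element.
  rw [avg_comm, ← avg_const (α := GL (Fin c) F) (avg fun g => k * _)]
  refine avg_congr fun g' => ?_
  refine Eq.trans (avg_congr fun g => ?_)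
    (avg_comp_equiv (Equiv.mulRight (glLevi h (g'⁻¹, 1))⁻¹) fun g => T (adGL F (Fin n) g⁻¹ X))
  rw [Equiv.coe_mulRight, mul_inv_rev, inv_inv, ad_mul_apply]

theorem ind3_rev [Finite F] (h₁₂ : n₁ + n₂ = c) (h : c + n₃ = n) (h₃₂ : n₃ + n₂ = d)
    (h' : d + n₁ = n) (f₁ : InvFun (adGL F (Fin n₁))) (f₂ : InvFun (adGL F (Fin n₂)))
    (f₃ : InvFun (adGL F (Fin n₃))) : ind3 h₁₂ h f₁ f₂ f₃ = ind3 h₃₂ h' f₃ f₂ f₁ := by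
  refine Subtype.ext (funext fun X => ?_)
  rw [ind3_apply, ind3_apply, ← indFun_flip (blk3_rev (by omega : n₁ + n₂ + n₃ = n))]
  congr 1
  funext Y
  have h₂₃ : n₂ + n₃ = d := by omega
  have h'' : n₁ + d = n := by omega
  have e1 : (glBlocks F h₁₂ (glBlocks F h Y).1).1 = (glBlocks F h'' Y).1 := by
    ext r s; simp [glBlocks, glEquiv_assoc_inl_inl h₁₂ h h'']
  have e2 : (glBlocks F h₁₂ (glBlocks F h Y).1).2 = (glBlocks F h₂₃ (glBlocks F h'' Y).2).1 := by
    ext r s; simp [glBlocks, glEquiv_assoc_inl_inr h₁₂ h h₂₃ h'']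
  have e3 : (glBlocks F h Y).2 = (glBlocks F h₂₃ (glBlocks F h'' Y).2).2 := by
    ext r s; simp [glBlocks, glEquiv_assoc_inr h₁₂ h h₂₃ h'']
  rw [e1, e2, e3, glBlocks_flip h' h'', glBlocks_flip h₃₂ h₂₃]
  simp only [InvFun.apply_flip]
  ring

/-- The same word in the swap and the reversal as in `res3_perm`. -/
theorem ind3_perm [Finite F] (h₁₂ : n₁ + n₂ = c) (h : c + n₃ = n) (h₁₃ : n₁ + n₃ = d)
    (h' : d + n₂ = n) (f₁ : InvFun (adGL F (Fin n₁))) (f₂ : InvFun (adGL F (Fin n₂)))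
    (f₃ : InvFun (adGL F (Fin n₃))) : ind3 h₁₂ h f₁ f₂ f₃ = ind3 h₁₃ h' f₁ f₃ f₂ := by
  rw [ind3, glInd_comm h₁₂ (by omega), ← ind3, ind3_rev _ h (by omega : n₃ + n₁ = d) h', ind3,
    glInd_comm _ h₁₃, ← ind3]

end Ind

end LieInv

set_option linter.unusedSimpArgs false

namespace LieInv

/-! ### Relative positions of two isotropic subspaces -/

section UNum

variable {i j n : ℕ}

theorem val_uFst (h : i + j = n) (a : Fin i) : (uFst h a).val = a := by
  simp [uFst, uEquiv]

theorem val_uMid (h : i + j = n) (a : Fin (2 * j)) : (uMid h a).val = i + a := by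
  simp [uMid, uEquiv]

theorem val_uLst (h : i + j = n) (a : Fin i) : (uLst h a).val = i + (2 * j + a) := by
  simp [uLst, uEquiv]

theorem uBlk_eq (h : i + j = n) (v : Fin (2 * n)) : uBlk h v = blk3 i (2 * j) v := by
  rcases u_cases h v with ⟨a, rfl⟩ | ⟨a, rfl⟩ | ⟨a, rfl⟩
  · simp [blk3, val_uFst]
  · simp [blk3, val_uMid]
  · rw [uBlk_uLst, blk3, val_uLst]; split_ifs <;> omega

end UNum

/-- The possible relative positions of isotropic subspaces `W`, `E` of dimensions `i`, `k` in a space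
of dimension `2(i + j) = 2(k + l)`. Here `r` is the dimension of `W ⊓ E`, and `r + s` is the dimension
of `W ⊓ E^⊥`. -/
structure Position (i j k l : ℕ) where
  r : ℕ
  s : ℕ
  t : ℕ
  j₁ : ℕ
  j₂ : ℕ
  hi : r + s + t = i
  hj : j₁ + j₂ = j
  hk : r + j₁ + t = k
  hl : s + j₂ = l

namespace Position

variable {i j k l n : ℕ} (τ : Position i j k l)

/-- The relative position of `E` and `W`. -/
abbrev symm : Position k l i j :=
  ⟨τ.r, τ.j₁, τ.t, τ.s, τ.j₂, τ.hk, τ.hl, τ.hi, τ.hj⟩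

/-- The permutation of the standard basis attached to a relative position, on natural numbers. -/
def sigNat (v : ℕ) : ℕ :=
  if v < τ.r then v
  else if v < τ.r + τ.s then v + (τ.j₁ + τ.t)
  else if v < i then v + (k + 2 * l) - (τ.r + τ.s)
  else if v < i + τ.j₁ then v - (τ.s + τ.t)
  else if v < i + τ.j₁ + 2 * τ.j₂ then v
  else if v < i + 2 * j then v + (τ.s + τ.t)
  else if v < i + 2 * j + τ.t then v + (τ.r + τ.j₁) - (i + 2 * j)
  else if v < i + 2 * j + τ.t + τ.s then v - (τ.j₁ + τ.t)
  else v

/-- The source blocks are cut into intervals of sizes `r, s, t | j₁, 2j₂, j₁ | t, s, r`, the target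
blocks into `r, j₁, t | s, 2j₂, s | t, j₁, r`. The two labels in each of the nine names are the
source block and the target block of the interval that is moved. -/
theorem sigNat_fst_fst {c : ℕ} (hc : c < τ.r) : τ.sigNat c = c := by
  have h₁ := τ.hi
  have h₂ := τ.hj
  have h₃ := τ.hk
  have h₄ := τ.hl
  rw [sigNat, if_pos (by omega)]

theorem sigNat_fst_mid {c : ℕ} (hc : c < τ.s) : τ.sigNat (τ.r + c) = k + c := by
  have h₁ := τ.hi
  have h₂ := τ.hj
  have h₃ := τ.hk
  have h₄ := τ.hl
  rw [sigNat, if_neg (by omega), if_pos (by omega)]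
  omega

theorem sigNat_fst_lst {c : ℕ} (hc : c < τ.t) : τ.sigNat (τ.r + τ.s + c) = k + 2 * l + c := by
  have h₁ := τ.hi
  have h₂ := τ.hj
  have h₃ := τ.hk
  have h₄ := τ.hl
  rw [sigNat, if_neg (by omega), if_neg (by omega), if_pos (by omega)]
  omega

theorem sigNat_mid_fst {c : ℕ} (hc : c < τ.j₁) : τ.sigNat (i + c) = τ.r + c := by
  have h₁ := τ.hi
  have h₂ := τ.hj
  have h₃ := τ.hk
  have h₄ := τ.hl
  rw [sigNat, if_neg (by omega), if_neg (by omega), if_neg (by omega), if_pos (by omega)]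
  omega

theorem sigNat_mid_mid {c : ℕ} (hc : c < 2 * τ.j₂) : τ.sigNat (i + τ.j₁ + c) = k + τ.s + c := by
  have h₁ := τ.hi
  have h₂ := τ.hj
  have h₃ := τ.hk
  have h₄ := τ.hl
  rw [sigNat, if_neg (by omega),
    if_neg (by omega), if_neg (by omega), if_neg (by omega), if_pos (by omega)]
  omega

theorem sigNat_mid_lst {c : ℕ} (hc : c < τ.j₁) : τ.sigNat (i + τ.j₁ + 2 * τ.j₂ + c) = k + 2 * l + τ.t + c := by
  have h₁ := τ.hi
  have h₂ := τ.hj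
  have h₃ := τ.hk
  have h₄ := τ.hl
  rw [sigNat, if_neg (by omega),
    if_neg (by omega), if_neg (by omega), if_neg (by omega), if_neg (by omega), if_pos (by omega)]
  omega

theorem sigNat_lst_fst {c : ℕ} (hc : c < τ.t) : τ.sigNat (i + 2 * j + c) = τ.r + τ.j₁ + c := by
  have h₁ := τ.hi
  have h₂ := τ.hj
  have h₃ := τ.hk
  have h₄ := τ.hl
  rw [sigNat, if_neg (by omega),
    if_neg (by omega), if_neg (by omega), if_neg (by omega), if_neg (by omega), if_neg (by omega), if_pos (by omega)]
  omega

theorem sigNat_lst_mid {c : ℕ} (hc : c < τ.s) : τ.sigNat (i + 2 * j + τ.t + c) = k + τ.s + 2 * τ.j₂ + c := by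
  have h₁ := τ.hi
  have h₂ := τ.hj
  have h₃ := τ.hk
  have h₄ := τ.hl
  rw [sigNat, if_neg (by omega),
    if_neg (by omega), if_neg (by omega), if_neg (by omega), if_neg (by omega), if_neg (by omega), if_neg (by omega), if_pos (by omega)]
  omega

theorem sigNat_lst_lst {c : ℕ} :
    τ.sigNat (i + 2 * j + τ.t + τ.s + c) = k + 2 * l + τ.t + τ.j₁ + c := by
  have h₁ := τ.hi
  have h₂ := τ.hj
  have h₃ := τ.hk
  have h₄ := τ.hl
  rw [sigNat, if_neg (by omega),
    if_neg (by omega), if_neg (by omega), if_neg (by omega), if_neg (by omega), if_neg (by omega), if_neg (by omega), if_neg (by omega)]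
  omega

theorem cases (h : i + j = n) {v : ℕ} (hv : v < 2 * n) :
    (∃ c, c < τ.r ∧ v = c) ∨
    (∃ c, c < τ.s ∧ v = τ.r + c) ∨
    (∃ c, c < τ.t ∧ v = τ.r + τ.s + c) ∨
    (∃ c, c < τ.j₁ ∧ v = i + c) ∨
    (∃ c, c < 2 * τ.j₂ ∧ v = i + τ.j₁ + c) ∨
    (∃ c, c < τ.j₁ ∧ v = i + τ.j₁ + 2 * τ.j₂ + c) ∨
    (∃ c, c < τ.t ∧ v = i + 2 * j + c) ∨
    (∃ c, c < τ.s ∧ v = i + 2 * j + τ.t + c) ∨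
    (∃ c, c < τ.r ∧ v = i + 2 * j + τ.t + τ.s + c) := by
  have h₁ := τ.hi
  have h₂ := τ.hj
  refine (lt_or_ge v (τ.r)).elim (fun hc => Or.inl ⟨v, by omega, rfl⟩) fun h0 => Or.inr ?_
  refine (lt_or_ge v (τ.r + τ.s)).elim (fun hc => Or.inl ⟨v - (τ.r), by omega, by omega⟩) fun h1 => Or.inr ?_
  refine (lt_or_ge v (i)).elim (fun hc => Or.inl ⟨v - (τ.r + τ.s), by omega, by omega⟩) fun h2 => Or.inr ?_
  refine (lt_or_ge v (i + τ.j₁)).elim (fun hc => Or.inl ⟨v - (i), by omega, by omega⟩) fun h3 => Or.inr ?_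
  refine (lt_or_ge v (i + τ.j₁ + 2 * τ.j₂)).elim (fun hc => Or.inl ⟨v - (i + τ.j₁), by omega, by omega⟩) fun h4 => Or.inr ?_
  refine (lt_or_ge v (i + 2 * j)).elim (fun hc => Or.inl ⟨v - (i + τ.j₁ + 2 * τ.j₂), by omega, by omega⟩) fun h5 => Or.inr ?_
  refine (lt_or_ge v (i + 2 * j + τ.t)).elim (fun hc => Or.inl ⟨v - (i + 2 * j), by omega, by omega⟩) fun h6 => Or.inr ?_
  refine (lt_or_ge v (i + 2 * j + τ.t + τ.s)).elim (fun hc => Or.inl ⟨v - (i + 2 * j + τ.t), by omega, by omega⟩) fun h7 => Or.inr ?_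
  exact ⟨v - (i + 2 * j + τ.t + τ.s), by omega, by omega⟩

theorem sigNat_lt (h : i + j = n) {v : ℕ} (hv : v < 2 * n) : τ.sigNat v < 2 * n := by
  have h₁ := τ.hi
  have h₂ := τ.hj
  have h₃ := τ.hk
  have h₄ := τ.hl
  rcases τ.cases h hv with ⟨c, hc, rfl⟩ |
    ⟨c, hc, rfl⟩ |
    ⟨c, hc, rfl⟩ |
    ⟨c, hc, rfl⟩ |
    ⟨c, hc, rfl⟩ |
    ⟨c, hc, rfl⟩ |
    ⟨c, hc, rfl⟩ |
    ⟨c, hc, rfl⟩ |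
    ⟨c, hc, rfl⟩
  · rw [τ.sigNat_fst_fst hc]; omega
  · rw [τ.sigNat_fst_mid hc]; omega
  · rw [τ.sigNat_fst_lst hc]; omega
  · rw [τ.sigNat_mid_fst hc]; omega
  · rw [τ.sigNat_mid_mid hc]; omega
  · rw [τ.sigNat_mid_lst hc]; omega
  · rw [τ.sigNat_lst_fst hc]; omega
  · rw [τ.sigNat_lst_mid hc]; omega
  · rw [τ.sigNat_lst_lst]; omega

/-- The nine rules are symmetric under exchanging the two parabolics, which exchanges `s` with `j₁`;
the rule that undoes a given one has its two labels interchanged. -/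
theorem sigNat_symm (h : i + j = n) {v : ℕ} (hv : v < 2 * n) :
    τ.symm.sigNat (τ.sigNat v) = v := by
  rcases τ.cases h hv with ⟨c, hc, rfl⟩ |
    ⟨c, hc, rfl⟩ |
    ⟨c, hc, rfl⟩ |
    ⟨c, hc, rfl⟩ |
    ⟨c, hc, rfl⟩ |
    ⟨c, hc, rfl⟩ |
    ⟨c, hc, rfl⟩ |
    ⟨c, hc, rfl⟩ |
    ⟨c, hc, rfl⟩
  · rw [τ.sigNat_fst_fst hc]; exact τ.symm.sigNat_fst_fst hc
  · rw [τ.sigNat_fst_mid hc]; exact τ.symm.sigNat_mid_fst hc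
  · rw [τ.sigNat_fst_lst hc]; exact τ.symm.sigNat_lst_fst hc
  · rw [τ.sigNat_mid_fst hc]; exact τ.symm.sigNat_fst_mid hc
  · rw [τ.sigNat_mid_mid hc]; exact τ.symm.sigNat_mid_mid hc
  · rw [τ.sigNat_mid_lst hc]; exact τ.symm.sigNat_lst_mid hc
  · rw [τ.sigNat_lst_fst hc]; exact τ.symm.sigNat_fst_lst hc
  · rw [τ.sigNat_lst_mid hc]; exact τ.symm.sigNat_mid_lst hc
  · rw [τ.sigNat_lst_lst]; exact τ.symm.sigNat_lst_lst

/-- Reversal sends the interval with a given pair of labels to the one with first and last exchanged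
in both. Commuting with reversal is what makes the permutation matrix unitary. -/
theorem sigNat_rev (h : i + j = n) {v : ℕ} (hv : v < 2 * n) :
    τ.sigNat (2 * n - (v + 1)) = 2 * n - (τ.sigNat v + 1) := by
  have h₁ := τ.hi
  have h₂ := τ.hj
  have h₃ := τ.hk
  have h₄ := τ.hl
  rcases τ.cases h hv with ⟨c, hc, rfl⟩ |
    ⟨c, hc, rfl⟩ |
    ⟨c, hc, rfl⟩ |
    ⟨c, hc, rfl⟩ |
    ⟨c, hc, rfl⟩ |
    ⟨c, hc, rfl⟩ |
    ⟨c, hc, rfl⟩ |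
    ⟨c, hc, rfl⟩ |
    ⟨c, hc, rfl⟩
  · have := τ.sigNat_lst_lst (c := τ.r - (v + 1))
    rw [τ.sigNat_fst_fst hc, show 2 * n - (v + 1) = i + 2 * j + τ.t + τ.s + (τ.r - (v + 1)) by omega, this]
    omega
  · have := τ.sigNat_lst_mid (c := τ.s - (c + 1)) (by omega)
    rw [τ.sigNat_fst_mid hc, show 2 * n - (_ + 1) = i + 2 * j + τ.t + (τ.s - (c + 1)) by omega, this]
    omega
  · have := τ.sigNat_lst_fst (c := τ.t - (c + 1)) (by omega)
    rw [τ.sigNat_fst_lst hc, show 2 * n - (_ + 1) = i + 2 * j + (τ.t - (c + 1)) by omega, this]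
    omega
  · have := τ.sigNat_mid_lst (c := τ.j₁ - (c + 1)) (by omega)
    rw [τ.sigNat_mid_fst hc, show 2 * n - (_ + 1) = i + τ.j₁ + 2 * τ.j₂ + (τ.j₁ - (c + 1)) by omega, this]
    omega
  · have := τ.sigNat_mid_mid (c := 2 * τ.j₂ - (c + 1)) (by omega)
    rw [τ.sigNat_mid_mid hc, show 2 * n - (_ + 1) = i + τ.j₁ + (2 * τ.j₂ - (c + 1)) by omega, this]
    omega
  · have := τ.sigNat_mid_fst (c := τ.j₁ - (c + 1)) (by omega)
    rw [τ.sigNat_mid_lst hc, show 2 * n - (_ + 1) = i + (τ.j₁ - (c + 1)) by omega, this]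
    omega
  · have := τ.sigNat_fst_lst (c := τ.t - (c + 1)) (by omega)
    rw [τ.sigNat_lst_fst hc, show 2 * n - (_ + 1) = τ.r + τ.s + (τ.t - (c + 1)) by omega, this]
    omega
  · have := τ.sigNat_fst_mid (c := τ.s - (c + 1)) (by omega)
    rw [τ.sigNat_lst_mid hc, show 2 * n - (_ + 1) = τ.r + (τ.s - (c + 1)) by omega, this]
    omega
  · have := τ.sigNat_fst_fst (c := τ.r - (c + 1)) (by omega)
    rw [τ.sigNat_lst_lst, show 2 * n - (_ + 1) = τ.r - (c + 1) by omega, this]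
    omega
/-- The permutation of the standard basis attached to a relative position. -/
def sig (h : i + j = n) (h' : k + l = n) : Equiv.Perm (Fin (2 * n)) where
  toFun v := ⟨τ.sigNat v, τ.sigNat_lt h v.2⟩
  invFun v := ⟨τ.symm.sigNat v, τ.symm.sigNat_lt h' v.2⟩
  left_inv v := Fin.ext (τ.sigNat_symm h v.2)
  right_inv v := Fin.ext (τ.symm.sigNat_symm h' v.2)

theorem sig_rev (h : i + j = n) (h' : k + l = n) (v : Fin (2 * n)) :
    τ.sig h h' v.rev = (τ.sig h h' v).rev := by
  ext
  simp only [sig, Equiv.coe_fn_mk, Fin.val_rev]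
  exact τ.sigNat_rev h v.2

/-- The first of three consecutive blocks of sizes `r`, `s`, `t`. -/
def e₁ (a : Fin τ.r) : Fin i := ⟨a, by have := τ.hi; omega⟩

/-- The second of three consecutive blocks of sizes `r`, `s`, `t`. -/
def e₂ (a : Fin τ.s) : Fin i := ⟨τ.r + a, by have := τ.hi; omega⟩

/-- The third of three consecutive blocks of sizes `r`, `s`, `t`. -/
def e₃ (a : Fin τ.t) : Fin i := ⟨τ.r + τ.s + a, by have := τ.hi; omega⟩

/-- The first of three consecutive blocks of sizes `t`, `s`, `r`. -/
def o₃ (a : Fin τ.t) : Fin i := ⟨a, by have := τ.hi; omega⟩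

/-- The second of three consecutive blocks of sizes `t`, `s`, `r`. -/
def o₂ (a : Fin τ.s) : Fin i := ⟨τ.t + a, by have := τ.hi; omega⟩

/-- The third of three consecutive blocks of sizes `t`, `s`, `r`. -/
def o₁ (a : Fin τ.r) : Fin i := ⟨τ.t + τ.s + a, by have := τ.hi; omega⟩

theorem e_cases (a : Fin i) : (∃ b, a = τ.e₁ b) ∨ (∃ b, a = τ.e₂ b) ∨ (∃ b, a = τ.e₃ b) := by
  have := τ.hi
  rcases lt_or_ge a.1 τ.r with h | h
  · exact Or.inl ⟨⟨a, h⟩, rfl⟩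
  rcases lt_or_ge a.1 (τ.r + τ.s) with h' | h'
  · exact Or.inr (Or.inl ⟨⟨a - τ.r, by omega⟩, Fin.ext (by simp [e₂]; omega)⟩)
  · exact Or.inr (Or.inr ⟨⟨a - (τ.r + τ.s), by omega⟩, Fin.ext (by simp [e₃]; omega)⟩)

theorem o_cases (a : Fin i) : (∃ b, a = τ.o₃ b) ∨ (∃ b, a = τ.o₂ b) ∨ (∃ b, a = τ.o₁ b) := by
  have := τ.hi
  rcases lt_or_ge a.1 τ.t with h | h
  · exact Or.inl ⟨⟨a, h⟩, rfl⟩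
  rcases lt_or_ge a.1 (τ.t + τ.s) with h' | h'
  · exact Or.inr (Or.inl ⟨⟨a - τ.t, by omega⟩, Fin.ext (by simp [o₂]; omega)⟩)
  · exact Or.inr (Or.inr ⟨⟨a - (τ.t + τ.s), by omega⟩, Fin.ext (by simp [o₁]; omega)⟩)

@[simp] theorem blk3_e₁ (a : Fin τ.r) : blk3 τ.r τ.s (τ.e₁ a) = 0 := by simp [blk3, e₁]

@[simp] theorem blk3_e₂ (a : Fin τ.s) : blk3 τ.r τ.s (τ.e₂ a) = 1 := by simp [blk3, e₂]

@[simp] theorem blk3_e₃ (a : Fin τ.t) : blk3 τ.r τ.s (τ.e₃ a) = 2 := by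
  rw [blk3, if_neg, if_neg] <;> simp only [e₃] <;> omega

@[simp] theorem blk3_o₃ (a : Fin τ.t) : blk3 τ.t τ.s (τ.o₃ a) = 0 := by simp [blk3, o₃]

@[simp] theorem blk3_o₂ (a : Fin τ.s) : blk3 τ.t τ.s (τ.o₂ a) = 1 := by simp [blk3, o₂]

@[simp] theorem blk3_o₁ (a : Fin τ.r) : blk3 τ.t τ.s (τ.o₁ a) = 2 := by
  rw [blk3, if_neg, if_neg] <;> simp only [o₁] <;> omega

section Sig

variable (h : i + j = n) (h' : k + l = n)

@[simp] theorem sig_fst_e₁ (a : Fin τ.r) : τ.sig h h' (uFst h (τ.e₁ a)) = uFst h' (τ.symm.e₁ a) := by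
  have h₁ := τ.hi
  have h₂ := τ.hj
  have h₃ := τ.hk
  have h₄ := τ.hl
  have hs := τ.sigNat_fst_fst a.2
  ext
  simp only [sig, Equiv.coe_fn_mk, val_uFst, val_uMid, val_uLst, e₁, e₂, e₃, o₁, o₂, o₃, symm,
    add_assoc] at hs ⊢
  omega

@[simp] theorem sig_fst_e₂ (a : Fin τ.s) : τ.sig h h' (uFst h (τ.e₂ a)) = uMid h' (uFst τ.hl a) := by
  have h₁ := τ.hi
  have h₂ := τ.hj
  have h₃ := τ.hk
  have h₄ := τ.hl
  have hs := τ.sigNat_fst_mid a.2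
  ext
  simp only [sig, Equiv.coe_fn_mk, val_uFst, val_uMid, val_uLst, e₁, e₂, e₃, o₁, o₂, o₃, symm,
    add_assoc] at hs ⊢
  omega

@[simp] theorem sig_fst_e₃ (a : Fin τ.t) : τ.sig h h' (uFst h (τ.e₃ a)) = uLst h' (τ.symm.o₃ a) := by
  have h₁ := τ.hi
  have h₂ := τ.hj
  have h₃ := τ.hk
  have h₄ := τ.hl
  have hs := τ.sigNat_fst_lst a.2
  ext
  simp only [sig, Equiv.coe_fn_mk, val_uFst, val_uMid, val_uLst, e₁, e₂, e₃, o₁, o₂, o₃, symm,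
    add_assoc] at hs ⊢
  omega

@[simp] theorem sig_mid_fst (a : Fin τ.j₁) : τ.sig h h' (uMid h (uFst τ.hj a)) = uFst h' (τ.symm.e₂ a) := by
  have h₁ := τ.hi
  have h₂ := τ.hj
  have h₃ := τ.hk
  have h₄ := τ.hl
  have hs := τ.sigNat_mid_fst a.2
  ext
  simp only [sig, Equiv.coe_fn_mk, val_uFst, val_uMid, val_uLst, e₁, e₂, e₃, o₁, o₂, o₃, symm,
    add_assoc] at hs ⊢
  omega

@[simp] theorem sig_mid_mid (a : Fin (2 * τ.j₂)) : τ.sig h h' (uMid h (uMid τ.hj a)) = uMid h' (uMid τ.hl a) := by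
  have h₁ := τ.hi
  have h₂ := τ.hj
  have h₃ := τ.hk
  have h₄ := τ.hl
  have hs := τ.sigNat_mid_mid a.2
  ext
  simp only [sig, Equiv.coe_fn_mk, val_uFst, val_uMid, val_uLst, e₁, e₂, e₃, o₁, o₂, o₃, symm,
    add_assoc] at hs ⊢
  omega

@[simp] theorem sig_mid_lst (a : Fin τ.j₁) : τ.sig h h' (uMid h (uLst τ.hj a)) = uLst h' (τ.symm.o₂ a) := by
  have h₁ := τ.hi
  have h₂ := τ.hj
  have h₃ := τ.hk
  have h₄ := τ.hl
  have hs := τ.sigNat_mid_lst a.2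
  ext
  simp only [sig, Equiv.coe_fn_mk, val_uFst, val_uMid, val_uLst, e₁, e₂, e₃, o₁, o₂, o₃, symm,
    add_assoc] at hs ⊢
  omega

@[simp] theorem sig_lst_o₃ (a : Fin τ.t) : τ.sig h h' (uLst h (τ.o₃ a)) = uFst h' (τ.symm.e₃ a) := by
  have h₁ := τ.hi
  have h₂ := τ.hj
  have h₃ := τ.hk
  have h₄ := τ.hl
  have hs := τ.sigNat_lst_fst a.2
  ext
  simp only [sig, Equiv.coe_fn_mk, val_uFst, val_uMid, val_uLst, e₁, e₂, e₃, o₁, o₂, o₃, symm,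
    add_assoc] at hs ⊢
  omega

@[simp] theorem sig_lst_o₂ (a : Fin τ.s) : τ.sig h h' (uLst h (τ.o₂ a)) = uMid h' (uLst τ.hl a) := by
  have h₁ := τ.hi
  have h₂ := τ.hj
  have h₃ := τ.hk
  have h₄ := τ.hl
  have hs := τ.sigNat_lst_mid a.2
  ext
  simp only [sig, Equiv.coe_fn_mk, val_uFst, val_uMid, val_uLst, e₁, e₂, e₃, o₁, o₂, o₃, symm,
    add_assoc] at hs ⊢
  omega

@[simp] theorem sig_lst_o₁ (a : Fin τ.r) : τ.sig h h' (uLst h (τ.o₁ a)) = uLst h' (τ.symm.o₁ a) := by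
  have h₁ := τ.hi
  have h₂ := τ.hj
  have h₃ := τ.hk
  have h₄ := τ.hl
  have hs := τ.sigNat_lst_lst (c := a)
  ext
  simp only [sig, Equiv.coe_fn_mk, val_uFst, val_uMid, val_uLst, e₁, e₂, e₃, o₁, o₂, o₃, symm,
    add_assoc] at hs ⊢
  omega

/-- Together with the next two lemmas: on each diagonal block of the source, the pulled back block
number is again weakly increasing. The conjugate parabolic therefore meets the Levi subgroup in
standard parabolics, of types `(r, s, t)` and `(j₁, 2j₂, j₁)`. -/
theorem uBlk_sig_uFst (a : Fin i) : uBlk h' (τ.sig h h' (uFst h a)) = blk3 τ.r τ.s a := by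
  rcases τ.e_cases a with ⟨a, rfl⟩ | ⟨a, rfl⟩ | ⟨a, rfl⟩ <;> simp

theorem uBlk_sig_uMid (a : Fin (2 * j)) : uBlk h' (τ.sig h h' (uMid h a)) = uBlk τ.hj a := by
  rcases u_cases τ.hj a with ⟨a, rfl⟩ | ⟨a, rfl⟩ | ⟨a, rfl⟩ <;> simp

theorem uBlk_sig_uLst (a : Fin i) : uBlk h' (τ.sig h h' (uLst h a)) = blk3 τ.t τ.s a := by
  rcases τ.o_cases a with ⟨a, rfl⟩ | ⟨a, rfl⟩ | ⟨a, rfl⟩ <;> simp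

end Sig

end Position

/-! ### The Levi decomposition and the Cayley transform -/

section UMat

variable {F : Type*} [Field F] {m i j n : ℕ}

section Entries

variable (h : i + j = n) (A C : Matrix (Fin i) (Fin i) F) (B : Matrix (Fin (2 * j)) (Fin (2 * j)) F)

@[simp] theorem uDiag_fst_fst (a b : Fin i) : uDiag F h A B C (uFst h a) (uFst h b) = A a b := by
  simp [uDiag, uFst]

@[simp] theorem uDiag_fst_mid (a : Fin i) (b : Fin (2 * j)) :
    uDiag F h A B C (uFst h a) (uMid h b) = 0 := by simp [uDiag, uFst, uMid]

@[simp] theorem uDiag_fst_lst (a b : Fin i) : uDiag F h A B C (uFst h a) (uLst h b) = 0 := by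
  simp [uDiag, uFst, uLst]

@[simp] theorem uDiag_mid_fst (a : Fin (2 * j)) (b : Fin i) :
    uDiag F h A B C (uMid h a) (uFst h b) = 0 := by simp [uDiag, uFst, uMid]

@[simp] theorem uDiag_mid_mid (a b : Fin (2 * j)) :
    uDiag F h A B C (uMid h a) (uMid h b) = B a b := by simp [uDiag, uMid]

@[simp] theorem uDiag_mid_lst (a : Fin (2 * j)) (b : Fin i) :
    uDiag F h A B C (uMid h a) (uLst h b) = 0 := by simp [uDiag, uMid, uLst]

@[simp] theorem uDiag_lst_fst (a b : Fin i) : uDiag F h A B C (uLst h a) (uFst h b) = 0 := by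
  simp [uDiag, uFst, uLst]

@[simp] theorem uDiag_lst_mid (a : Fin i) (b : Fin (2 * j)) :
    uDiag F h A B C (uLst h a) (uMid h b) = 0 := by simp [uDiag, uMid, uLst]

@[simp] theorem uDiag_lst_lst (a b : Fin i) : uDiag F h A B C (uLst h a) (uLst h b) = C a b := by
  simp [uDiag, uLst]

theorem uDiag_blockTriangular_iff (b : Fin (2 * n) → ℕ) :
    (uDiag F h A B C).BlockTriangular b ↔ A.BlockTriangular (fun a => b (uFst h a)) ∧
      B.BlockTriangular (fun a => b (uMid h a)) ∧ C.BlockTriangular (fun a => b (uLst h a)) := by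
  constructor
  · intro hX
    exact ⟨fun r s hrs => by simpa using hX hrs, fun r s hrs => by simpa using hX hrs,
      fun r s hrs => by simpa using hX hrs⟩
  · rintro ⟨h1, h2, h3⟩ r s hrs
    rcases u_cases h r with ⟨a, rfl⟩ | ⟨a, rfl⟩ | ⟨a, rfl⟩ <;>
    rcases u_cases h s with ⟨b, rfl⟩ | ⟨b, rfl⟩ | ⟨b, rfl⟩ <;> simp
    · exact h1 hrs
    · exact h2 hrs
    · exact h3 hrs

theorem uDiag_mem_strictUpper_iff (b : Fin (2 * n) → ℕ) :
    uDiag F h A B C ∈ strictUpper F b ↔ A ∈ strictUpper F (fun a => b (uFst h a)) ∧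
      B ∈ strictUpper F (fun a => b (uMid h a)) ∧ C ∈ strictUpper F (fun a => b (uLst h a)) := by
  constructor
  · intro hX
    exact ⟨fun r s hrs => by simpa using hX _ _ hrs, fun r s hrs => by simpa using hX _ _ hrs,
      fun r s hrs => by simpa using hX _ _ hrs⟩
  · rintro ⟨h1, h2, h3⟩ r s hrs
    rcases u_cases h r with ⟨a, rfl⟩ | ⟨a, rfl⟩ | ⟨a, rfl⟩ <;>
    rcases u_cases h s with ⟨b, rfl⟩ | ⟨b, rfl⟩ | ⟨b, rfl⟩ <;> simp
    · exact h1 _ _ hrs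
    · exact h2 _ _ hrs
    · exact h3 _ _ hrs

end Entries

variable [StarRing F]

theorem tau_add (X Y : Matrix (Fin m) (Fin m) F) : tau F (X + Y) = tau F X + tau F Y := by
  ext r s; simp [tau_apply]

theorem tau_sub (X Y : Matrix (Fin m) (Fin m) F) : tau F (X - Y) = tau F X - tau F Y := by
  ext r s; simp [tau_apply]

theorem tau_blockTriangular {b b' : Fin m → ℕ}
    (hb : ∀ r s, b r < b s ↔ b' s.rev < b' r.rev) (X : Matrix (Fin m) (Fin m) F) :
    (tau F X).BlockTriangular b' ↔ X.BlockTriangular b := by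
  constructor
  · intro h r s hrs
    have := h ((hb s r).1 hrs)
    simpa [tau_apply] using this
  · intro h r s hrs
    rw [tau_apply, h ((hb r.rev s.rev).2 (by simpa using hrs)), star_zero]

theorem tau_mem_strictUpper {b b' : Fin m → ℕ}
    (hb : ∀ r s, b r < b s ↔ b' s.rev < b' r.rev) {X : Matrix (Fin m) (Fin m) F}
    (hX : X ∈ strictUpper F b) : tau F X ∈ strictUpper F b' := by
  intro r s hrs
  rw [tau_apply, hX, star_zero]
  have := hb s.rev r.rev
  simp only [Fin.rev_rev] at this
  omega

/-! #### The Cayley transform -/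

theorem strictUpper_pow {b : Fin m → ℕ} {Z : Matrix (Fin m) (Fin m) F} (hZ : Z ∈ strictUpper F b)
    (k : ℕ) {r s : Fin m} (h : b s < b r + k) : (Z ^ k) r s = 0 := by
  induction k generalizing r with
  | zero => rw [pow_zero, Matrix.one_apply_ne]; rintro rfl; omega
  | succ k ih =>
    rw [pow_succ', Matrix.mul_apply]
    refine Finset.sum_eq_zero fun t _ => ?_
    rcases le_or_gt (b t) (b r) with h' | h'
    · rw [hZ r t h', zero_mul]
    · rw [ih (by omega), mul_zero]

theorem isNilpotent_of_mem_strictUpper {b : Fin m → ℕ} {Z : Matrix (Fin m) (Fin m) F}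
    (hZ : Z ∈ strictUpper F b) : IsNilpotent Z := by
  refine ⟨(∑ r, b r) + 1, ?_⟩
  ext r s
  refine strictUpper_pow hZ _ ?_
  have := Finset.single_le_sum (f := b) (fun _ _ => Nat.zero_le _) (Finset.mem_univ s)
  omega

theorem blockTriangular_of_mem_strictUpper {b : Fin m → ℕ} {Z : Matrix (Fin m) (Fin m) F}
    (hZ : Z ∈ strictUpper F b) : Z.BlockTriangular b := fun r s hrs => hZ r s hrs.le

/-- The Cayley transform `Z ↦ (1 + Z)(1 - Z)⁻¹` is a bijection with inverse `u ↦ (u + 1)⁻¹(u - 1)`.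
It turns `tau Z = -Z` into `tau u * u = 1`. Being built from sums, products and inverses, it
respects every group of block triangular matrices, so the extra condition given by `b'` passes
along. -/
theorem card_unipotent_eq (h2 : (2 : F) ≠ 0) (b b' : Fin m → ℕ) :
    Nat.card {u : unitaryGrp F m // (u.1 : Matrix (Fin m) (Fin m) F) - 1 ∈ strictUpper F b ∧
      (u.1 : Matrix (Fin m) (Fin m) F).BlockTriangular b'} =
    Nat.card {Z : unitaryLie F m // Z.1 ∈ strictUpper F b ∧ Z.1.BlockTriangular b'} := by
  symm
  have hu1 : ∀ Z ∈ strictUpper F b, ∃ A : GL (Fin m) F, (A : Matrix (Fin m) (Fin m) F) = 1 + Z :=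
    fun Z hZ => (isNilpotent_of_mem_strictUpper hZ).isUnit_one_add
  have hu2 : ∀ Z ∈ strictUpper F b, ∃ A : GL (Fin m) F, (A : Matrix (Fin m) (Fin m) F) = 1 - Z :=
    fun Z hZ => (isNilpotent_of_mem_strictUpper hZ).isUnit_one_sub
  -- Since 2 is invertible, `u + 1` is twice `1 + (u - 1) / 2`, a unit plus a nilpotent.
  have hu3 : ∀ u : GL (Fin m) F, (u : Matrix (Fin m) (Fin m) F) - 1 ∈ strictUpper F b →
      ∃ A : GL (Fin m) F, (A : Matrix (Fin m) (Fin m) F) = u + 1 := by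
    intro u hu
    obtain ⟨A, hA⟩ := hu1 ((2 : F)⁻¹ • ((u : Matrix (Fin m) (Fin m) F) - 1)) (fun r s hrs => by
      simp [hu r s hrs])
    refine ⟨⟨(2 : F) • A.1, (2 : F)⁻¹ • (A⁻¹ : GL (Fin m) F).1, ?_, ?_⟩, ?_⟩
    · rw [smul_mul_smul_comm, mul_inv_cancel₀ h2, one_smul, Units.mul_inv]
    · rw [smul_mul_smul_comm, inv_mul_cancel₀ h2, one_smul, Units.inv_mul]
    · change (2 : F) • A.1 = _
      rw [hA, smul_add, smul_inv_smul₀ h2, two_smul]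
      abel
  have key : ∀ Z : {Z : unitaryLie F m // Z.1 ∈ strictUpper F b ∧ Z.1.BlockTriangular b'},
      ∃ u : {u : unitaryGrp F m // (u.1 : Matrix (Fin m) (Fin m) F) - 1 ∈ strictUpper F b ∧
      (u.1 : Matrix (Fin m) (Fin m) F).BlockTriangular b'},
      (u.1.1 : Matrix (Fin m) (Fin m) F) * (1 - Z.1.1) = 1 + Z.1.1 := by
    rintro ⟨⟨Z, hZu⟩, hZ, hZ'⟩
    obtain ⟨A, hA⟩ := hu1 Z hZ
    obtain ⟨B, hB⟩ := hu2 Z hZ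
    have hrel : ((A * B⁻¹ : GL (Fin m) F) : Matrix (Fin m) (Fin m) F) * (1 - Z) = 1 + Z := by
      rw [← hA, ← hB, Units.val_mul, mul_assoc, Units.inv_mul, mul_one]
    have hcomm : A * B = B * A := Units.ext (by
      rw [Units.val_mul, Units.val_mul, hA, hB]; noncomm_ring)
    have hrel' : (1 - Z) * ((A * B⁻¹ : GL (Fin m) F) : Matrix (Fin m) (Fin m) F) = 1 + Z := by
      rw [← hA, ← hB, ← Units.val_mul, ← mul_assoc, ← hcomm, mul_assoc, mul_inv_cancel, mul_one]
    have htau : tau F Z = -Z := by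
      rw [mem_unitaryLie, omegaMat_eq] at hZu
      rw [← hZu, neg_neg, hZu]
    have hBT (c : Fin m → ℕ) (hc : Z.BlockTriangular c) :
        (B⁻¹ : GL (Fin m) F).1.BlockTriangular c :=
      blockTriangular_inv (by rw [hB]; exact Matrix.blockTriangular_one.sub hc)
    refine ⟨⟨⟨A * B⁻¹, ?_⟩, ?_, ?_⟩, hrel⟩
    · rw [mem_unitaryGrp]
      -- Applying `tau` to `u (1 - Z) = 1 + Z` gives `(1 + Z) * tau u = 1 - Z`; multiplying by `u`
      -- and cancelling `1 + Z` gives unitarity.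
      have h3 := congrArg (tau F) hrel
      rw [tau_mul, tau_sub, tau_add, tau_one, htau, sub_neg_eq_add, ← sub_eq_add_neg] at h3
      have h4 : (A : Matrix (Fin m) (Fin m) F) * (tau F (A * B⁻¹ : GL (Fin m) F).1 * (A * B⁻¹ : GL (Fin m) F).1) = A * 1 := by
        rw [hA, ← mul_assoc, h3, hrel', mul_one]
      exact (Units.mul_right_inj A).1 h4
    · have : ((A * B⁻¹ : GL (Fin m) F) : Matrix (Fin m) (Fin m) F) - 1 =
          Z * ((2 : F) • (B⁻¹ : GL (Fin m) F).1) := by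
        rw [← Units.mul_left_inj B, sub_mul, one_mul, hB, hrel, mul_smul_comm, smul_mul_assoc, mul_assoc, ← hB,
          Units.inv_mul, hB, mul_one, two_smul]
        abel
      change _ - _ ∈ _
      rw [this]
      exact strictUpper_mul_right (fun r s hrs => by
        rw [Matrix.smul_apply, hBT b (blockTriangular_of_mem_strictUpper hZ) hrs, smul_zero]) hZ
    · change (A * B⁻¹ : GL (Fin m) F).1.BlockTriangular b'
      rw [Units.val_mul, hA]
      exact (Matrix.blockTriangular_one.add hZ').mul (hBT b' hZ')
  choose f hf using key
  refine Nat.card_eq_of_bijective f ⟨fun Z Z' hZZ' => ?_, fun u => ?_⟩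
  · obtain ⟨A, hA⟩ := hu3 (f Z).1.1 (f Z).2.1
    -- The image `u` determines the preimage through `(u + 1) Z = u - 1`.
    have h3 (Y) (hY : f Y = f Z) : (A : Matrix (Fin m) (Fin m) F) * Y.1.1 = (f Z).1.1 - 1 := by
      have := hf Y
      rw [hY, mul_sub, mul_one] at this
      rw [hA, add_mul, one_mul, eq_sub_iff_add_eq]
      refine Eq.trans ?_ (sub_eq_iff_eq_add.1 this).symm
      abel
    refine Subtype.ext (Subtype.ext ((Units.mul_right_inj A).1 ?_))
    rw [h3 Z rfl, h3 Z' hZZ'.symm]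
  · obtain ⟨⟨u, huu⟩, hu, hu'⟩ := u
    obtain ⟨A, hA⟩ := hu3 u hu
    change (u : Matrix (Fin m) (Fin m) F) - 1 ∈ strictUpper F b at hu
    change (u : Matrix (Fin m) (Fin m) F).BlockTriangular b' at hu'
    have hBT (c : Fin m → ℕ) (hc : (u : Matrix (Fin m) (Fin m) F).BlockTriangular c) :
        (A⁻¹ : GL (Fin m) F).1.BlockTriangular c :=
      blockTriangular_inv (by rw [hA]; exact hc.add Matrix.blockTriangular_one)
    have huT : (u : Matrix (Fin m) (Fin m) F).BlockTriangular b := by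
      have := (blockTriangular_of_mem_strictUpper hu).add Matrix.blockTriangular_one
      rwa [sub_add_cancel] at this
    let Z : Matrix (Fin m) (Fin m) F := (A⁻¹ : GL (Fin m) F).1 * (u.1 - 1)
    have hZA : (A : Matrix (Fin m) (Fin m) F) * Z = u.1 - 1 := by
      rw [← mul_assoc, Units.mul_inv, one_mul]
    have hrel : u.1 * (1 - Z) = 1 + Z := by
      have : u.1 * Z + Z = u.1 - 1 := by rw [← hZA, hA, add_mul, one_mul]
      rw [mul_sub, mul_one, sub_eq_iff_eq_add, add_assoc, add_comm Z, this]
      abel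
    have hZu : Z ∈ unitaryLie F m := by
      rw [mem_unitaryLie, omegaMat_eq]
      refine (Units.mul_right_inj A).1 ?_
      have hcomm : Z * (A : Matrix (Fin m) (Fin m) F) = u.1 - 1 := by
        have : (u.1 - 1) * (A : Matrix (Fin m) (Fin m) F) = A * (u.1 - 1) := by
          rw [hA]; noncomm_ring
        rw [mul_assoc, this, ← mul_assoc, Units.inv_mul, one_mul]
      -- Apply `tau` to `Z (u + 1) = u - 1` and multiply by `u` from the left: `(u + 1) * tau Z = 1
      -- - u`.
      have h3 := congrArg (tau F) hcomm
      have h5 : u.1 * tau F u.1 = 1 := mul_eq_one_comm.1 ((mem_unitaryGrp F u).1 huu)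
      rw [tau_mul, hA, tau_add, tau_sub, tau_one] at h3
      have h4 := congrArg (u.1 * ·) h3
      simp only [← mul_assoc, mul_add, mul_sub, h5, mul_one] at h4
      rw [hZA, hA, mul_neg, add_comm u.1, h4, neg_sub]
    have hZ : Z ∈ strictUpper F b := strictUpper_mul_left (hBT b huT) hu
    have hZ' : Z.BlockTriangular b' := (hBT b' hu').mul (hu'.sub Matrix.blockTriangular_one)
    refine ⟨⟨⟨Z, hZu⟩, hZ, hZ'⟩, Subtype.ext (Subtype.ext (Units.ext ?_))⟩
    obtain ⟨B, hB⟩ := hu2 Z hZ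
    refine (Units.mul_left_inj B).1 ?_
    rw [hB, hrel]
    exact hf ⟨⟨Z, hZu⟩, hZ, hZ'⟩

end UMat

/-! ### Averages over double cosets -/

section DoubleCoset

variable {G : Type*} [Group G] [Finite G]

/-- Each orbit contributes its size times the average over it, which is an average over the group;
the size comes from the orbit-stabilizer theorem. -/
theorem sum_orbits {X T : Type*} [MulAction G X] [Finite X] [Fintype T] (x : T → X)
    (hx : ∀ y, ∃! τ, y ∈ MulAction.orbit G (x τ)) (f : X → ℝ) :
    ∑ᶠ y, f y = ∑ τ, ((Nat.card G : ℝ) / Nat.card (MulAction.stabilizer G (x τ))) *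
      avg fun g : G => f (g • x τ) := by
  classical
  have := Fintype.ofFinite X
  choose ρ hρ hρ' using hx
  rw [finsum_eq_sum_of_fintype, ← Finset.sum_fiberwise_of_maps_to (g := ρ) (fun _ _ => Finset.mem_univ _)]
  refine Finset.sum_congr rfl fun τ _ => ?_
  have h1 := avg_smul_of_isPretransitive (G := G) (β := MulAction.orbit G (x τ))
    ⟨x τ, MulAction.mem_orbit_self _⟩ (fun y => f y.1)
  have h2 : (avg fun g : G => f (g • x τ)) = avg fun y : MulAction.orbit G (x τ) => f y.1 := by
    rw [← h1]; rfl
  have h3 := Nat.card_congr (MulAction.orbitProdStabilizerEquivGroup G (x τ))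
  rw [Nat.card_prod] at h3
  have h4 : (Nat.card (MulAction.stabilizer G (x τ)) : ℝ) ≠ 0 := by
    exact_mod_cast Nat.card_pos.ne'
  rw [← h3, Nat.cast_mul, mul_div_cancel_right₀ _ h4, h2]
  have : Nonempty (MulAction.orbit G (x τ)) := ⟨⟨x τ, MulAction.mem_orbit_self _⟩⟩
  rw [card_mul_avg, finsum_eq_sum_of_fintype]
  refine Finset.sum_subtype _ (fun y => ?_) f
  simp only [Finset.mem_filter, Finset.mem_univ, true_and]
  exact ⟨fun h => h ▸ hρ y, fun h => (hρ' y τ h).symm⟩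

/-- A function invariant under `Q` on the right lives on `G ⧸ Q`, and the orbits of `P` there are
the double cosets. The stabilizer of the coset of `w τ` is the part of `P` that `w τ` conjugates
into `Q`. -/
theorem index_mul_avg_eq_sum_doubleCoset {T : Type*} [Fintype T] (P Q : Subgroup G) (w : T → G)
    (hw : ∀ g, ∃! τ, ∃ p ∈ P, ∃ q ∈ Q, g = p * w τ * q) (F : G → ℝ)
    (hF : ∀ g, ∀ q ∈ Q, F (g * q) = F g) :
    (Q.index : ℝ) * avg F = ∑ τ, ((Nat.card P : ℝ) /
      Nat.card {p : G // p ∈ P ∧ (w τ)⁻¹ * p * w τ ∈ Q}) * avg fun p : P => F (p * w τ) := by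
  let f : G ⧸ Q → ℝ := Quotient.lift F fun a b hab => by
    have := hF a _ (QuotientGroup.leftRel_apply.1 hab)
    rw [mul_inv_cancel_left] at this
    exact this.symm
  have h1 : avg F = avg f := by
    rw [← avg_smul_of_isPretransitive (G := G) ((1 : G) : G ⧸ Q)]
    refine avg_congr fun g => ?_
    rw [MulAction.Quotient.smul_coe, smul_eq_mul, mul_one]
    rfl
  rw [h1, Subgroup.index, card_mul_avg, sum_orbits (G := P) (fun τ => ((w τ : G) : G ⧸ Q))]
  · refine Finset.sum_congr rfl fun τ _ => ?_
    congr 3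
    refine Nat.card_congr
      { toFun := fun p => ⟨p.1, p.1.2, ?_⟩
        invFun := fun p => ⟨⟨p.1, p.2.1⟩, ?_⟩
        left_inv := fun p => rfl
        right_inv := fun p => rfl }
    · have h : ((p.1.1 * w τ : G) : G ⧸ Q) = (w τ : G) := p.2
      have := QuotientGroup.eq.1 h.symm
      rwa [← mul_assoc] at this
    · change ((p.1 * w τ : G) : G ⧸ Q) = (w τ : G)
      refine (QuotientGroup.eq.2 ?_).symm
      rw [← mul_assoc]
      exact p.2.2
  · intro y
    obtain ⟨g, rfl⟩ := QuotientGroup.mk_surjective y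
    have key (τ : T) : ((g : G ⧸ Q) ∈ MulAction.orbit P ((w τ : G) : G ⧸ Q)) ↔
        ∃ p ∈ P, ∃ q ∈ Q, g = p * w τ * q := by
      constructor
      · rintro ⟨p, hp⟩
        have h : ((p.1 * w τ : G) : G ⧸ Q) = g := hp
        exact ⟨p, p.2, _, QuotientGroup.eq.1 h, by group⟩
      · rintro ⟨p, hp, q, hq, rfl⟩
        refine ⟨⟨p, hp⟩, ?_⟩
        change ((p * w τ : G) : G ⧸ Q) = _
        exact QuotientGroup.eq.2 (by rwa [inv_mul_cancel_left])
    simpa only [key] using hw g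

end DoubleCoset

/-! ### Levi decomposition in the unitary group -/

section Levi

variable {F : Type*} [Field F] [StarRing F] {i j n : ℕ}

/-- The projection of block upper triangular matrices in the unitary group to the Levi quotient. -/
def uProj (h : i + j = n) (p : unitaryGrp F (2 * n))
    (hp : (p.1 : Matrix (Fin (2 * n)) (Fin (2 * n)) F).BlockTriangular (uBlk h)) :
    GL (Fin i) F × unitaryGrp F (2 * j) :=
  (diagBlock p.1 hp 0 _ (uFst_injective h) (uBlk_zero h),
    ⟨diagBlock p.1 hp 1 _ (uMid_injective h) (uBlk_one h), diagBlock_mem F h p hp⟩)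

/-- A unitary matrix is `tau` of its inverse, so its last diagonal block is determined by the first
block of the inverse. -/
theorem uLst_entry_grp (h : i + j = n) (p : unitaryGrp F (2 * n))
    (hp : (p.1 : Matrix (Fin (2 * n)) (Fin (2 * n)) F).BlockTriangular (uBlk h)) (a b : Fin i) :
    (p.1 : Matrix (Fin (2 * n)) (Fin (2 * n)) F) (uLst h a) (uLst h b) =
      (tauInv F (uProj h p hp).1).1 a b := by
  have h1 : (p.1 : Matrix (Fin (2 * n)) (Fin (2 * n)) F) = tau F (p.1⁻¹ : GL (Fin (2 * n)) F).1 := by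
    have h2 := congrArg (fun M : Matrix (Fin (2 * n)) (Fin (2 * n)) F => M * p.1⁻¹.1)
      ((mem_unitaryGrp F p.1).1 p.2)
    simp only [mul_assoc, Units.mul_inv, mul_one, one_mul] at h2
    rw [← h2, tau_tau]
  rw [h1]
  change _ = tau F ((uProj h p hp).1⁻¹).1 a b
  rw [tau_apply, tau_apply, rev_uLst, rev_uLst]
  rfl

theorem sub_uLevi_mem (h : i + j = n) (p : unitaryGrp F (2 * n))
    (hp : (p.1 : Matrix (Fin (2 * n)) (Fin (2 * n)) F).BlockTriangular (uBlk h)) :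
    (p.1 : Matrix (Fin (2 * n)) (Fin (2 * n)) F) - (uLevi F h (uProj h p hp)).1 ∈
      strictUpper F (uBlk h) := by
  intro r s hrs
  change p.1 r s - uDiag F h _ _ _ r s = 0
  rcases u_cases h r with ⟨a, rfl⟩ | ⟨a, rfl⟩ | ⟨a, rfl⟩ <;>
  rcases u_cases h s with ⟨b, rfl⟩ | ⟨b, rfl⟩ | ⟨b, rfl⟩
  · rw [uDiag_fst_fst]; exact sub_self _
  · simp at hrs
  · simp at hrs
  · rw [hp (by simp)]; simp
  · rw [uDiag_mid_mid]; exact sub_self _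
  · simp at hrs
  · rw [hp (by simp)]; simp
  · rw [hp (by simp)]; simp
  · rw [uLst_entry_grp h p hp, uDiag_lst_lst]; exact sub_self _

theorem uProj_eq_of_sub_mem (h : i + j = n) (p : unitaryGrp F (2 * n))
    (hp : (p.1 : Matrix (Fin (2 * n)) (Fin (2 * n)) F).BlockTriangular (uBlk h))
    (g : GL (Fin i) F × unitaryGrp F (2 * j))
    (hg : (p.1 : Matrix (Fin (2 * n)) (Fin (2 * n)) F) - (uLevi F h g).1 ∈ strictUpper F (uBlk h)) :
    uProj h p hp = g := by
  refine Prod.ext (Units.ext ?_) (Subtype.ext (Units.ext ?_)) <;> ext a b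
  · have : _ - uDiag F h _ _ _ _ _ = 0 := hg (uFst h a) (uFst h b) (by simp)
    rw [uDiag_fst_fst] at this
    exact sub_eq_zero.1 this
  · have : _ - uDiag F h _ _ _ _ _ = 0 := hg (uMid h a) (uMid h b) (by simp)
    rw [uDiag_mid_mid] at this
    exact sub_eq_zero.1 this

theorem uLevi_blockTriangular (h : i + j = n) (g : GL (Fin i) F × unitaryGrp F (2 * j)) :
    ((uLevi F h g).1 : Matrix (Fin (2 * n)) (Fin (2 * n)) F).BlockTriangular (uBlk h) :=
  uDiag_blockTriangular F h _ _ _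

/-- The Levi decomposition of the intersection of a parabolic subgroup with another group of block
upper triangular matrices. -/
def leviEquiv (h : i + j = n) (b : Fin (2 * n) → ℕ) :
    {p : unitaryGrp F (2 * n) // (p.1 : Matrix (Fin (2 * n)) (Fin (2 * n)) F).BlockTriangular (uBlk h) ∧
      (p.1 : Matrix (Fin (2 * n)) (Fin (2 * n)) F).BlockTriangular b} ≃
    {g : GL (Fin i) F × unitaryGrp F (2 * j) //
      ((uLevi F h g).1 : Matrix (Fin (2 * n)) (Fin (2 * n)) F).BlockTriangular b} ×
    {u : unitaryGrp F (2 * n) // (u.1 : Matrix (Fin (2 * n)) (Fin (2 * n)) F) - 1 ∈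
      strictUpper F (uBlk h) ∧ (u.1 : Matrix (Fin (2 * n)) (Fin (2 * n)) F).BlockTriangular b} where
  toFun p :=
    -- Block triangularity is a condition on single entries, and the diagonal blocks of the Levi
    -- part are those of `p`.
    have hL : ((uLevi F h (uProj h p.1 p.2.1)).1 : Matrix (Fin (2 * n)) (Fin (2 * n)) F).BlockTriangular
        b := by
      refine (uDiag_blockTriangular_iff h _ _ _ b).2 ⟨fun r s hrs => p.2.2 hrs,
        fun r s hrs => p.2.2 hrs, fun r s hrs => ?_⟩
      rw [← uLst_entry_grp h p.1 p.2.1]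
      exact p.2.2 hrs
    (⟨uProj h p.1 p.2.1, hL⟩, ⟨(uLevi F h (uProj h p.1 p.2.1))⁻¹ * p.1, by
      have := strictUpper_mul_left (blockTriangular_inv
        (uLevi_blockTriangular h (uProj h p.1 p.2.1)))
        (sub_uLevi_mem h p.1 p.2.1)
      rw [mul_sub, Units.inv_mul] at this
      exact this, (blockTriangular_inv hL).mul p.2.2⟩)
  invFun x := ⟨uLevi F h x.1.1 * x.2.1, by
      have := (uLevi_blockTriangular (F := F) h x.1.1).mul
        ((blockTriangular_of_mem_strictUpper x.2.2.1).add Matrix.blockTriangular_one)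
      rwa [sub_add_cancel] at this, x.1.2.mul x.2.2.2⟩
  left_inv p := Subtype.ext (mul_inv_cancel_left _ _)
  right_inv x := by
    have hp := (uLevi_blockTriangular (F := F) h x.1.1).mul
        ((blockTriangular_of_mem_strictUpper x.2.2.1).add Matrix.blockTriangular_one)
    rw [sub_add_cancel] at hp
    have key : uProj h (uLevi F h x.1.1 * x.2.1) hp = x.1.1 := by
      refine uProj_eq_of_sub_mem h _ _ _ ?_
      have := strictUpper_mul_left (uLevi_blockTriangular h x.1.1) x.2.2.1
      rwa [mul_sub, mul_one] at this
    refine Prod.ext (Subtype.ext key) (Subtype.ext ?_)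
    change (uLevi F h (uProj h (uLevi F h x.1.1 * x.2.1) hp))⁻¹ * (uLevi F h x.1.1 * x.2.1) = _
    rw [key, inv_mul_cancel_left]

end Levi

/-! ### The contribution of a double coset -/

section Kernel

variable {F : Type*} [Field F] [StarRing F] {i j k l n : ℕ}

/-- The permutation matrix of a permutation commuting with the reversal, as a unitary matrix. -/
def permU {m : ℕ} (σ : Equiv.Perm (Fin m)) (hσ : ∀ v, σ v.rev = (σ v).rev) : unitaryGrp F m :=
  ⟨⟨Matrix.of fun a b => if a = σ b then 1 else 0, Matrix.of fun a b => if σ a = b then 1 else 0,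
    by
      ext a b
      rw [Matrix.mul_apply, ← Equiv.sum_comp σ.symm]
      simp [Matrix.one_apply],
    by ext a b; simp [Matrix.mul_apply, Matrix.one_apply]⟩, by
    rw [mem_unitaryGrp]
    ext a b
    by_cases hab : a = b
    · subst hab
      simp [Matrix.mul_apply, tau_apply, hσ]
    · simp [Matrix.mul_apply, tau_apply, hσ, hab, Ne.symm hab]⟩

theorem ad_permU_inv {m : ℕ} (σ : Equiv.Perm (Fin m)) (hσ : ∀ v, σ v.rev = (σ v).rev)
    (X : Matrix (Fin m) (Fin m) F) :
    adGL F (Fin m) (permU σ hσ).1⁻¹ X = X.submatrix σ σ := by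
  change (Matrix.of fun a b => if σ a = b then 1 else 0) * X *
    (Matrix.of fun a b => if a = σ b then 1 else 0) = _
  ext a b
  simp [Matrix.mul_apply]

theorem submatrix_blockTriangular_iff {m : ℕ} (σ : Equiv.Perm (Fin m)) (b : Fin m → ℕ)
    (X : Matrix (Fin m) (Fin m) F) :
    (X.submatrix σ σ).BlockTriangular b ↔ X.BlockTriangular (fun v => b (σ.symm v)) := by
  constructor
  · intro h r s hrs
    simpa using h (i := σ.symm r) (j := σ.symm s) hrs
  · intro h r s hrs
    exact h (by simpa using hrs)

namespace Position

variable (τ : Position i j k l) (h : i + j = n) (h' : k + l = n)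

/-- The block function of the conjugate of the second parabolic. -/
def blk (v : Fin (2 * n)) : ℕ := uBlk h ((τ.sig h h').symm v)

theorem blk_uFst (a : Fin k) : τ.blk h h' (uFst h' a) = blk3 τ.r τ.j₁ a :=
  τ.symm.uBlk_sig_uFst h' h a

theorem blk_uMid (a : Fin (2 * l)) : τ.blk h h' (uMid h' a) = uBlk τ.hl a :=
  τ.symm.uBlk_sig_uMid h' h a

theorem blk_uLst (a : Fin k) : τ.blk h h' (uLst h' a) = blk3 τ.t τ.j₁ a :=
  τ.symm.uBlk_sig_uLst h' h a

/-- The representative of a double coset. -/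
def w : unitaryGrp F (2 * n) := permU (τ.sig h h') (τ.sig_rev h h')

theorem tau_blk3_blockTriangular (X : Matrix (Fin i) (Fin i) F) :
    (tau F X).BlockTriangular (blk3 τ.t τ.s) ↔ X.BlockTriangular (blk3 τ.r τ.s) :=
  tau_blockTriangular (blk3_rev τ.hi) X

/-- The condition on the last diagonal block repeats the condition on the first one, by duality, and
can be dropped. -/
theorem uDiag_blk_iff (A C : Matrix (Fin k) (Fin k) F) (B : Matrix (Fin (2 * l)) (Fin (2 * l)) F)
    (hAC : C.BlockTriangular (blk3 τ.t τ.j₁) ↔ A.BlockTriangular (blk3 τ.r τ.j₁)) :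
    (uDiag F h' A B C).BlockTriangular (τ.blk h h') ↔
      A.BlockTriangular (blk3 τ.r τ.j₁) ∧ B.BlockTriangular (uBlk τ.hl) := by
  rw [uDiag_blockTriangular_iff]
  simp only [blk_uFst, blk_uMid, blk_uLst]
  change A.BlockTriangular (blk3 τ.r τ.j₁) ∧ B.BlockTriangular (uBlk τ.hl) ∧
    C.BlockTriangular (blk3 τ.t τ.j₁) ↔ _
  tauto

theorem omegaMat_blockTriangular {m : ℕ} (b : Fin m → ℕ) (X : Matrix (Fin m) (Fin m) F) :
    (omegaMat F X).BlockTriangular b ↔ (tau F X).BlockTriangular b := by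
  rw [omegaMat_eq]
  exact ⟨fun h => by simpa using h.neg, fun h => h.neg⟩

theorem uIncl_blk_iff (Y : Matrix (Fin k) (Fin k) F × unitaryLie F (2 * l)) :
    (uIncl F h' Y).1.BlockTriangular (τ.blk h h') ↔
      Y.1.BlockTriangular (blk3 τ.r τ.j₁) ∧ Y.2.1.BlockTriangular (uBlk τ.hl) :=
  τ.uDiag_blk_iff h h' _ _ _ (by
    rw [omegaMat_blockTriangular]; exact τ.symm.tau_blk3_blockTriangular _)

theorem uLevi_blk_iff (g : GL (Fin k) F × unitaryGrp F (2 * l)) :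
    ((uLevi F h' g).1 : Matrix (Fin (2 * n)) (Fin (2 * n)) F).BlockTriangular (τ.blk h h') ↔
      (g.1 : Matrix (Fin k) (Fin k) F).BlockTriangular (blk3 τ.r τ.j₁) ∧
      (g.2.1 : Matrix (Fin (2 * l)) (Fin (2 * l)) F).BlockTriangular (uBlk τ.hl) := by
  refine τ.uDiag_blk_iff h h' _ _ _ ?_
  change (tau F (g.1⁻¹ : GL (Fin k) F).1).BlockTriangular (blk3 τ.symm.t τ.symm.s) ↔ _
  rw [τ.symm.tau_blk3_blockTriangular]
  refine ⟨fun h => ?_, fun h => blockTriangular_inv h⟩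
  have := blockTriangular_inv h
  rwa [inv_inv] at this

/-- The part of the nilpotent radical of the first parabolic inside the conjugate of the second. -/
def nilInter (F : Type*) [Field F] [StarRing F] : AddSubgroup (unitaryLie F (2 * n)) where
  carrier := {Z | Z.1 ∈ strictUpper F (uBlk h') ∧ Z.1.BlockTriangular (τ.blk h h')}
  add_mem' hX hY := ⟨add_mem hX.1 hY.1, hX.2.add hY.2⟩
  zero_mem' := ⟨zero_mem _, Matrix.blockTriangular_zero⟩
  neg_mem' hX := ⟨neg_mem hX.1, hX.2.neg⟩

/-- The three diagonal blocks of an element of the Levi algebra, glued in the order in which they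
appear in the second parabolic. -/
def glueA {c : ℕ} (hc : τ.r + τ.s = c) (hc' : c + τ.t = i)
    (Y : Matrix (Fin k) (Fin k) F × unitaryLie F (2 * l)) : Matrix (Fin i) (Fin i) F :=
  glDiag F hc' (glDiag F hc (Y.1.submatrix τ.symm.e₁ τ.symm.e₁, (uBlocks F τ.hl Y.2).1),
    omegaMat F (Y.1.submatrix τ.symm.e₃ τ.symm.e₃))

theorem e₁_eq {c : ℕ} (hc : τ.r + τ.s = c) (hc' : c + τ.t = i) (a : Fin τ.r) :
    τ.e₁ a = glEquiv hc' (Sum.inl (glEquiv hc (Sum.inl a))) := by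
  ext; simp [e₁, val_glEquiv_inl]

theorem e₂_eq {c : ℕ} (hc : τ.r + τ.s = c) (hc' : c + τ.t = i) (a : Fin τ.s) :
    τ.e₂ a = glEquiv hc' (Sum.inl (glEquiv hc (Sum.inr a))) := by
  ext; simp [e₂, val_glEquiv_inl, val_glEquiv_inr]

theorem e₃_eq {c : ℕ} (hc : τ.r + τ.s = c) (hc' : c + τ.t = i) (a : Fin τ.t) :
    τ.e₃ a = glEquiv hc' (Sum.inr a) := by
  ext; simp [e₃, val_glEquiv_inr, hc]

theorem rev_o₃ (a : Fin τ.t) : (τ.o₃ a).rev = τ.e₃ a.rev := by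
  have := τ.hi
  ext; simp only [o₃, e₃, Fin.val_rev]; omega

theorem rev_o₂ (a : Fin τ.s) : (τ.o₂ a).rev = τ.e₂ a.rev := by
  have := τ.hi
  ext; simp only [o₂, e₂, Fin.val_rev]; omega

/-- This is where `ω` arises. Of the `i` first coordinates, `r` go to the first block, `s` to the
middle block and `t` to the last block, in which a Levi element carries `ω` of its first component.
The leading `t` rows of `ω(X)` are `ω` of the trailing block of `X`. -/
theorem submatrix_sig_fst {c : ℕ} (hc : τ.r + τ.s = c) (hc' : c + τ.t = i)
    (Y : Matrix (Fin k) (Fin k) F × unitaryLie F (2 * l)) :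
    ((uIncl F h' Y).1.submatrix (τ.sig h h') (τ.sig h h')).submatrix (uFst h) (uFst h) =
      τ.glueA hc hc' Y := by
  ext a b
  simp only [Matrix.submatrix_apply, uIncl]
  rcases τ.e_cases a with ⟨a, rfl⟩ | ⟨a, rfl⟩ | ⟨a, rfl⟩ <;>
  rcases τ.e_cases b with ⟨b, rfl⟩ | ⟨b, rfl⟩ | ⟨b, rfl⟩ <;>
  simp only [sig_fst_e₁, sig_fst_e₂, sig_fst_e₃, uDiag_fst_fst, uDiag_fst_mid, uDiag_fst_lst,
    uDiag_mid_fst, uDiag_mid_mid, uDiag_mid_lst, uDiag_lst_fst, uDiag_lst_mid, uDiag_lst_lst] <;>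
  simp only [glueA, τ.e₁_eq hc hc', τ.e₂_eq hc hc', τ.e₃_eq hc hc', glDiag_inl_inl, glDiag_inl_inr,
    glDiag_inr_inl, glDiag_inr_inr, Matrix.submatrix_apply, omegaMat_apply, uBlocks] <;> try rfl
  rw [show (τ.symm.o₃ a).rev = _ from τ.symm.rev_o₃ a,
    show (τ.symm.o₃ b).rev = _ from τ.symm.rev_o₃ b]

theorem submatrix_sig_mid (Y : Matrix (Fin k) (Fin k) F × unitaryLie F (2 * l)) :
    ((uIncl F h' Y).1.submatrix (τ.sig h h') (τ.sig h h')).submatrix (uMid h) (uMid h) =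
      (uIncl F τ.hj (Y.1.submatrix τ.symm.e₂ τ.symm.e₂, (uBlocks F τ.hl Y.2).2)).1 := by
  ext a b
  simp only [Matrix.submatrix_apply, uIncl]
  rcases u_cases τ.hj a with ⟨a, rfl⟩ | ⟨a, rfl⟩ | ⟨a, rfl⟩ <;>
  rcases u_cases τ.hj b with ⟨b, rfl⟩ | ⟨b, rfl⟩ | ⟨b, rfl⟩ <;>
  simp only [sig_mid_fst, sig_mid_mid, sig_mid_lst, uDiag_fst_fst, uDiag_fst_mid, uDiag_fst_lst,
    uDiag_mid_fst, uDiag_mid_mid, uDiag_mid_lst, uDiag_lst_fst, uDiag_lst_mid, uDiag_lst_lst,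
    Matrix.submatrix_apply, omegaMat_apply, uBlocks] <;> try rfl
  rw [show (τ.symm.o₂ a).rev = _ from τ.symm.rev_o₂ a,
    show (τ.symm.o₂ b).rev = _ from τ.symm.rev_o₂ b]

/-- The map of the intersection of the nilpotent radical with the conjugate parabolic to the
nilpotent radicals in the Levi factors. -/
def nilHom : τ.nilInter h h' F →+ strictUpper F (blk3 τ.r τ.s : Fin i → ℕ) × (uParabolic F τ.hj).nil where
  toFun Z := (⟨(Z.1.1.submatrix (τ.sig h h') (τ.sig h h')).submatrix (uFst h) (uFst h),
      fun r s hrs => Z.2.1 _ _ (by rwa [uBlk_sig_uFst, uBlk_sig_uFst])⟩,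
    ⟨⟨(Z.1.1.submatrix (τ.sig h h') (τ.sig h h')).submatrix (uMid h) (uMid h), by
      refine uMid_mem F h ?_
      rw [← ad_permU_inv (τ.sig h h') (τ.sig_rev h h')]
      exact ad_mem_unitaryLie F (inv_mem (permU _ _).2) Z.1.2⟩,
      fun r s hrs => Z.2.1 _ _ (by rwa [uBlk_sig_uMid, uBlk_sig_uMid])⟩)
  map_zero' := rfl
  map_add' _ _ := rfl

/-- A preimage is the conjugate by `w` of the block diagonal element with first and middle blocks
`C` and `D`. It is strictly upper for the other parabolic because the pulled back block numbers are
standard on each block. -/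
theorem nilHom_surjective : Function.Surjective (τ.nilHom (F := F) h h') := by
  rintro ⟨⟨C, hC⟩, ⟨D, hD⟩⟩
  change D.1 ∈ strictUpper F (uBlk τ.hj) at hD
  have h1 : (adU F (2 * n) (τ.w h h') (uIncl F h (C, D))).1.submatrix (τ.sig h h') (τ.sig h h') =
      (uIncl F h (C, D)).1 := by
    rw [← ad_permU_inv (τ.sig h h') (τ.sig_rev h h')]
    exact ad_inv_ad (adGL F (Fin (2 * n))) _ _
  have h2 : (uIncl F h (C, D)).1 ∈ strictUpper F (fun v => uBlk h' (τ.sig h h' v)) := by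
    refine (uDiag_mem_strictUpper_iff h _ _ _ _).2 ?_
    simp only [uBlk_sig_uFst, uBlk_sig_uMid, uBlk_sig_uLst]
    refine ⟨hC, hD, ?_⟩
    rw [omegaMat_eq]
    exact neg_mem (tau_mem_strictUpper (blk3_rev τ.hi) hC)
  refine ⟨⟨adU F (2 * n) (τ.w h h') (uIncl F h (C, D)), ?_, ?_⟩, ?_⟩
  · intro r s hrs
    rw [← (τ.sig h h').apply_symm_apply r, ← (τ.sig h h').apply_symm_apply s] at hrs ⊢
    have := h2 _ _ hrs
    rwa [← h1] at this
  · refine (submatrix_blockTriangular_iff _ _ _).1 ?_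
    rw [h1]
    exact uDiag_blockTriangular F h _ _ _
  · refine Prod.ext (Subtype.ext ?_) (Subtype.ext (Subtype.ext ?_))
    · change Matrix.submatrix (Matrix.submatrix _ _ _) _ _ = C
      rw [h1]
      ext a b
      simp [uIncl]
    · change Matrix.submatrix (Matrix.submatrix _ _ _) _ _ = D.1
      rw [h1]
      ext a b
      simp [uIncl]

/-- A Levi element and an element of the nilradical have disjoint supports, so a condition on single
entries may be tested on each of them. -/
theorem uIncl_add_blk_iff (Y : Matrix (Fin k) (Fin k) F × unitaryLie F (2 * l))
    {Z : Matrix (Fin (2 * n)) (Fin (2 * n)) F} (hZ : Z ∈ strictUpper F (uBlk h'))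
    (b : Fin (2 * n) → ℕ) : ((uIncl F h' Y).1 + Z).BlockTriangular b ↔
      (uIncl F h' Y).1.BlockTriangular b ∧ Z.BlockTriangular b := by
  refine ⟨fun hX => ?_, fun hX => hX.1.add hX.2⟩
  have hne (r s) (hrs : uBlk h' r ≠ uBlk h' s) : (uIncl F h' Y).1 r s = 0 := by
    rcases u_cases h' r with ⟨a, rfl⟩ | ⟨a, rfl⟩ | ⟨a, rfl⟩ <;>
    rcases u_cases h' s with ⟨b, rfl⟩ | ⟨b, rfl⟩ | ⟨b, rfl⟩ <;> simp at hrs <;> simp [uIncl]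
  have key : (uIncl F h' Y).1.BlockTriangular b := by
    intro r s hrs
    by_cases h0 : uBlk h' r = uBlk h' s
    · have := hX hrs
      rwa [Matrix.add_apply, hZ r s h0.ge, add_zero] at this
    · exact hne r s h0
  refine ⟨key, ?_⟩
  have := hX.sub key
  rwa [add_sub_cancel_left] at this

-- The heart of the Mackey formula. Membership in the conjugate parabolic separates into a condition
-- on `Y` and a condition on `Z`. Under the latter, the integrand depends on `Z` only through
-- `nilHom`, a surjection onto a product of two nilradicals, so the average factors into two
-- restrictions. The quotient of cardinalities is the proportion of admissible `Z`.
open Classical in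
theorem avg_nil_extend [Finite F] {c : ℕ} (hc : τ.r + τ.s = c) (hc' : c + τ.t = i)
    (a : InvFun (adGL F (Fin i))) (b : InvFun (adU F (2 * j)))
    (Y : Matrix (Fin k) (Fin k) F × unitaryLie F (2 * l)) :
    (avg fun Z : (uParabolic F h').nil => (uParabolic F h).extend
      (tensorToProd (adGL F (Fin i)) (adU F (2 * j)) (a ⊗ₜ b)).1
        (adU F (2 * n) (τ.w h h')⁻¹ ((uParabolic F h').incl Y + Z))) =
    ((Nat.card (τ.nilInter h h' F) : ℝ) / Nat.card (uParabolic F h').nil) *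
      if Y.1.BlockTriangular (blk3 τ.r τ.j₁) ∧ Y.2.1.BlockTriangular (uBlk τ.hl) then
        avgNil (blk3 τ.r τ.s) a.1 (τ.glueA hc hc' Y) * ((uParabolic F τ.hj).res b).1
          (Y.1.submatrix τ.symm.e₂ τ.symm.e₂, (uBlocks F τ.hl Y.2).2)
      else 0 := by
  have hX (X : unitaryLie F (2 * n)) : (adU F (2 * n) (τ.w h h')⁻¹ X).1 =
      X.1.submatrix (τ.sig h h') (τ.sig h h') := ad_permU_inv _ _ _
  have hpar (X : unitaryLie F (2 * n)) : adU F (2 * n) (τ.w h h')⁻¹ X ∈ (uParabolic F h).par ↔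
      X.1.BlockTriangular (τ.blk h h') := by
    change (adU F (2 * n) (τ.w h h')⁻¹ X).1.BlockTriangular _ ↔ _
    rw [hX, submatrix_blockTriangular_iff]
    rfl
  have hproj (X : unitaryLie F (2 * n)) :
      (uParabolic F h).proj (adU F (2 * n) (τ.w h h')⁻¹ X) = uBlocks F h (adU F (2 * n) (τ.w h h')⁻¹ X) :=
    rfl
  simp only [Parabolic.extend, hpar, tensorToProd_tmul]
  have hcond (Z : (uParabolic F h').nil) :
      (((uParabolic F h').incl Y + Z : unitaryLie F (2 * n))).1.BlockTriangular (τ.blk h h') ↔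
      (Y.1.BlockTriangular (blk3 τ.r τ.j₁) ∧ Y.2.1.BlockTriangular (uBlk τ.hl)) ∧
        Z.1.1.BlockTriangular (τ.blk h h') := by
    rw [← uIncl_blk_iff τ h h']
    exact uIncl_add_blk_iff h' Y Z.2 _
  simp only [hcond]
  by_cases hY : Y.1.BlockTriangular (blk3 τ.r τ.j₁) ∧ Y.2.1.BlockTriangular (uBlk τ.hl)
  swap
  · simp only [hY, false_and, if_false, avg_zero, mul_zero]
  simp only [hY, true_and, if_true]
  rw [avg_ite]
  let e : {Z : (uParabolic F h').nil // Z.1.1.BlockTriangular (τ.blk h h')} ≃ τ.nilInter h h' F :=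
    { toFun := fun Z => ⟨Z.1.1, Z.1.2, Z.2⟩
      invFun := fun Z => ⟨⟨Z.1, Z.2.1⟩, Z.2.2⟩
      left_inv := fun _ => rfl
      right_inv := fun _ => rfl }
  rw [Nat.card_congr e, avgNil, Parabolic.res_apply, avg_mul_avg]
  congr 1
  rw [← avg_prod fun p : strictUpper F (blk3 τ.r τ.s : Fin i → ℕ) × (uParabolic F τ.hj).nil =>
    a.1 (τ.glueA hc hc' Y + p.1.1) * b.1 ((uParabolic F τ.hj).incl
      (Y.1.submatrix τ.symm.e₂ τ.symm.e₂, (uBlocks F τ.hl Y.2).2) + p.2.1),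
    ← avg_comp_of_surjective_addHom (τ.nilHom h h') (τ.nilHom_surjective h h'), ← avg_comp_equiv e]
  refine avg_congr fun Z => ?_
  rw [hproj]
  congr 2
  · refine congrArg a.1 ?_
    rw [← τ.submatrix_sig_fst h h' hc hc']
    change Matrix.submatrix (adU F (2 * n) (τ.w h h')⁻¹ _).1 _ _ = _
    rw [hX]
    rfl
  · refine congrArg b.1 (Subtype.ext ?_)
    change Matrix.submatrix (adU F (2 * n) (τ.w h h')⁻¹ _).1 _ _ = (uIncl F τ.hj _).1 + _
    rw [← τ.submatrix_sig_mid h h', hX]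
    rfl

end Position

end Kernel

/-! ### Parabolic restriction of an induced function -/

section ResInd

/-- An element of the parabolic subgroup maps a translate of the nilradical bijectively to another
translate, whose Levi part is obtained by projection. -/
theorem Parabolic.avg_nil_ad {G H 𝔤 𝔩 : Type*} [Group G] [Group H] [AddCommGroup 𝔤]
    [AddCommGroup 𝔩] {Ad : G →* AddMonoid.End 𝔤} {AdL : H →* AddMonoid.End 𝔩}
    (D : Parabolic Ad AdL) {p : G} (hp : p ∈ D.P) (Y : 𝔩) (f : 𝔤 → ℝ) :
    (avg fun Z : D.nil => f (Ad p (D.incl Y + Z))) =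
      avg fun Z : D.nil => f (D.incl (D.proj (Ad p (D.incl Y))) + Z) := by
  have hY : D.incl Y ∈ D.par := (D.mem_par_iff _).2 ⟨0, zero_mem _, by
    have := D.proj_incl_add Y 0 (zero_mem _)
    rw [add_zero] at this
    rw [this, add_zero]⟩
  obtain ⟨Z₀, hZ₀, h⟩ := (D.mem_par_iff _).1 (D.ad_mem_par p hp _ hY)
  let e : D.nil ≃ D.nil :=
    { toFun := fun Z => ⟨Z₀ + Ad p Z, add_mem hZ₀ (D.ad_mem_nil p hp _ Z.2)⟩
      invFun := fun Z => ⟨Ad p⁻¹ (Z - Z₀), D.ad_mem_nil p⁻¹ (inv_mem hp) _ (sub_mem Z.2 hZ₀)⟩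
      left_inv := fun Z => Subtype.ext (by simp)
      right_inv := fun Z => Subtype.ext (by simp) }
  refine Eq.trans (avg_congr fun Z => congrArg f ?_)
    (avg_comp_equiv e fun Z : D.nil => f (D.incl (D.proj (Ad p (D.incl Y))) + Z))
  rw [map_add]
  conv_lhs => rw [h]
  exact add_assoc _ _ _

variable {F : Type*} [Field F] [StarRing F] {i j k l n : ℕ}

theorem proj_ad_uIncl (h : i + j = n) (p : unitaryGrp F (2 * n))
    (hp : (p.1 : Matrix (Fin (2 * n)) (Fin (2 * n)) F).BlockTriangular (uBlk h))
    (Y : Matrix (Fin i) (Fin i) F × unitaryLie F (2 * j)) :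
    (uParabolic F h).proj (adU F (2 * n) p ((uParabolic F h).incl Y)) =
      adProd (adGL F (Fin i)) (adU F (2 * j)) (uProj h p hp) Y := by
  have hX : (uIncl F h Y).1.BlockTriangular (uBlk h) := uDiag_blockTriangular F h _ _ _
  have h0 : uBlocks F h (uIncl F h Y) = Y := by
    have := (uParabolic F h).proj_incl_add Y 0 (zero_mem _)
    rwa [add_zero] at this
  rw [adProd_apply]
  refine Prod.ext ?_ (Subtype.ext ?_)
  · refine (adGL_submatrix p.1 hp 0 _ (uFst_injective h) (uBlk_zero h) _ hX).trans ?_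
    exact congrArg (adGL F (Fin i) (uProj h p hp).1) (congrArg Prod.fst h0)
  · refine (adGL_submatrix p.1 hp 1 _ (uMid_injective h) (uBlk_one h) _ hX).trans ?_
    exact congrArg (fun M => adGL F (Fin (2 * j)) (uProj h p hp).2.1 M.2.1) h0

/-- By the Levi decomposition all fibres of the projection are copies of the unipotent radical. The
constant block function imposes no condition, so `leviEquiv` with it decomposes the whole parabolic.
-/
theorem avg_uProj [Finite F] (h : i + j = n) (f : GL (Fin i) F × unitaryGrp F (2 * j) → ℝ) :
    (avg fun p : (uParabolic F h).P => f (uProj h p.1 p.2)) = avg f := by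
  have hb (X : Matrix (Fin (2 * n)) (Fin (2 * n)) F) : X.BlockTriangular (fun _ => 0) :=
    fun r s hrs => absurd hrs (lt_irrefl _)
  let e₁ : {p : unitaryGrp F (2 * n) //
      (p.1 : Matrix (Fin (2 * n)) (Fin (2 * n)) F).BlockTriangular (uBlk h) ∧
      (p.1 : Matrix (Fin (2 * n)) (Fin (2 * n)) F).BlockTriangular (fun _ => 0)} ≃
      (uParabolic F h).P :=
    Equiv.subtypeEquivRight fun p => and_iff_left (hb _)
  let e₂ : {g : GL (Fin i) F × unitaryGrp F (2 * j) //
      ((uLevi F h g).1 : Matrix (Fin (2 * n)) (Fin (2 * n)) F).BlockTriangular (fun _ => 0)} ≃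
      GL (Fin i) F × unitaryGrp F (2 * j) := Equiv.subtypeUnivEquiv fun g => hb _
  rw [← avg_comp_equiv e₁, ← avg_comp_equiv e₂]
  have : Nonempty {u : unitaryGrp F (2 * n) // (u.1 : Matrix (Fin (2 * n)) (Fin (2 * n)) F) - 1 ∈
      strictUpper F (uBlk h) ∧ (u.1 : Matrix (Fin (2 * n)) (Fin (2 * n)) F).BlockTriangular
        (fun _ => 0)} := ⟨⟨1, by simpa using zero_mem _, hb _⟩⟩
  calc _ = avg fun p => f (e₂ (leviEquiv (F := F) h (fun _ => 0) p).1) := rfl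
    _ = _ := by
      rw [avg_comp_equiv (leviEquiv h (fun _ => 0)) fun x => f (e₂ x.1), avg_prod]
      simp only [avg_const]

theorem card_uParabolic_P [Finite F] (h2 : (2 : F) ≠ 0) (h : i + j = n) :
    Nat.card (uParabolic F h).P = Nat.card (GL (Fin i) F) * Nat.card (unitaryGrp F (2 * j)) *
      Nat.card (uParabolic F h).nil := by
  have hb (X : Matrix (Fin (2 * n)) (Fin (2 * n)) F) : X.BlockTriangular (fun _ => 0) :=
    fun r s hrs => absurd hrs (lt_irrefl _)
  have e := Nat.card_congr (leviEquiv (F := F) h (fun _ => 0))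
  rw [Nat.card_prod, card_unipotent_eq h2] at e
  have e₁ : Nat.card {p : unitaryGrp F (2 * n) //
      (p.1 : Matrix (Fin (2 * n)) (Fin (2 * n)) F).BlockTriangular (uBlk h) ∧
      (p.1 : Matrix (Fin (2 * n)) (Fin (2 * n)) F).BlockTriangular (fun _ => 0)} =
      Nat.card (uParabolic F h).P :=
    Nat.card_congr (Equiv.subtypeEquivRight fun p => and_iff_left (hb _))
  have e₂ : Nat.card {g : GL (Fin i) F × unitaryGrp F (2 * j) //
      ((uLevi F h g).1 : Matrix (Fin (2 * n)) (Fin (2 * n)) F).BlockTriangular (fun _ => 0)} =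
      Nat.card (GL (Fin i) F × unitaryGrp F (2 * j)) :=
    Nat.card_congr (Equiv.subtypeUnivEquiv fun g => hb _)
  have e₃ : Nat.card {Z : unitaryLie F (2 * n) // Z.1 ∈ strictUpper F (uBlk h) ∧
      Z.1.BlockTriangular (fun _ => 0)} = Nat.card (uParabolic F h).nil :=
    Nat.card_congr (Equiv.subtypeEquivRight fun p => and_iff_left (hb _))
  rw [← e₁, e, e₂, e₃, Nat.card_prod]

namespace Position

variable (τ : Position i j k l) (h : i + j = n) (h' : k + l = n)

/-- The Levi decomposition restricts to the intersection. Its Levi part is a product of parabolics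
in the two Levi factors, and its unipotent part is counted by the Cayley transform. -/
theorem card_inter [Finite F] (h2 : (2 : F) ≠ 0) :
    Nat.card {p : unitaryGrp F (2 * n) // p ∈ (uParabolic F h').P ∧
      (τ.w h h')⁻¹ * p * τ.w h h' ∈ (uParabolic F h).P} =
    Nat.card (blockUpper F (blk3 τ.r τ.j₁ : Fin k → ℕ)) * Nat.card (uParabolic F τ.hl).P *
      Nat.card (τ.nilInter h h' F) := by
  have e := Nat.card_congr (leviEquiv (F := F) h' (τ.blk h h'))
  rw [Nat.card_prod, card_unipotent_eq h2] at e
  have e₁ : Nat.card {p : unitaryGrp F (2 * n) // p ∈ (uParabolic F h').P ∧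
      (τ.w h h')⁻¹ * p * τ.w h h' ∈ (uParabolic F h).P} = _ :=
    Nat.card_congr (Equiv.subtypeEquivRight (q := fun p : unitaryGrp F (2 * n) =>
      (p.1 : Matrix (Fin (2 * n)) (Fin (2 * n)) F).BlockTriangular (uBlk h') ∧
      (p.1 : Matrix (Fin (2 * n)) (Fin (2 * n)) F).BlockTriangular (τ.blk h h'))
      fun p => and_congr_right fun _ => by
        refine Iff.trans ?_ (submatrix_blockTriangular_iff (τ.sig h h') (uBlk h) _)
        rw [← ad_permU_inv (τ.sig h h') (τ.sig_rev h h')]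
        change _ ↔ (((τ.w h h').1⁻¹.1 * p.1.1 * ((τ.w h h').1⁻¹)⁻¹.1)).BlockTriangular _
        rw [inv_inv]
        rfl)
  let e₂ : {g : GL (Fin k) F × unitaryGrp F (2 * l) //
      ((uLevi F h' g).1 : Matrix (Fin (2 * n)) (Fin (2 * n)) F).BlockTriangular (τ.blk h h')} ≃
      blockUpper F (blk3 τ.r τ.j₁ : Fin k → ℕ) × (uParabolic F τ.hl).P :=
    (Equiv.subtypeEquivRight fun g => τ.uLevi_blk_iff h h' g).trans
      (Equiv.subtypeProdEquivProd (p := fun g : GL (Fin k) F => g ∈ blockUpper F (blk3 τ.r τ.j₁))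
        (q := fun g : unitaryGrp F (2 * l) => g ∈ (uParabolic F τ.hl).P))
  rw [e₁, e, Nat.card_congr e₂, Nat.card_prod]
  rfl

open Classical in
/-- The contribution of a double coset to the restriction of an induced function. -/
noncomputable def term (a : InvFun (adGL F (Fin i))) [Finite F] (b : InvFun (adU F (2 * j)))
    (Y : Matrix (Fin k) (Fin k) F × unitaryLie F (2 * l)) : ℝ :=
  if Y.1.BlockTriangular (blk3 τ.r τ.j₁) ∧ Y.2.1.BlockTriangular (uBlk τ.hl) then
    avgNil (blk3 τ.r τ.s) a.1 (τ.glueA rfl τ.hi Y) * ((uParabolic F τ.hj).res b).1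
      (Y.1.submatrix τ.symm.e₂ τ.symm.e₂, (uBlocks F τ.hl Y.2).2)
  else 0

end Position

/-- Mackey formula: sum over the double cosets, then on each of them average first over the
nilradical by `Position.avg_nil_extend`, and next over the Levi quotient. The average over the Levi
quotient, weighted by the two indices, is already a pair of parabolic inductions. -/
theorem res_ind_apply [Finite F] (h2 : (2 : F) ≠ 0) [Fintype (Position i j k l)] (h : i + j = n)
    (h' : k + l = n)
    (hw : ∀ g : unitaryGrp F (2 * n), ∃! τ : Position i j k l, ∃ p ∈ (uParabolic F h').P,
      ∃ q ∈ (uParabolic F h).P, g = p * τ.w h h' * q)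
    (a : InvFun (adGL F (Fin i))) (b : InvFun (adU F (2 * j)))
    (Y : Matrix (Fin k) (Fin k) F × unitaryLie F (2 * l)) :
    ((uParabolic F h').res ((uParabolic F h).ind (tensorToProd _ _ (a ⊗ₜ b)))).1 Y =
      ∑ τ : Position i j k l, ((blockUpper F (blk3 τ.r τ.j₁ : Fin k → ℕ)).index : ℝ) *
        (uParabolic F τ.hl).P.index * avg fun g : GL (Fin k) F × unitaryGrp F (2 * l) =>
          τ.term a b (adProd (adGL F (Fin k)) (adU F (2 * l)) g⁻¹ Y) := by
  rw [Parabolic.res_apply]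
  set Φ := tensorToProd (adGL F (Fin i)) (adU F (2 * j)) (a ⊗ₜ b) with hΦ
  have h1 (Z : (uParabolic F h').nil) := index_mul_avg_eq_sum_doubleCoset (uParabolic F h').P
    (uParabolic F h).P (fun τ : Position i j k l => τ.w h h') hw
    (fun g => (uParabolic F h).extend Φ.1 (adU F (2 * n) g⁻¹ ((uParabolic F h').incl Y + Z)))
    (fun g q hq => by
      rw [mul_inv_rev, ad_mul_apply, (uParabolic F h).extend_ad Φ _ (inv_mem hq)])
  simp only [Parabolic.ind_apply, h1]
  rw [avg_sum]
  refine Finset.sum_congr rfl fun τ _ => ?_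
  -- The average over the nilradical is moved inside, and `p` is replaced by its inverse so that
  -- `(p⁻¹ w)⁻¹ = w⁻¹ p` acts through `p` first.
  rw [avg_const_mul, avg_comm, ← avg_comp_equiv (Equiv.inv (uParabolic F h').P)]
  have h3 (p : (uParabolic F h').P) : (avg fun Z : (uParabolic F h').nil =>
      (uParabolic F h).extend Φ.1 (adU F (2 * n) ((((Equiv.inv (uParabolic F h').P) p :
        (uParabolic F h').P) : unitaryGrp F (2 * n)) * τ.w h h')⁻¹ ((uParabolic F h').incl Y + Z))) =
      ((Nat.card (τ.nilInter h h' F) : ℝ) / Nat.card (uParabolic F h').nil) *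
        τ.term a b (adProd (adGL F (Fin k)) (adU F (2 * l)) (uProj h' p.1 p.2) Y) := by
    have e1 := (uParabolic F h').avg_nil_ad p.2 Y fun X =>
      (uParabolic F h).extend Φ.1 (adU F (2 * n) (τ.w h h')⁻¹ X)
    rw [proj_ad_uIncl h' p.1 p.2, hΦ, τ.avg_nil_extend h h' rfl τ.hi] at e1
    refine Eq.trans (avg_congr fun Z => ?_) e1
    rw [← ad_mul_apply, mul_inv_rev]
    congr 3
  simp only [h3]
  rw [avg_const_mul, avg_uProj h' fun g => τ.term a b (adProd _ _ g Y), ← mul_assoc,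
    ← avg_comp_equiv (Equiv.inv (GL (Fin k) F × unitaryGrp F (2 * l)))]
  -- What remains is numerical: the factors `|P'|` and `|P' ∩ w P w⁻¹|` split into Levi and
  -- unipotent orders. The unipotent ones cancel against the proportion of admissible `Z`, and the
  -- Levi ones leave the two indices.
  congr 1
  rw [card_uParabolic_P h2, τ.card_inter h h' h2,
    ← Subgroup.index_mul_card (blockUpper F (blk3 τ.r τ.j₁ : Fin k → ℕ)),
    ← Subgroup.index_mul_card (uParabolic F τ.hl).P]
  have c1 : (Nat.card (blockUpper F (blk3 τ.r τ.j₁ : Fin k → ℕ)) : ℝ) ≠ 0 := by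
    exact_mod_cast Nat.card_pos.ne'
  have c2 : (Nat.card (uParabolic F τ.hl).P : ℝ) ≠ 0 := by exact_mod_cast Nat.card_pos.ne'
  have c3 : (Nat.card (τ.nilInter h h' F) : ℝ) ≠ 0 := by exact_mod_cast Nat.card_pos.ne'
  have c4 : (Nat.card (uParabolic F h').nil : ℝ) ≠ 0 := by exact_mod_cast Nat.card_pos.ne'
  push_cast
  field_simp

end ResInd

/-! ### Bases adapted to two isotropic subspaces -/

section Adapted

universe u

variable {F : Type*} [Field F] [StarRing F]

section Split

variable {V : Type u} [AddCommGroup V] [Module F V] (B : V →ₗ⋆[F] V →ₗ[F] F)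

/-- The orthogonal complement of a plane. -/
def planePerp (x y : V) : Submodule F V := LinearMap.ker (B x) ⊓ LinearMap.ker (B y)

theorem mem_planePerp {x y z : V} : z ∈ planePerp B x y ↔ B x z = 0 ∧ B y z = 0 := Iff.rfl

variable {B} {x y : V}

/-- The orthogonal projection to the complement of a hyperbolic plane. -/
def planeProj (hxx : B x x = 0) (hyy : B y y = 0) (hxy : B x y = 1) (hyx : B y x = 1) :
    V →ₗ[F] planePerp B x y :=
  LinearMap.codRestrict _ (LinearMap.id - (B y).smulRight x - (B x).smulRight y) fun z => by
    simp [mem_planePerp, hxx, hyy, hxy, hyx]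

theorem coe_planeProj (hxx : B x x = 0) (hyy : B y y = 0) (hxy : B x y = 1) (hyx : B y x = 1)
    (z : V) : (planeProj hxx hyy hxy hyx z : V) = z - B y z • x - B x z • y := rfl

theorem planeProj_coe (hxx : B x x = 0) (hyy : B y y = 0) (hxy : B x y = 1) (hyx : B y x = 1)
    (z : planePerp B x y) : planeProj hxx hyy hxy hyx z = z := by
  ext
  rw [coe_planeProj, z.2.1, z.2.2]
  simp

/-- In a space with a perfect hermitian form, a vector outside a subspace orthogonal to it has an
isotropic dual vector that is orthogonal to the subspace. -/
theorem exists_dual_vector (h2 : (2 : F) ≠ 0) (hs : ∀ x y, star (B x y) = B y x)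
    (hp : Function.Surjective B) (S : Submodule F V) (hxx : B x x = 0) (hxS : ∀ z ∈ S, B x z = 0)
    (hx : x ∉ S) : ∃ y, B y y = 0 ∧ B x y = 1 ∧ B y x = 1 ∧ ∀ z ∈ S, B y z = 0 := by
  -- A functional separating `x` from `S` is represented by a vector; after scaling it pairs to 1
  -- with `x` and is orthogonal to `S`.
  obtain ⟨f, hfx, hfS⟩ := Submodule.exists_le_ker_of_notMem hx
  obtain ⟨y, hy⟩ := hp ((f x)⁻¹ • f)
  have hyx : B y x = 1 := by rw [hy]; simp [hfx]
  have hyS : ∀ z ∈ S, B y z = 0 := fun z hz => by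
    rw [hy]; simp [LinearMap.mem_ker.1 (hfS hz)]
  have hxy : B x y = 1 := by rw [← hs, hyx, star_one]
  have hst : star (2⁻¹ : F) = 2⁻¹ := by rw [star_inv₀, star_ofNat]
  -- Subtracting half of `B y y` times `x` makes the dual vector isotropic. The pairings with `x`
  -- and `S` do not change, since `x` is orthogonal to itself and to `S`.
  refine ⟨y - (2⁻¹ * B y y) • x, ?_, ?_, ?_, fun z hz => ?_⟩
  · simp only [map_sub, LinearMap.sub_apply, map_smul, LinearMap.map_smulₛₗ, LinearMap.smul_apply,
      hyx, hxy, hxx, smul_eq_mul, starRingEnd_apply, star_mul, hst, hs]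
    field_simp
    ring
  · simp [hxx, hxy]
  · simp [hxx, hyx]
  · simp [hyS z hz, hxS z hz]

end Split

/-- A basis `x₁, …, y₁, …` of a hermitian space consisting of hyperbolic pairs, such that `E` is
spanned by the `xₐ` with `c a ≤ 2` and `W` is spanned by the `xₐ` with `c a = 0` or `c a = 3` and
the `yₐ` with `c a = 2`. -/
structure AdaptedBasis {V : Type u} [AddCommGroup V] [Module F V] (B : V →ₗ⋆[F] V →ₗ[F] F)
    (E W : Submodule F V) {ι : Type} [DecidableEq ι] (c : ι → Fin 5) (x y : ι → V) : Prop where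
  xx : ∀ a b, B (x a) (x b) = 0
  yy : ∀ a b, B (y a) (y b) = 0
  xy : ∀ a b, B (x a) (y b) = if a = b then 1 else 0
  ext : ∀ z, (∀ a, B (x a) z = 0 ∧ B (y a) z = 0) → z = 0
  mem_E : ∀ z, z ∈ E ↔ ∀ a, B (x a) z = 0 ∧ (2 < c a → B (y a) z = 0)
  mem_W : ∀ z, z ∈ W ↔ ∀ a, (c a ≠ 2 → B (x a) z = 0) ∧ (c a ≠ 0 → c a ≠ 3 → B (y a) z = 0)

/-- The hypotheses on `E` and `W` say that both subspaces split along the hyperbolic plane and its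
complement, with the part in the plane prescribed by the kind `c₀`. -/
theorem AdaptedBasis.cons {V : Type u} [AddCommGroup V] [Module F V] {B : V →ₗ⋆[F] V →ₗ[F] F}
    (hs : ∀ x y, star (B x y) = B y x) {E W : Submodule F V} {x₀ y₀ : V} (hxx : B x₀ x₀ = 0)
    (hyy : B y₀ y₀ = 0) (hxy : B x₀ y₀ = 1) (hyx : B y₀ x₀ = 1) (c₀ : Fin 5)
    (hE : ∀ z, z ∈ E ↔ (B x₀ z = 0 ∧ (2 < c₀ → B y₀ z = 0)) ∧
      (planeProj hxx hyy hxy hyx z : V) ∈ E)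
    (hW : ∀ z, z ∈ W ↔ ((c₀ ≠ 2 → B x₀ z = 0) ∧ (c₀ ≠ 0 → c₀ ≠ 3 → B y₀ z = 0)) ∧
      (planeProj hxx hyy hxy hyx z : V) ∈ W)
    {ι : Type} [DecidableEq ι] {c : ι → Fin 5} {x y : ι → planePerp B x₀ y₀}
    (H : AdaptedBasis ((B.domRestrict (planePerp B x₀ y₀)).compl₂ (planePerp B x₀ y₀).subtype)
      (E.comap (planePerp B x₀ y₀).subtype) (W.comap (planePerp B x₀ y₀).subtype) c x y) :
    AdaptedBasis B E W (fun a : Option ι => a.elim c₀ c) (fun a => a.elim x₀ fun a => x a)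
      (fun a => a.elim y₀ fun a => y a) := by
  have h1 (w : planePerp B x₀ y₀) : B w x₀ = 0 := by rw [← hs, w.2.1, star_zero]
  have h2 (w : planePerp B x₀ y₀) : B w y₀ = 0 := by rw [← hs, w.2.2, star_zero]
  have h3 (w : planePerp B x₀ y₀) (z : V) : B w (planeProj hxx hyy hxy hyx z) = B w z := by
    rw [coe_planeProj]; simp [h1, h2]
  refine ⟨?_, ?_, ?_, fun z hz => ?_, fun z => ?_, fun z => ?_⟩
  · rintro (_ | a) (_ | b)
    exacts [hxx, (x b).2.1, h1 _, H.xx a b]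
  · rintro (_ | a) (_ | b)
    exacts [hyy, (y b).2.2, h2 _, H.yy a b]
  · rintro (_ | a) (_ | b)
    · simpa using hxy
    · simpa using (y b).2.1
    · simpa using h2 _
    · simpa using H.xy a b
  · have h0 := H.ext (planeProj hxx hyy hxy hyx z) fun a =>
      ⟨(h3 (x a) z).trans (hz (some a)).1, (h3 (y a) z).trans (hz (some a)).2⟩
    have h0' := congrArg Subtype.val h0
    have e1 : B x₀ z = 0 := (hz none).1
    have e2 : B y₀ z = 0 := (hz none).2
    rw [coe_planeProj, e1, e2] at h0'
    simpa using h0'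
  · rw [hE, Option.forall]
    exact and_congr Iff.rfl ((H.mem_E (planeProj hxx hyy hxy hyx z)).trans (forall_congr' fun a => and_congr
      (Eq.congr_left (h3 (x a) z)) (imp_congr Iff.rfl (Eq.congr_left (h3 (y a) z)))))
  · rw [hW, Option.forall]
    exact and_congr Iff.rfl ((H.mem_W (planeProj hxx hyy hxy hyx z)).trans (forall_congr' fun a => and_congr
      (imp_congr Iff.rfl (Eq.congr_left (h3 (x a) z)))
      (imp_congr Iff.rfl (imp_congr Iff.rfl (Eq.congr_left (h3 (y a) z))))))

/-- A space with a perfect hermitian form and a Lagrangian subspace has a basis adapted to two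
isotropic subspaces. -/
theorem exists_adaptedBasis (h2 : (2 : F) ≠ 0) (d : ℕ) : ∀ (V : Type u) [AddCommGroup V]
    [Module F V] [FiniteDimensional F V] (_ : Module.finrank F V = d) (B : V →ₗ⋆[F] V →ₗ[F] F)
    (_ : ∀ x y, star (B x y) = B y x) (_ : Function.Surjective B) (L E W : Submodule F V)
    (_ : ∀ x, x ∈ L ↔ ∀ y ∈ L, B x y = 0) (_ : ∀ x ∈ E, ∀ y ∈ E, B x y = 0)
    (_ : ∀ x ∈ W, ∀ y ∈ W, B x y = 0), ∃ (ι : Type) (_ : DecidableEq ι) (_ : Fintype ι)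
      (c : ι → Fin 5) (x y : ι → V), AdaptedBasis B E W c x y := by
  induction d using Nat.strong_induction_on with
  | _ d ih =>
  intro V _ _ _ hd B hs hp L E W hL hE hW
  have step {x₀ y₀ : V} (hxx : B x₀ x₀ = 0) (hyy : B y₀ y₀ = 0) (hxy : B x₀ y₀ = 1)
      (hyx : B y₀ x₀ = 1) (c₀ : Fin 5)
      (hE' : ∀ z, z ∈ E ↔ (B x₀ z = 0 ∧ (2 < c₀ → B y₀ z = 0)) ∧
        (planeProj hxx hyy hxy hyx z : V) ∈ E)
      (hW' : ∀ z, z ∈ W ↔ ((c₀ ≠ 2 → B x₀ z = 0) ∧ (c₀ ≠ 0 → c₀ ≠ 3 → B y₀ z = 0)) ∧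
        (planeProj hxx hyy hxy hyx z : V) ∈ W) :
      ∃ (ι : Type) (_ : DecidableEq ι) (_ : Fintype ι) (c : ι → Fin 5) (x y : ι → V),
        AdaptedBasis B E W c x y := by
    have hx₀ (w : planePerp B x₀ y₀) : B w x₀ = 0 := by rw [← hs, w.2.1, star_zero]
    have hy₀ (w : planePerp B x₀ y₀) : B w y₀ = 0 := by rw [← hs, w.2.2, star_zero]
    have hlt : Module.finrank F (planePerp B x₀ y₀) < d := by
      rw [← hd]
      refine Submodule.finrank_lt fun h => ?_
      have : y₀ ∈ planePerp B x₀ y₀ := h ▸ Submodule.mem_top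
      exact one_ne_zero (hxy.symm.trans this.1)
    obtain ⟨ι, _, _, c, x, y, H⟩ := ih _ hlt (planePerp B x₀ y₀) rfl
      ((B.domRestrict (planePerp B x₀ y₀)).compl₂ (planePerp B x₀ y₀).subtype)
      (fun x y => hs x y)
      (fun f => by
        -- The complement inherits a perfect form: extend the functional by the projection,
        -- represent it, and project the representative.
        obtain ⟨w, hw⟩ := hp (f ∘ₗ planeProj hxx hyy hxy hyx)
        refine ⟨planeProj hxx hyy hxy hyx w, LinearMap.ext fun z => ?_⟩
        change B (planeProj hxx hyy hxy hyx w) z = f z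
        rw [coe_planeProj]
        simp [(mem_planePerp B).1 z.2, hw, planeProj_coe])
      -- A Lagrangian subspace of the complement is obtained from `L` by adding `x₀` and
      -- intersecting. It equals its own orthogonal: a vector outside is detected by some `v`
      -- orthogonal to `L` and `x₀`. Then `v` lies in `L`, and its projection lies in the new
      -- subspace.
      ((L ⊔ Submodule.span F {x₀}).comap (planePerp B x₀ y₀).subtype)
      (E.comap (planePerp B x₀ y₀).subtype) (W.comap (planePerp B x₀ y₀).subtype)
      (fun w => by
        rw [Submodule.mem_comap]
        refine ⟨fun hw w' hw' => ?_, fun hw => ?_⟩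
        · obtain ⟨a, ha, b, hb, hab⟩ := Submodule.mem_sup.1 hw
          obtain ⟨a', ha', b', hb', hab'⟩ := Submodule.mem_sup.1 (Submodule.mem_comap.1 hw')
          obtain ⟨t, rfl⟩ := Submodule.mem_span_singleton.1 hb
          obtain ⟨t', rfl⟩ := Submodule.mem_span_singleton.1 hb'
          have e1 : B x₀ a' = 0 := by
            have : B x₀ (w' : V) = 0 := w'.2.1
            rw [← show a' + t' • x₀ = (w' : V) from hab'] at this
            simpa [hxx] using this
          change B (w : V) (w' : V) = 0
          rw [← show a' + t' • x₀ = (w' : V) from hab', map_add, map_smul, hx₀,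
            ← show a + t • x₀ = (w : V) from hab]
          simp [e1, (hL a).1 ha a' ha']
        · by_contra hn
          obtain ⟨f, hfw, hf⟩ := Submodule.exists_le_ker_of_notMem hn
          obtain ⟨v, rfl⟩ := hp f
          have hvL : v ∈ L := (hL v).2 fun z hz => hf (Submodule.mem_sup_left hz)
          have hvx : B v x₀ = 0 := hf (Submodule.mem_sup_right (Submodule.mem_span_singleton_self _))
          have hxv : B x₀ v = 0 := by rw [← hs, hvx, star_zero]
          have hv : (planeProj hxx hyy hxy hyx v : V) = v - B y₀ v • x₀ := by
            rw [coe_planeProj, hxv, zero_smul, sub_zero]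
          have e := hw (planeProj hxx hyy hxy hyx v) (by
            rw [Submodule.mem_comap]
            change (planeProj hxx hyy hxy hyx v : V) ∈ _
            rw [hv]
            exact sub_mem (Submodule.mem_sup_left hvL) (Submodule.smul_mem _ _
              (Submodule.mem_sup_right (Submodule.mem_span_singleton_self _))))
          change B (w : V) (planeProj hxx hyy hxy hyx v : V) = 0 at e
          rw [hv, map_sub, map_smul, hx₀, smul_zero, sub_zero] at e
          exact hfw (by change B v (w : V) = 0; rw [← hs, e, star_zero]))
      (fun x hx y hy => hE x hx y hy) (fun x hx y hy => hW x hx y hy)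
    exact ⟨Option ι, inferInstance, inferInstance, _, _, _, H.cons hs hxx hyy hxy hyx c₀ hE' hW'⟩
  -- The cases of a vector of a plane contained in, or of a plane orthogonal to, a subspace.
  have hmem {S : Submodule F V} (hS : ∀ x ∈ S, ∀ y ∈ S, B x y = 0) {x₀ y₀ : V} (hxx : B x₀ x₀ = 0)
      (hyy : B y₀ y₀ = 0) (hxy : B x₀ y₀ = 1) (hyx : B y₀ x₀ = 1) (hx : x₀ ∈ S) (z : V) :
      z ∈ S ↔ B x₀ z = 0 ∧ (planeProj hxx hyy hxy hyx z : V) ∈ S := by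
    rw [coe_planeProj]
    refine ⟨fun hz => ⟨hS _ hx _ hz, ?_⟩, fun ⟨h, hz⟩ => ?_⟩
    · rw [hS _ hx _ hz, zero_smul, sub_zero]
      exact sub_mem hz (Submodule.smul_mem _ _ hx)
    · rw [h, zero_smul, sub_zero] at hz
      exact (Submodule.sub_mem_iff_left _ (Submodule.smul_mem _ _ hx)).1 hz
  have hmem' {S : Submodule F V} (hS : ∀ x ∈ S, ∀ y ∈ S, B x y = 0) {x₀ y₀ : V} (hxx : B x₀ x₀ = 0)
      (hyy : B y₀ y₀ = 0) (hxy : B x₀ y₀ = 1) (hyx : B y₀ x₀ = 1) (hy : y₀ ∈ S) (z : V) :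
      z ∈ S ↔ B y₀ z = 0 ∧ (planeProj hxx hyy hxy hyx z : V) ∈ S := by
    rw [coe_planeProj, sub_right_comm]
    exact hmem hS hyy hxx hyx hxy hy z
  have hperp {S : Submodule F V} {x₀ y₀ : V} (hxx : B x₀ x₀ = 0)
      (hyy : B y₀ y₀ = 0) (hxy : B x₀ y₀ = 1) (hyx : B y₀ x₀ = 1) (hx : ∀ z ∈ S, B x₀ z = 0)
      (hy : ∀ z ∈ S, B y₀ z = 0) (z : V) :
      z ∈ S ↔ (B x₀ z = 0 ∧ B y₀ z = 0) ∧ (planeProj hxx hyy hxy hyx z : V) ∈ S := by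
    rw [coe_planeProj]
    refine ⟨fun hz => ⟨⟨hx z hz, hy z hz⟩, ?_⟩, fun ⟨⟨h, h'⟩, hz⟩ => ?_⟩
    · rwa [hx z hz, hy z hz, zero_smul, zero_smul, sub_zero, sub_zero]
    · rwa [h, h', zero_smul, zero_smul, sub_zero, sub_zero] at hz
  -- A plane is split off in the order: common vectors of `E` and `W` (kind 0), non-orthogonal pairs
  -- from `E` and `W` (kind 2), vectors of `E` (kind 1), of `W` (kind 3), of `L` (kind 4). The order
  -- matters: for kinds 1 and 3 the dual vector must be orthogonal to the other subspace, which
  -- requires `E ⊓ W = 0` and `E ⊥ W` to have been reached.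
  by_cases h₀ : ∃ x₀ ∈ E, x₀ ∈ W ∧ x₀ ≠ 0
  · obtain ⟨x₀, hxE, hxW, hx⟩ := h₀
    obtain ⟨y₀, hyy, hxy, hyx, -⟩ := exists_dual_vector h2 hs hp ⊥ (hE _ hxE _ hxE)
      (fun z hz => by rw [(Submodule.mem_bot F).1 hz, map_zero]) hx
    refine step (hE _ hxE _ hxE) hyy hxy hyx 0 (fun z => ?_) fun z => ?_
    · simpa using hmem hE (hE _ hxE _ hxE) hyy hxy hyx hxE z
    · simpa using hmem hW (hE _ hxE _ hxE) hyy hxy hyx hxW z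
  by_cases h₁ : ∃ x₀ ∈ E, ∃ y₀ ∈ W, B x₀ y₀ ≠ 0
  · obtain ⟨x₀, hxE, y₀, hyW, hn⟩ := h₁
    have hyW' : (B x₀ y₀)⁻¹ • y₀ ∈ W := Submodule.smul_mem _ _ hyW
    have hxy : B x₀ ((B x₀ y₀)⁻¹ • y₀) = 1 := by simp [hn]
    have hyx : B ((B x₀ y₀)⁻¹ • y₀) x₀ = 1 := by rw [← hs, hxy, star_one]
    refine step (hE _ hxE _ hxE) (hW _ hyW' _ hyW') hxy hyx 2 (fun z => ?_) fun z => ?_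
    · simpa using hmem hE (hE _ hxE _ hxE) (hW _ hyW' _ hyW') hxy hyx hxE z
    · have := hmem' hW (hE _ hxE _ hxE) (hW _ hyW' _ hyW') hxy hyx hyW' z
      rw [this]
      simp
  push Not at h₀ h₁
  have h₁' : ∀ y ∈ W, ∀ x ∈ E, B y x = 0 := fun y hy x hx => by rw [← hs, h₁ x hx y hy, star_zero]
  by_cases h₃ : ∃ x₀ ∈ E, x₀ ≠ 0
  · obtain ⟨x₀, hxE, hx⟩ := h₃
    obtain ⟨y₀, hyy, hxy, hyx, hy⟩ := exists_dual_vector h2 hs hp W (hE _ hxE _ hxE)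
      (h₁ _ hxE) fun hxW => hx (h₀ _ hxE hxW)
    refine step (hE _ hxE _ hxE) hyy hxy hyx 1 (fun z => ?_) fun z => ?_
    · simpa using hmem hE (hE _ hxE _ hxE) hyy hxy hyx hxE z
    · simpa using hperp (hE _ hxE _ hxE) hyy hxy hyx (h₁ _ hxE) hy z
  push Not at h₃
  by_cases h₄ : ∃ x₀ ∈ W, x₀ ≠ 0
  · obtain ⟨x₀, hxW, hx⟩ := h₄
    obtain ⟨y₀, hyy, hxy, hyx, hy⟩ := exists_dual_vector h2 hs hp E (hW _ hxW _ hxW)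
      (h₁' _ hxW) fun hxE => hx (h₃ _ hxE)
    refine step (hW _ hxW _ hxW) hyy hxy hyx 3 (fun z => ?_) fun z => ?_
    · have := hperp (hW _ hxW _ hxW) hyy hxy hyx (h₁' _ hxW) hy z
      rw [this]
      simp
    · simpa using hmem hW (hW _ hxW _ hxW) hyy hxy hyx hxW z
  push Not at h₄
  by_cases h₅ : ∃ x₀ ∈ L, x₀ ≠ 0
  · obtain ⟨x₀, hxL, hx⟩ := h₅
    have hxx := (hL _).1 hxL _ hxL
    obtain ⟨y₀, hyy, hxy, hyx, -⟩ := exists_dual_vector h2 hs hp ⊥ hxx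
      (fun z hz => by rw [(Submodule.mem_bot F).1 hz, map_zero]) hx
    refine step hxx hyy hxy hyx 4 (fun z => ?_) fun z => ?_
    · have := hperp hxx hyy hxy hyx (S := E) (fun z hz => by rw [h₃ z hz, map_zero])
        (fun z hz => by rw [h₃ z hz, map_zero]) z
      rw [this]
      simp
    · have := hperp hxx hyy hxy hyx (S := W) (fun z hz => by rw [h₄ z hz, map_zero])
        (fun z hz => by rw [h₄ z hz, map_zero]) z
      rw [this]
      simp
  push Not at h₅
  -- A zero subspace that equals its own orthogonal forces the whole space to be zero.
  have h₆ (z : V) : z = 0 := h₅ z ((hL z).2 fun y hy => by rw [h₅ y hy, map_zero])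
  refine ⟨Empty, inferInstance, inferInstance, Empty.elim, Empty.elim, Empty.elim,
    fun a => a.elim, fun a => a.elim, fun a => a.elim, fun z _ => h₆ z, fun z => ?_, fun z => ?_⟩
  · rw [h₆ z]; simp
  · rw [h₆ z]; simp

end Adapted

/-! ### Relative position of two isotropic subspaces -/

section Bruhat

variable {F : Type*} [Field F]

theorem card_support_subset [Finite F] {κ : Type*} [Finite κ] (q : κ → Prop) :
    Nat.card {f : κ → F // ∀ a, ¬ q a → f a = 0} = Nat.card F ^ Nat.card {a // q a} := by
  classical
  rw [← Nat.card_fun]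
  exact Nat.card_congr
    { toFun := fun f a => f.1 a
      invFun := fun f => ⟨fun a => if h : q a then f ⟨a, h⟩ else 0, fun a ha => dif_neg ha⟩
      left_inv := fun f => Subtype.ext (funext fun a => by
        by_cases ha : q a
        · exact dif_pos ha
        · exact (dif_neg ha).trans (f.2 a ha).symm)
      right_inv := fun f => funext fun a => dif_pos a.2 }

variable [StarRing F] {i j k l n m : ℕ}

/-- The hermitian form `∑ₐ x̄ₐ y_{rev a}`. -/
def unitForm (F : Type*) [Field F] [StarRing F] (m : ℕ) : (Fin m → F) →ₗ⋆[F] (Fin m → F) →ₗ[F] F :=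
  LinearMap.mk₂'ₛₗ (starRingEnd F) (RingHom.id F) (fun x y => ∑ a, star (x a) * y a.rev)
    (fun x x' y => by simp [add_mul, Finset.sum_add_distrib])
    (fun c x y => by simp [mul_assoc, Finset.mul_sum, starRingEnd_apply])
    (fun x y y' => by simp [mul_add, Finset.sum_add_distrib])
    (fun c x y => by simp [mul_left_comm, Finset.mul_sum])

theorem unitForm_apply (x y : Fin m → F) : unitForm F m x y = ∑ a, star (x a) * y a.rev := rfl

theorem star_unitForm (x y : Fin m → F) : star (unitForm F m x y) = unitForm F m y x := by
  rw [unitForm_apply, unitForm_apply, star_sum, ← Equiv.sum_comp Fin.revPerm]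
  simp [mul_comm]

theorem unitForm_surjective : Function.Surjective (unitForm F m) := fun f => by
  refine ⟨fun a => star (f (Pi.single a.rev 1)), LinearMap.pi_ext' fun a => LinearMap.ext_ring ?_⟩
  simp [unitForm_apply, Pi.single_apply, Fin.rev_eq_iff]

theorem unitForm_mulVec (g : GL (Fin m) F) (hg : g ∈ unitaryGrp F m) (x y : Fin m → F) :
    unitForm F m (g.1 *ᵥ x) (g.1 *ᵥ y) = unitForm F m x y := by
  have h (x y : Fin m → F) : unitForm F m x y = star x ⬝ᵥ (J F m *ᵥ y) := by
    simp [unitForm_apply, dotProduct, Matrix.mulVec, J]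
  rw [h, h, Matrix.star_mulVec, ← Matrix.dotProduct_mulVec, Matrix.mulVec_mulVec,
    Matrix.mulVec_mulVec, show (g.1 : Matrix _ _ F)ᴴ * J F m * g.1 = J F m from hg]

/-- The subspace of vectors whose coordinates in blocks with number larger than `c` vanish. -/
def coordSub (F : Type*) [Field F] (b : Fin m → ℕ) (c : ℕ) : Submodule F (Fin m → F) where
  carrier := {z | ∀ a, c < b a → z a = 0}
  add_mem' := fun hx hy a ha => by simp [hx a ha, hy a ha]
  zero_mem' := fun _ _ => rfl
  smul_mem' := fun t x hx a ha => by simp [hx a ha]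

theorem mem_coordSub {b : Fin m → ℕ} {c : ℕ} {z : Fin m → F} :
    z ∈ coordSub F b c ↔ ∀ a, c < b a → z a = 0 := Iff.rfl

theorem mulVec_mem_coordSub {b : Fin m → ℕ} {g : Matrix (Fin m) (Fin m) F}
    (hg : g.BlockTriangular b) (c : ℕ) {z : Fin m → F} (hz : z ∈ coordSub F b c) :
    g *ᵥ z ∈ coordSub F b c := fun a ha => by
  change ∑ a', g a a' * z a' = 0
  refine Finset.sum_eq_zero fun a' _ => ?_
  rcases lt_or_ge c (b a') with h | h
  · rw [hz a' h, mul_zero]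
  · rw [hg (h.trans_lt ha), zero_mul]

theorem mulVec_mem_coordSub_iff {b : Fin m → ℕ} {g : GL (Fin m) F}
    (hg : g ∈ blockUpper F b) (c : ℕ) {z : Fin m → F} :
    g.1 *ᵥ z ∈ coordSub F b c ↔ z ∈ coordSub F b c := by
  refine ⟨fun hz => ?_, mulVec_mem_coordSub hg c⟩
  have := mulVec_mem_coordSub (blockTriangular_inv hg) c hz
  rwa [Matrix.mulVec_mulVec, Units.inv_mul, Matrix.one_mulVec] at this

theorem uBlk_pos_iff (h : i + j = n) (v : Fin (2 * n)) : 0 < uBlk h v ↔ i ≤ v := by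
  rw [uBlk_eq, blk3]; split_ifs <;> omega

theorem uBlk_one_lt_iff (h : i + j = n) (v : Fin (2 * n)) : 1 < uBlk h v ↔ i + 2 * j ≤ v := by
  rw [uBlk_eq, blk3]; split_ifs <;> omega

theorem isotropic_coordSub (h : i + j = n) : ∀ x ∈ coordSub F (uBlk h) 0,
    ∀ y ∈ coordSub F (uBlk h) 0, unitForm F (2 * n) x y = 0 := fun x hx y hy => by
  rw [unitForm_apply]
  refine Finset.sum_eq_zero fun a _ => ?_
  by_cases ha : i ≤ a.1
  · rw [hx a ((uBlk_pos_iff h a).2 ha), star_zero, zero_mul]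
  · rw [hy a.rev ((uBlk_pos_iff h _).2 (by rw [Fin.val_rev]; omega)), mul_zero]

/-- With `i = n` the middle block is empty. Testing against the basis vector at the reversed
position extracts each coordinate that has to vanish. -/
theorem mem_coordSub_lagrangian (x : Fin (2 * n) → F) :
    x ∈ coordSub F (uBlk (add_zero n)) 0 ↔
      ∀ y ∈ coordSub F (uBlk (add_zero n)) 0, unitForm F (2 * n) x y = 0 := by
  refine ⟨isotropic_coordSub (add_zero n) x, fun H a ha => ?_⟩
  have := H (Pi.single a.rev 1) fun b hb => by
    rw [uBlk_pos_iff] at ha hb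
    refine Pi.single_eq_of_ne (fun hab => ?_) _
    rw [hab, Fin.val_rev] at hb
    omega
  simpa [unitForm_apply, Pi.single_apply, Fin.rev_eq_iff] using this

/-- A unitary matrix that preserves the standard isotropic subspace is block triangular. -/
theorem blockTriangular_of_mulVec_mem_iff (h : i + j = n) {g : GL (Fin (2 * n)) F}
    (hg : g ∈ unitaryGrp F (2 * n))
    (H : ∀ z, g.1 *ᵥ z ∈ coordSub F (uBlk h) 0 ↔ z ∈ coordSub F (uBlk h) 0) :
    (g : Matrix (Fin (2 * n)) (Fin (2 * n)) F).BlockTriangular (uBlk h) := by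
  have hs (b : Fin (2 * n)) (hb : uBlk h b = 0) :
      (Pi.single b 1 : Fin (2 * n) → F) ∈ coordSub F (uBlk h) 0 := fun a ha =>
    Pi.single_eq_of_ne (fun hab => by rw [hab, hb] at ha; exact lt_irrefl _ ha) _
  have h1 (a b) (hb : uBlk h b = 0) (ha : 0 < uBlk h a) : g.1 a b = 0 := by
    have := (H _).2 (hs b hb) a ha
    simpa using this
  have h2 (a b) (hb : uBlk h b = 0) (ha : 0 < uBlk h a) : (g⁻¹).1 a b = 0 := by
    have := (H (g⁻¹.1 *ᵥ Pi.single b 1)).1 (by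
      rw [Matrix.mulVec_mulVec, Units.mul_inv, Matrix.one_mulVec]; exact hs b hb) a ha
    simpa using this
  have h3 : tau F g.1 = g⁻¹.1 :=
    eq_comm.1 (Units.inv_eq_of_mul_eq_one_left ((mem_unitaryGrp F g).1 hg))
  intro a b hab
  rcases Nat.eq_zero_or_pos (uBlk h b) with hb | hb
  · exact h1 a b hb (by omega)
  -- The entries left of the last diagonal block in the middle columns: since the inverse is `tau
  -- g`, they are conjugates of entries of the inverse that vanish because it also preserves the
  -- subspace.
  · have h4 := h2 b.rev a.rev
    rw [← h3, tau_apply, Fin.rev_rev, Fin.rev_rev, star_eq_zero] at h4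
    have ha : 1 < uBlk h a := by omega
    rw [uBlk_one_lt_iff] at ha
    refine h4 ?_ ?_
    · refine Nat.eq_zero_of_not_pos fun hc => ?_
      rw [uBlk_pos_iff, Fin.val_rev] at hc
      omega
    · have hb2 : ¬ 1 < uBlk h b := by
        have : uBlk h a ≤ 2 := by rw [uBlk_eq, blk3]; split_ifs <;> omega
        omega
      rw [uBlk_one_lt_iff] at hb2
      rw [uBlk_pos_iff, Fin.val_rev]
      omega

/-- The number of vectors of the standard isotropic subspaces in a position determined by `g`. -/
theorem card_position [Finite F] (τ : Position i j k l) (h : i + j = n) (h' : k + l = n)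
    {p q g : unitaryGrp F (2 * n)} (hp : p ∈ (uParabolic F h').P) (hq : q ∈ (uParabolic F h).P)
    (hg : g = p * τ.w h h' * q) (c : ℕ) :
    Nat.card {z : Fin (2 * n) → F // z ∈ coordSub F (uBlk h') c ∧
      g.1⁻¹.1 *ᵥ z ∈ coordSub F (uBlk h) 0} =
    Nat.card F ^ Nat.card {a : Fin i // blk3 τ.r τ.s a ≤ c} := by
  have hw (z : Fin (2 * n) → F) (v) : ((τ.w h h').1⁻¹.1 *ᵥ z) v = z (τ.sig h h' v) := by
    change (Matrix.mulVec (Matrix.of fun a b => if τ.sig h h' a = b then 1 else 0) z) v = _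
    simp [Matrix.mulVec, dotProduct]
  have e : {a : Fin i // blk3 τ.r τ.s a ≤ c} ≃
      {v : Fin (2 * n) // uBlk h' v ≤ c ∧ uBlk h ((τ.sig h h').symm v) = 0} :=
    Equiv.ofBijective (fun a => ⟨τ.sig h h' (uFst h a.1), by rw [τ.uBlk_sig_uFst]; exact a.2, by simp⟩)
      ⟨fun a b hab => Subtype.ext (uFst_injective h ((τ.sig h h').injective
        (congrArg Subtype.val hab))), fun ⟨v, hv, hv'⟩ => by
          obtain ⟨a, ha⟩ := (uBlk_zero h _).1 hv'
          rw [eq_comm, Equiv.symm_apply_eq] at ha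
          subst ha
          exact ⟨⟨a, by rwa [τ.uBlk_sig_uFst] at hv⟩, rfl⟩⟩
  rw [Nat.card_congr e, ← card_support_subset]
  -- The factors `p` and `q` preserve their own flags of coordinate subspaces, so `g` may be
  -- replaced by the permutation `w`, and the set to be counted becomes a coordinate subspace.
  have h1 (z : Fin (2 * n) → F) : (p.1⁻¹.1 *ᵥ z ∈ coordSub F (uBlk h') c ∧
      (τ.w h h').1⁻¹.1 *ᵥ (p.1⁻¹.1 *ᵥ z) ∈ coordSub F (uBlk h) 0) ↔
      (z ∈ coordSub F (uBlk h') c ∧ g.1⁻¹.1 *ᵥ z ∈ coordSub F (uBlk h) 0) := by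
    have hp' : p.1⁻¹ ∈ blockUpper F (uBlk h') := inv_mem hp
    have hq' : q.1⁻¹ ∈ blockUpper F (uBlk h) := inv_mem hq
    have hg' : g.1⁻¹.1 = q.1⁻¹.1 * ((τ.w h h').1⁻¹.1 * p.1⁻¹.1) := by
      rw [hg]
      simp only [Subgroup.coe_mul, mul_inv_rev, Units.val_mul]
    rw [mulVec_mem_coordSub_iff hp', hg', ← Matrix.mulVec_mulVec, mulVec_mem_coordSub_iff hq',
      ← Matrix.mulVec_mulVec]
  have h2 (z : Fin (2 * n) → F) : (z ∈ coordSub F (uBlk h') c ∧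
      (τ.w h h').1⁻¹.1 *ᵥ z ∈ coordSub F (uBlk h) 0) ↔
      ∀ v, ¬ (uBlk h' v ≤ c ∧ uBlk h ((τ.sig h h').symm v) = 0) → z v = 0 := by
    refine ⟨fun ⟨h₁, h₂⟩ v hv => ?_, fun H => ⟨fun v hv => H v fun hc => by omega, fun v hv => ?_⟩⟩
    · by_cases hc : uBlk h' v ≤ c
      · have := h₂ ((τ.sig h h').symm v) (Nat.pos_of_ne_zero fun h0 => hv ⟨hc, h0⟩)
        rwa [hw, Equiv.apply_symm_apply] at this
      · exact h₁ v (not_le.1 hc)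
    · rw [hw]
      refine H _ fun hc => ?_
      rw [Equiv.symm_apply_apply] at hc
      exact hv.ne' hc.2
  exact Nat.card_congr (Equiv.subtypeEquiv
    { toFun := fun z => p.1⁻¹.1 *ᵥ z
      invFun := fun z => p.1.1 *ᵥ z
      left_inv := fun z => by
        beta_reduce
        rw [Matrix.mulVec_mulVec, Units.mul_inv, Matrix.one_mulVec]
      right_inv := fun z => by
        beta_reduce
        rw [Matrix.mulVec_mulVec, Units.inv_mul, Matrix.one_mulVec] }
    fun z => (h1 z).symm.trans (h2 _))

theorem Position.ext_of_le {τ τ' : Position i j k l} (hr : τ.r = τ'.r) (hs : τ.s = τ'.s) :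
    τ = τ' := by
  obtain ⟨r, s, t, j₁, j₂, h₁, h₂, h₃, h₄⟩ := τ
  obtain ⟨r', s', t', j₁', j₂', h₁', h₂', h₃', h₄'⟩ := τ'
  simp only at hr hs
  subst hr hs
  obtain rfl : t = t' := by omega
  obtain rfl : j₁ = j₁' := by omega
  obtain rfl : j₂ = j₂' := by omega
  rfl

theorem card_fin_lt {m c : ℕ} (hc : c ≤ m) : Nat.card {a : Fin m // a.1 < c} = c := by
  rw [Nat.card_congr (⟨fun a => ⟨a.1.1, a.2⟩, fun a => ⟨⟨a.1, a.2.trans_le hc⟩, a.2⟩,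
    fun _ => rfl, fun _ => rfl⟩ : {a : Fin m // a.1 < c} ≃ Fin c), Nat.card_eq_fintype_card,
    Fintype.card_fin]

/-- With `E` the standard isotropic subspace of dimension `k` and `W` the translate by `g` of the
one of dimension `i`, the cardinalities of `W ⊓ E` and `W ⊓ E^⊥` depend on `g` alone. They are `|F|
^ r` and `|F| ^ (r + s)`, and `r`, `s` determine the position. -/
theorem position_unique [Finite F] {τ τ' : Position i j k l} (h : i + j = n) (h' : k + l = n)
    {p q p' q' : unitaryGrp F (2 * n)} (hp : p ∈ (uParabolic F h').P) (hq : q ∈ (uParabolic F h).P)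
    (hp' : p' ∈ (uParabolic F h').P) (hq' : q' ∈ (uParabolic F h).P)
    (hg : p * τ.w h h' * q = p' * τ'.w h h' * q') : τ = τ' := by
  have key (c : ℕ) : Nat.card {a : Fin i // blk3 τ.r τ.s a ≤ c} =
      Nat.card {a : Fin i // blk3 τ'.r τ'.s a ≤ c} :=
    Nat.pow_right_injective (Finite.one_lt_card (α := F))
      ((card_position τ h h' hp hq rfl c).symm.trans (card_position τ' h h' hp' hq' hg c))
  have h0 (σ : Position i j k l) : Nat.card {a : Fin i // blk3 σ.r σ.s a ≤ 0} = σ.r := by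
    refine Eq.trans (Nat.card_congr (Equiv.subtypeEquivRight fun a => ?_))
      (card_fin_lt (m := i) (c := σ.r) (by have := σ.hi; omega))
    rw [blk3]; split_ifs <;> omega
  have h1 (σ : Position i j k l) : Nat.card {a : Fin i // blk3 σ.r σ.s a ≤ 1} = σ.r + σ.s := by
    refine Eq.trans (Nat.card_congr (Equiv.subtypeEquivRight fun a => ?_))
      (card_fin_lt (m := i) (c := σ.r + σ.s) (by have := σ.hi; omega))
    rw [blk3]; split_ifs <;> omega
  have k0 := key 0
  have k1 := key 1
  rw [h0, h0] at k0
  rw [h1, h1] at k1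
  exact Position.ext_of_le k0 (by omega)

end Bruhat

/-! ### Existence of the double coset decomposition -/

section Exists

variable {F : Type*} [Field F] [StarRing F] {i j k l n m : ℕ}

theorem card_sum_subtype {ι : Type*} [Fintype ι] (q q' : ι → Prop) [DecidablePred q]
    [DecidablePred q'] : Nat.card {p : ι ⊕ ι // Sum.elim q q' p} =
      ∑ a, ((if q a then 1 else 0) + if q' a then 1 else 0) := by
  classical
  rw [Nat.card_eq_fintype_card, Fintype.card_subtype, Finset.card_filter, Fintype.sum_sum_type,
    Finset.sum_add_distrib]
  congr 1 <;> exact Finset.sum_congr rfl fun a _ => if_congr Iff.rfl rfl rfl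

namespace AdaptedBasis

variable {V : Type*} [AddCommGroup V] [Module F V] {B : V →ₗ⋆[F] V →ₗ[F] F}
    {E W : Submodule F V} {ι : Type} [DecidableEq ι] [Fintype ι] {c : ι → Fin 5} {x y : ι → V}

/-- Coordinates with respect to a basis of hyperbolic pairs. -/
noncomputable def coords (H : AdaptedBasis B E W c x y) (hs : ∀ x y, star (B x y) = B y x) :
    V ≃ (ι ⊕ ι → F) where
  toFun z := Sum.elim (fun a => B (y a) z) fun a => B (x a) z
  invFun f := ∑ a, (f (Sum.inl a) • x a + f (Sum.inr a) • y a)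
  left_inv z := by
    have yx (a b) : B (y a) (x b) = if a = b then 1 else 0 := by
      rw [← hs, H.xy]; split_ifs <;> simp_all
    refine sub_eq_zero.1 (H.ext _ fun a => ?_)
    simp [H.xx, H.yy, H.xy, yx]
  right_inv f := by
    have yx (a b) : B (y a) (x b) = if a = b then 1 else 0 := by
      rw [← hs, H.xy]; split_ifs <;> simp_all
    funext a
    rcases a with a | a <;> simp [H.xx, H.yy, H.xy, yx]

theorem card_eq [Finite F] (H : AdaptedBasis B E W c x y) (hs : ∀ x y, star (B x y) = B y x)
    (S : Submodule F V) (q : ι ⊕ ι → Prop) (hq : ∀ z, z ∈ S ↔ ∀ p, ¬ q p → H.coords hs z p = 0) :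
    Nat.card S = Nat.card F ^ Nat.card {p // q p} := by
  rw [← card_support_subset]
  exact Nat.card_congr (Equiv.subtypeEquiv (H.coords hs) hq)

end AdaptedBasis

theorem card_coordSub_zero [Finite F] (h : i + j = n) :
    Nat.card (coordSub F (uBlk h) 0) = Nat.card F ^ i := by
  have : Nat.card {a : Fin (2 * n) // a.1 < i} = i := card_fin_lt (by omega)
  conv_rhs => rw [← this]
  rw [← card_support_subset]
  refine Nat.card_congr (Equiv.subtypeEquivRight fun z => forall_congr' fun a => ?_)
  rw [uBlk_pos_iff, not_lt]

/-- The column of the matrix of a basis of hyperbolic pairs. -/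
def hypCol {V ι : Type*} (γ : Fin n → ι) (x y : ι → V) (b : Fin (2 * n)) : V :=
  if h : b.1 < n then x (γ ⟨b, h⟩) else y (γ ⟨b.rev, by rw [Fin.val_rev]; omega⟩)

/-- The intervals excluded on the right are the images under the permutation of the three pieces of
the first source block; they are the coordinates spanning `w` applied to the standard isotropic
subspace. -/
theorem Position.le_sigNat_symm_iff (τ : Position i j k l) (h' : k + l = n) {v : ℕ}
    (hv : v < 2 * n) : i ≤ τ.symm.sigNat v ↔ ¬ (v < τ.r ∨ (k ≤ v ∧ v < k + τ.s) ∨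
      (k + 2 * l ≤ v ∧ v < k + 2 * l + τ.t)) := by
  have h₁ := τ.hi
  have h₂ := τ.hj
  have h₃ := τ.hk
  have h₄ := τ.hl
  unfold sigNat
  simp only
  split_ifs <;> omega

/-- Take hyperbolic pairs adapted to the standard `E` and to `W`, the translate by `g` of the
standard isotropic subspace, and order them by kind. The matrix `p` of this basis preserves `E`, so
it lies in `P'`; and `p w` has the same effect as `g` on the standard isotropic subspace, so they
differ by an element of `P` on the right. -/
theorem position_exists [Finite F] (h2 : (2 : F) ≠ 0) (h : i + j = n) (h' : k + l = n)
    (g : unitaryGrp F (2 * n)) : ∃ τ : Position i j k l, ∃ p ∈ (uParabolic F h').P,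
      ∃ q ∈ (uParabolic F h).P, g = p * τ.w h h' * q := by
  have hinv (z : Fin (2 * n) → F) : g.1⁻¹.1 *ᵥ (g.1.1 *ᵥ z) = z := by
    rw [Matrix.mulVec_mulVec, Units.inv_mul, Matrix.one_mulVec]
  have hinv' (z : Fin (2 * n) → F) : g.1.1 *ᵥ (g.1⁻¹.1 *ᵥ z) = z := by
    rw [Matrix.mulVec_mulVec, Units.mul_inv, Matrix.one_mulVec]
  set W : Submodule F (Fin (2 * n) → F) :=
    (coordSub F (uBlk h) 0).comap (Matrix.mulVecLin g.1⁻¹.1) with hWdef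
  have hcW : Nat.card W = Nat.card F ^ i := by
    rw [← card_coordSub_zero h]
    exact Nat.card_congr (Equiv.subtypeEquiv ⟨fun z => g.1⁻¹.1 *ᵥ z, fun z => g.1.1 *ᵥ z,
      hinv', hinv⟩ fun z => Iff.rfl)
  obtain ⟨ι, _, _, c, x, y, H⟩ := exists_adaptedBasis h2 _ (Fin (2 * n) → F) rfl (unitForm F (2 * n))
    star_unitForm unitForm_surjective (coordSub F (uBlk (add_zero n)) 0) (coordSub F (uBlk h') 0) W
    mem_coordSub_lagrangian (isotropic_coordSub h') (fun x hx y hy => by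
      rw [← unitForm_mulVec g.1⁻¹ (inv_mem g.2)]
      exact isotropic_coordSub h _ hx _ hy)
  have hF : Function.Injective (Nat.card F ^ · : ℕ → ℕ) :=
    Nat.pow_right_injective (Finite.one_lt_card (α := F))
  -- Counting the pairs of each kind.
  set N : Fin 5 → ℕ := fun e => ∑ a, if c a = e then 1 else 0 with hN
  have cE : k = N 0 + N 1 + N 2 := by
    have e := H.card_eq star_unitForm (coordSub F (uBlk h') 0)
      (Sum.elim (fun a => c a ≤ 2) fun _ => False) (fun z => by
        rw [H.mem_E, Sum.forall]
        simp [AdaptedBasis.coords, forall_and, and_comm])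
    rw [card_coordSub_zero, card_sum_subtype] at e
    rw [hF e]
    simp only [hN, ← Finset.sum_add_distrib]
    refine Finset.sum_congr rfl fun a _ => ?_
    -- What is left is an identity between indicator functions of kinds, checked on all five of
    -- them.
    generalize c a = e
    revert e
    decide
  have cW : i = N 0 + N 3 + N 2 := by
    have e := H.card_eq star_unitForm W
      (Sum.elim (fun a => c a = 0 ∨ c a = 3) fun a => c a = 2) (fun z => by
        rw [H.mem_W, Sum.forall]
        simp [AdaptedBasis.coords, forall_and, and_comm])
    rw [hcW, card_sum_subtype] at e
    rw [hF e]
    simp only [hN, ← Finset.sum_add_distrib]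
    refine Finset.sum_congr rfl fun a _ => ?_
    generalize c a = e
    revert e
    decide
  have cT : Fintype.card ι = n := by
    have e := H.card_eq star_unitForm ⊤
      (Sum.elim (fun _ => True) fun _ => True) (fun z => by simp)
    have e' : Nat.card (⊤ : Submodule F (Fin (2 * n) → F)) = Nat.card F ^ (2 * n) := by
      rw [Nat.card_congr (Equiv.subtypeUnivEquiv fun _ => Submodule.mem_top), Nat.card_fun]
      simp
    rw [e', card_sum_subtype] at e
    have := hF e
    simp at this
    omega
  have cN : n = N 0 + N 1 + N 2 + N 3 + N 4 := by
    rw [← cT, Fintype.card_eq_sum_ones]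
    simp only [hN, ← Finset.sum_add_distrib]
    refine Finset.sum_congr rfl fun a _ => ?_
    generalize c a = e
    revert e
    decide
  obtain ⟨γ, hγ⟩ : ∃ γ : Fin n ≃ ι, Monotone fun a => c (γ a) :=
    ⟨(Tuple.sort fun a => c ((Fintype.equivFinOfCardEq cT).symm a)).trans
      (Fintype.equivFinOfCardEq cT).symm,
      Tuple.monotone_sort fun a => c ((Fintype.equivFinOfCardEq cT).symm a)⟩
  have hcard (e : Fin 5) : Finset.card {a | c (γ a) ≤ e} = ∑ a, if c a ≤ e then 1 else 0 := by
    rw [Finset.card_filter]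
    exact Equiv.sum_comp γ fun a => if c a ≤ e then 1 else 0
  -- The kinds are sorted, so those bounded by `e` occupy an initial segment.
  have hle (a : Fin n) (e : Fin 5) : c (γ a) ≤ e ↔ a.1 < ∑ a, if c a ≤ e then 1 else 0 := by
    rw [← hcard]
    exact (Tuple.lt_card_le_iff_apply_le_of_monotone hγ).symm
  have c0 (a : Fin n) : c (γ a) ≤ 0 ↔ a.1 < N 0 := by
    rw [hle]
    refine iff_of_eq (congrArg _ (Finset.sum_congr rfl fun a _ => ?_))
    generalize c a = e
    revert e
    decide
  have c1 (a : Fin n) : c (γ a) ≤ 1 ↔ a.1 < N 0 + N 1 := by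
    rw [hle]
    simp only [hN, ← Finset.sum_add_distrib]
    refine iff_of_eq (congrArg _ (Finset.sum_congr rfl fun a _ => ?_))
    generalize c a = e
    revert e
    decide
  have c2 (a : Fin n) : c (γ a) ≤ 2 ↔ a.1 < N 0 + N 1 + N 2 := by
    rw [hle]
    simp only [hN, ← Finset.sum_add_distrib]
    refine iff_of_eq (congrArg _ (Finset.sum_congr rfl fun a _ => ?_))
    generalize c a = e
    revert e
    decide
  have c3 (a : Fin n) : c (γ a) ≤ 3 ↔ a.1 < N 0 + N 1 + N 2 + N 3 := by
    rw [hle]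
    simp only [hN, ← Finset.sum_add_distrib]
    refine iff_of_eq (congrArg _ (Finset.sum_congr rfl fun a _ => ?_))
    generalize c a = e
    revert e
    decide
  -- The numbers of pairs of kinds 0, 3, 2, 1, 4 are `r`, `s`, `t`, `j₁`, `j₂`: common vectors,
  -- vectors of `W` orthogonal to `E`, paired vectors, vectors of `E` orthogonal to `W`, and the
  -- rest.
  let τ : Position i j k l := ⟨N 0, N 3, N 2, N 1, N 4, by omega, by omega, by omega, by omega⟩
  -- The matrix of the basis, in the order of the kinds of the pairs.
  have hcol (b b') : unitForm F (2 * n) (hypCol γ x y b) (hypCol γ x y b') =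
      if b' = b.rev then 1 else 0 := by
    have yx (a b) : unitForm F (2 * n) (y a) (x b) = if a = b then 1 else 0 := by
      rw [← star_unitForm, H.xy]; split_ifs <;> simp_all
    unfold hypCol
    have hb := Fin.val_rev b
    have hb' (b' : Fin (2 * n)) : b' = b.rev ↔ b'.1 = 2 * n - (b + 1) := by rw [Fin.ext_iff, hb]
    by_cases h₁ : b.1 < n <;> by_cases h₂ : b'.1 < n
    · rw [dif_pos h₁, dif_pos h₂, H.xx, if_neg (by rw [hb']; omega)]
    · rw [dif_pos h₁, dif_neg h₂, H.xy]
      refine if_congr ?_ rfl rfl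
      rw [γ.apply_eq_iff_eq, hb', Fin.ext_iff, Fin.val_rev]
      simp only
      omega
    · rw [dif_neg h₁, dif_pos h₂, yx]
      refine if_congr ?_ rfl rfl
      rw [γ.apply_eq_iff_eq, hb', Fin.ext_iff]
      simp only [hb]
      omega
    · rw [dif_neg h₁, dif_neg h₂, H.yy, if_neg (by rw [hb']; omega)]
  -- The Gram matrix of the columns is `J`, which is unitarity of their matrix.
  have hpp : tau F (Matrix.of fun a b => hypCol γ x y b a) *
      (Matrix.of fun a b => hypCol γ x y b a) = 1 := by
    ext b b'
    rw [Matrix.mul_apply, Matrix.one_apply]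
    have := hcol b.rev b'
    rw [unitForm_apply, ← Equiv.sum_comp Fin.revPerm] at this
    simpa [tau_apply, eq_comm] using this
  let p : GL (Fin (2 * n)) F :=
    ⟨Matrix.of fun a b => hypCol γ x y b a, tau F (Matrix.of fun a b => hypCol γ x y b a),
      mul_eq_one_comm.1 hpp, hpp⟩
  have hp : p ∈ unitaryGrp F (2 * n) := (mem_unitaryGrp F p).2 p.inv_val
  have hpz (z : Fin (2 * n) → F) (b) :
      unitForm F (2 * n) (hypCol γ x y b) (p.1 *ᵥ z) = z b.rev := by
    have : p.1 *ᵥ z = ∑ b', z b' • hypCol γ x y b' := by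
      ext a
      simp [p, Matrix.mulVec, dotProduct, mul_comm]
    rw [this]
    simp [hcol]
  have hx (z : Fin (2 * n) → F) (a : Fin n) :
      unitForm F (2 * n) (x (γ a)) (p.1 *ᵥ z) = z ⟨2 * n - (a + 1), by omega⟩ := by
    have := hpz z ⟨a, by omega⟩
    rw [hypCol, dif_pos a.2] at this
    exact this
  have hy (z : Fin (2 * n) → F) (a : Fin n) :
      unitForm F (2 * n) (y (γ a)) (p.1 *ᵥ z) = z ⟨a, by omega⟩ := by
    have := hpz z (Fin.rev ⟨a, by omega⟩)
    rw [hypCol, dif_neg (by rw [Fin.val_rev]; simp only; omega)] at this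
    simpa using this
  have hpP : (p : Matrix (Fin (2 * n)) (Fin (2 * n)) F).BlockTriangular (uBlk h') := by
    refine blockTriangular_of_mulVec_mem_iff h' hp fun z => ?_
    rw [H.mem_E, ← γ.forall_congr_right, mem_coordSub]
    simp only [hx, hy, uBlk_pos_iff]
    refine ⟨fun H b hb => ?_, fun H a => ⟨H _ ?_, fun ha => H _ ?_⟩⟩
    · by_cases hbn : b.1 < n
      · refine (H ⟨b, hbn⟩).2 ?_
        rw [← not_le, c2]
        simp only
        omega
      · have := (H ⟨2 * n - (b + 1), by omega⟩).1
        convert this using 2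
        ext
        simp only
        omega
    · simp only; omega
    · rw [← not_le, c2] at ha
      simp only
      omega
  have hwz (z : Fin (2 * n) → F) (v) :
      ((τ.w h h').1.1 *ᵥ z) v = z ⟨τ.symm.sigNat v, τ.symm.sigNat_lt h' v.2⟩ := by
    change (Matrix.mulVec (Matrix.of fun a b => if a = τ.sig h h' b then 1 else 0) z) v =
      z ((τ.sig h h').symm v)
    simp [Matrix.mulVec, dotProduct, ← Equiv.symm_apply_eq]
  -- The inverse of the right factor is used because `g⁻¹ p w z` is in the standard subspace exactly
  -- when `p w z` lies in `W`, a condition on the coordinates of `z` read off from the adapted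
  -- basis.
  have hq : ((⟨p, hp⟩ * τ.w h h')⁻¹ * g)⁻¹ ∈ (uParabolic F h).P := by
    refine blockTriangular_of_mulVec_mem_iff h (((⟨p, hp⟩ * τ.w h h')⁻¹ * g)⁻¹).2 fun z => ?_
    have e : (((⟨p, hp⟩ * τ.w h h')⁻¹ * g)⁻¹).1.1 *ᵥ z =
        g.1⁻¹.1 *ᵥ (p.1 *ᵥ ((τ.w h h').1.1 *ᵥ z)) := by
      rw [mul_inv_rev, inv_inv, Matrix.mulVec_mulVec, Matrix.mulVec_mulVec, mul_assoc]
      rfl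
    change (((⟨p, hp⟩ * τ.w h h')⁻¹ * g)⁻¹).1.1 *ᵥ z ∈ _ ↔ _
    rw [e]
    change p.1 *ᵥ ((τ.w h h').1.1 *ᵥ z) ∈ W ↔ _
    rw [H.mem_W, ← γ.forall_congr_right, mem_coordSub]
    simp only [hx, hy, hwz, uBlk_pos_iff]
    have e0 (a : Fin n) : c (γ a) = 0 ↔ a.1 < N 0 := by
      rw [← c0]; generalize c (γ a) = e; revert e; decide
    have e2 (a : Fin n) : c (γ a) = 2 ↔ N 0 + N 1 ≤ a.1 ∧ a.1 < k := by
      rw [cE, ← c2, ← not_lt, ← c1]; generalize c (γ a) = e; revert e; decide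
    have e3 (a : Fin n) : c (γ a) = 3 ↔ k ≤ a.1 ∧ a.1 < k + N 3 := by
      rw [cE, ← c3, ← not_lt, ← c2]; generalize c (γ a) = e; revert e; decide
    have hτ {v : ℕ} (hv : v < 2 * n) : i ≤ τ.symm.sigNat v ↔ ¬ (v < N 0 ∨ (k ≤ v ∧ v < k + N 3) ∨
        (k + 2 * l ≤ v ∧ v < k + 2 * l + N 2)) := τ.le_sigNat_symm_iff h' hv
    simp only [ne_eq, e0, e2, e3]
    refine ⟨fun H b hb => ?_, fun H a => ⟨fun ha => H _ ?_, fun ha ha' => H _ ?_⟩⟩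
    · obtain ⟨v, rfl⟩ := (τ.sig h h').symm.surjective b
      have hb' : i ≤ τ.symm.sigNat v := hb
      rw [hτ v.2] at hb'
      change z ⟨τ.symm.sigNat v, _⟩ = 0
      by_cases hvn : v.1 < n
      · exact (H ⟨v, hvn⟩).2 (by simp only; omega) (by simp only; omega)
      · have := (H ⟨2 * n - (v + 1), by omega⟩).1 (by simp only; omega)
        have hv : 2 * n - (2 * n - (v.1 + 1) + 1) = v.1 := by omega
        simpa only [hv] using this
    · simp only
      rw [hτ (by omega)]
      omega
    · simp only
      rw [hτ (by omega)]
      omega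
  exact ⟨τ, ⟨p, hp⟩, hpP, _, inv_mem_iff.1 hq, by rw [mul_inv_cancel_left]⟩

theorem existsUnique_position [Finite F] (h2 : (2 : F) ≠ 0) (h : i + j = n) (h' : k + l = n)
    (g : unitaryGrp F (2 * n)) : ∃! τ : Position i j k l, ∃ p ∈ (uParabolic F h').P,
      ∃ q ∈ (uParabolic F h).P, g = p * τ.w h h' * q := by
  obtain ⟨τ, p, hp, q, hq, hg⟩ := position_exists h2 h h' g
  refine ⟨τ, ⟨p, hp, q, hq, hg⟩, fun τ' ⟨p', hp', q', hq', hg'⟩ => ?_⟩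
  exact position_unique h h' hp' hq' hp hq (hg'.symm.trans hg)

instance : Finite (Position i j k l) :=
  Finite.of_injective (fun τ => ((⟨τ.r, by have := τ.hi; omega⟩, ⟨τ.s, by have := τ.hi; omega⟩) :
    Fin (i + 1) × Fin (i + 1))) fun τ τ' h => by
      simp only [Prod.mk.injEq, Fin.mk.injEq] at h
      exact Position.ext_of_le h.1 h.2

end Exists

/-! ### Components of elements of `A ⊗ B` -/

section Components

variable {F : Type*} [Field F] [StarRing F] {i j k l n : ℕ}

/-- The inclusion of a homogeneous component into `A`. -/
noncomputable abbrev lofA (F : Type*) [Field F] (n : ℕ) : InvFun (adGL F (Fin n)) →ₗ[ℝ] AlgA F :=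
  DirectSum.lof ℝ ℕ (fun n => InvFun (adGL F (Fin n))) n

/-- The inclusion of a homogeneous component into `B`. -/
noncomputable abbrev lofB (F : Type*) [Field F] [StarRing F] (n : ℕ) :
    InvFun (adU F (2 * n)) →ₗ[ℝ] ModB F :=
  DirectSum.lof ℝ ℕ (fun n => InvFun (adU F (2 * n))) n

/-- The value at a point of the homogeneous component of degree `(k, l)` of an element of
`A ⊗ B`. -/
noncomputable def evAB (k l : ℕ) (Y : Matrix (Fin k) (Fin k) F × unitaryLie F (2 * l)) :
    AlgA F ⊗[ℝ] ModB F →ₗ[ℝ] ℝ :=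
  LinearMap.proj Y ∘ₗ (InvFun (adProd (adGL F (Fin k)) (adU F (2 * l)))).subtype ∘ₗ
    tensorToProd _ _ ∘ₗ TensorProduct.map (DirectSum.component ℝ ℕ _ k) (DirectSum.component ℝ ℕ _ l)

theorem evAB_tmul (Y : Matrix (Fin k) (Fin k) F × unitaryLie F (2 * l)) (a : AlgA F) (b : ModB F) :
    evAB k l Y (a ⊗ₜ b) = (a k).1 Y.1 * (b l).1 Y.2 := rfl

theorem directSum_apply_eq_map_component {R ι κ : Type*} [CommRing R] [DecidableEq ι] [DecidableEq κ]
    {M : ι → Type*} {N : κ → Type*} [∀ i, AddCommGroup (M i)] [∀ i, AddCommGroup (N i)]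
    [∀ i, Module R (M i)] [∀ i, Module R (N i)]
    (t : (DirectSum ι M) ⊗[R] (DirectSum κ N)) (k : ι) (l : κ) :
    TensorProduct.directSum R R M N t (k, l) =
      TensorProduct.map (DirectSum.component R ι M k) (DirectSum.component R κ N l) t := by
  symm
  induction t with
  | zero => simp
  | add s t hs ht => rw [map_add, map_add, hs, ht, DirectSum.add_apply]
  | tmul a b =>
    induction a using DirectSum.induction_on with
    | zero => simp
    | add a a' ha ha' => rw [TensorProduct.add_tmul, map_add, map_add, ha, ha', DirectSum.add_apply]
    | of i a =>
      induction b using DirectSum.induction_on with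
      | zero => simp
      | add b b' hb hb' => rw [TensorProduct.tmul_add, map_add, map_add, hb, hb', DirectSum.add_apply]
      | of j b =>
        rw [← DirectSum.lof_eq_of R, ← DirectSum.lof_eq_of R, TensorProduct.directSum_lof_tmul_lof,
          TensorProduct.map_tmul]
        by_cases h : (i, j) = (k, l)
        · obtain ⟨rfl, rfl⟩ := Prod.ext_iff.1 h
          rw [DirectSum.component.lof_self, DirectSum.component.lof_self]
          exact (DirectSum.lof_apply R (M := fun x : ι × κ => M x.1 ⊗[R] N x.2) (i, j) _).symm
        · refine Eq.trans ?_ (DFinsupp.single_eq_of_ne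
            (β := fun x : ι × κ => M x.1 ⊗[R] N x.2) (Ne.symm h)).symm
          by_cases hi : i = k
          · have hj : ¬ j = l := fun hj => h (by rw [hi, hj])
            rw [DirectSum.component.of R l j, dif_neg hj, TensorProduct.tmul_zero]
          · rw [DirectSum.component.of, dif_neg hi, TensorProduct.zero_tmul]

/-- Tensor products commute with direct sums, and in each bidegree a tensor is determined by its
function of two variables. -/
theorem eq_of_evAB [Finite F] {t t' : AlgA F ⊗[ℝ] ModB F} (h : ∀ k l Y, evAB k l Y t = evAB k l Y t') :
    t = t' := by
  refine (TensorProduct.directSum ℝ ℝ (fun n => InvFun (adGL F (Fin n)))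
    (fun n => InvFun (adU F (2 * n)))).injective (DFinsupp.ext fun ⟨k, l⟩ => ?_)
  exact (directSum_apply_eq_map_component t k l).trans ((tensorToProd_injective _ _
    (Subtype.ext (funext fun Y => h k l Y))).trans (directSum_apply_eq_map_component t' k l).symm)

theorem lofA_apply_eq (f : InvFun (adGL F (Fin n))) : lofA F n f n = f := DirectSum.lof_apply ..

theorem lofB_apply_eq (f : InvFun (adU F (2 * n))) : lofB F n f n = f := DirectSum.lof_apply ..

theorem lofA_apply_ne (h : n ≠ k) (f : InvFun (adGL F (Fin n))) : lofA F n f k = 0 :=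
  DFinsupp.single_eq_of_ne h.symm

theorem lofB_apply_ne (h : n ≠ k) (f : InvFun (adU F (2 * n))) : lofB F n f k = 0 :=
  DFinsupp.single_eq_of_ne h.symm

theorem evAB_map_lof (Y : Matrix (Fin k) (Fin k) F × unitaryLie F (2 * l))
    (t : InvFun (adGL F (Fin k)) ⊗[ℝ] InvFun (adU F (2 * l))) :
    evAB k l Y (TensorProduct.map (lofA F k) (lofB F l) t) = (tensorToProd _ _ t).1 Y := by
  induction t with
  | zero => simp
  | add s t hs ht => rw [map_add, map_add, hs, ht, map_add]; rfl
  | tmul a b => rw [TensorProduct.map_tmul, evAB_tmul, lofA_apply_eq, lofB_apply_eq]; rfl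

theorem evAB_map_lof_ne (h : ¬ (i = k ∧ j = l)) (Y : Matrix (Fin k) (Fin k) F × unitaryLie F (2 * l))
    (t : InvFun (adGL F (Fin i)) ⊗[ℝ] InvFun (adU F (2 * j))) :
    evAB k l Y (TensorProduct.map (lofA F i) (lofB F j) t) = 0 := by
  induction t with
  | zero => simp
  | add s t hs ht => rw [map_add, map_add, hs, ht, add_zero]
  | tmul a b =>
    rw [TensorProduct.map_tmul, evAB_tmul]
    by_cases hi : i = k
    · rw [lofB_apply_ne (fun hj => h ⟨hi, hj⟩)]; simp
    · rw [lofA_apply_ne hi]; simp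

variable [Finite F]

theorem tensorToProd_symm {G H 𝔤 𝔩 : Type*} [Group G] [Group H] [AddCommGroup 𝔤] [AddCommGroup 𝔩]
    [Finite 𝔤] [Finite 𝔩] (Ad₁ : G →* AddMonoid.End 𝔤) (Ad₂ : H →* AddMonoid.End 𝔩)
    (f : InvFun (adProd Ad₁ Ad₂)) : tensorToProd Ad₁ Ad₂ ((tensorEquiv Ad₁ Ad₂).symm f) = f :=
  (tensorEquiv Ad₁ Ad₂).apply_symm_apply f

theorem nabla_lof (a : InvFun (adGL F (Fin i))) (b : InvFun (adGL F (Fin j))) :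
    nabla F (lofA F i a ⊗ₜ lofA F j b) =
      lofA F (i + j) ((glParabolic F rfl).ind (tensorToProd _ _ (a ⊗ₜ b))) := by
  simp only [nabla, lofA, TensorProduct.lift.tmul, DirectSum.toModule_lof, LinearMap.flip_apply]
  rfl

theorem nablaTilde_lof (a : InvFun (adGL F (Fin i))) (b : InvFun (adU F (2 * j))) :
    nablaTilde F (lofA F i a ⊗ₜ lofB F j b) =
      lofB F (i + j) ((uParabolic F rfl).ind (tensorToProd _ _ (a ⊗ₜ b))) := by
  simp only [nablaTilde, lofA, lofB, TensorProduct.lift.tmul, DirectSum.toModule_lof,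
    LinearMap.flip_apply]
  rfl

theorem omega_lof (a : InvFun (adGL F (Fin n))) : omega F (lofA F n a) = lofA F n (omegaInv F n a) := by
  rw [omega, lofA, DirectSum.toModule_lof]; rfl

theorem delta_comp_lof : delta F ∘ₗ lofA F n = ∑ x : Finset.HasAntidiagonal.antidiagonal n,
    TensorProduct.map (lofA F x.1.1) (lofA F x.1.2) ∘ₗ
      (tensorEquiv (adGL F (Fin x.1.1)) (adGL F (Fin x.1.2))).symm.toLinearMap ∘ₗ
      (glParabolic F (Finset.HasAntidiagonal.mem_antidiagonal.1 x.2)).res := by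
  ext1 f
  exact DirectSum.toModule_lof ..

theorem deltaTilde_lof (f : InvFun (adU F (2 * n))) : deltaTilde F (lofB F n f) =
    ∑ x : Finset.HasAntidiagonal.antidiagonal n, TensorProduct.map (lofA F x.1.1) (lofB F x.1.2)
      ((tensorEquiv (adGL F (Fin x.1.1)) (adU F (2 * x.1.2))).symm
        ((uParabolic F (Finset.HasAntidiagonal.mem_antidiagonal.1 x.2)).res f)) := by
  rw [deltaTilde, lofB, DirectSum.toModule_lof, LinearMap.sum_apply]
  rfl

theorem evAB_deltaTilde (h' : k + l = n) (f : InvFun (adU F (2 * n)))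
    (Y : Matrix (Fin k) (Fin k) F × unitaryLie F (2 * l)) :
    evAB k l Y (deltaTilde F (lofB F n f)) = ((uParabolic F h').res f).1 Y := by
  rw [deltaTilde_lof, map_sum, Fintype.sum_eq_single
    (⟨(k, l), Finset.HasAntidiagonal.mem_antidiagonal.2 h'⟩ : Finset.HasAntidiagonal.antidiagonal n)]
  · rw [evAB_map_lof, tensorToProd_symm]
  · intro x hx
    exact evAB_map_lof_ne (fun h => hx (Subtype.ext (Prod.ext h.1 h.2))) _ _

theorem evAB_deltaTilde_ne (h' : k + l ≠ n) (f : InvFun (adU F (2 * n)))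
    (Y : Matrix (Fin k) (Fin k) F × unitaryLie F (2 * l)) :
    evAB k l Y (deltaTilde F (lofB F n f)) = 0 := by
  rw [deltaTilde_lof, map_sum]
  refine Finset.sum_eq_zero fun x _ => evAB_map_lof_ne (fun h => h' ?_) _ _
  rw [← h.1, ← h.2]
  exact Finset.HasAntidiagonal.mem_antidiagonal.1 x.2

theorem odot_lof (a : InvFun (adGL F (Fin i))) (t : AlgA F ⊗[ℝ] ModB F) :
    odot F (lofA F i a ⊗ₜ t) = ∑ y : Finset.HasAntidiagonal.antidiagonal i,
      ∑ z : Finset.HasAntidiagonal.antidiagonal y.1.1,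
        twistedTriple F (TensorProduct.map (TensorProduct.map (lofA F z.1.1) (lofA F z.1.2))
          (lofA F y.1.2) (((tensorEquiv (adGL F (Fin z.1.1)) (adGL F (Fin z.1.2))).symm.toLinearMap ∘ₗ
            (glParabolic F (Finset.HasAntidiagonal.mem_antidiagonal.1 z.2)).res).rTensor _
          ((tensorEquiv (adGL F (Fin y.1.1)) (adGL F (Fin y.1.2))).symm
            ((glParabolic F (Finset.HasAntidiagonal.mem_antidiagonal.1 y.2)).res a)))) t := by
  have h1 : delta F (lofA F i a) = _ := LinearMap.congr_fun (delta_comp_lof (F := F) (n := i)) a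
  change twistedTriple F (TensorProduct.map (delta F) LinearMap.id (delta F (lofA F i a))) t = _
  rw [h1]
  simp only [LinearMap.sum_apply, map_sum]
  refine Finset.sum_congr rfl fun y _ => ?_
  simp only [LinearMap.comp_apply, ← TensorProduct.map_comp]
  have h2 (T : InvFun (adGL F (Fin y.1.1)) ⊗[ℝ] InvFun (adGL F (Fin y.1.2))) : TensorProduct.map (delta F) LinearMap.id (TensorProduct.map (lofA F y.1.1)
      (lofA F y.1.2) T) = ∑ z : Finset.HasAntidiagonal.antidiagonal y.1.1,
        TensorProduct.map (TensorProduct.map (lofA F z.1.1) (lofA F z.1.2)) (lofA F y.1.2)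
          (((tensorEquiv (adGL F (Fin z.1.1)) (adGL F (Fin z.1.2))).symm.toLinearMap ∘ₗ
            (glParabolic F (Finset.HasAntidiagonal.mem_antidiagonal.1 z.2)).res).rTensor _ T) := by
    induction T with
    | zero => simp
    | add s t hs ht => simp only [map_add, hs, ht, Finset.sum_add_distrib]
    | tmul f g =>
      have h3 : delta F (lofA F y.1.1 f) = _ :=
        LinearMap.congr_fun (delta_comp_lof (F := F) (n := y.1.1)) f
      rw [TensorProduct.map_tmul, TensorProduct.map_tmul, h3, LinearMap.sum_apply,
        TensorProduct.sum_tmul]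
      rfl
  rw [h2]
  simp only [map_sum, LinearMap.sum_apply]
  rfl

end Components

/-! ### The compatibility of restriction and induction -/

section Main

variable {F : Type*} [Field F] [StarRing F] [Finite F] {i j k l n r s t c : ℕ}

theorem lofA_ind_apply (h : i + j = n) (Φ : InvFun (adProd (adGL F (Fin i)) (adGL F (Fin j)))) :
    lofA F (i + j) ((glParabolic F rfl).ind Φ) n = (glParabolic F h).ind Φ := by
  subst h; exact lofA_apply_eq _

theorem lofB_ind_apply (h : i + j = n) (Φ : InvFun (adProd (adGL F (Fin i)) (adU F (2 * j)))) :
    lofB F (i + j) ((uParabolic F rfl).ind Φ) n = (uParabolic F h).ind Φ := by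
  subst h; exact lofB_apply_eq _

/-- The value at a point of an element of a triple tensor product. -/
noncomputable def eval₃ (X : (Matrix (Fin r) (Fin r) F × Matrix (Fin t) (Fin t) F) ×
    Matrix (Fin s) (Fin s) F) :
    (InvFun (adGL F (Fin r)) ⊗[ℝ] InvFun (adGL F (Fin t))) ⊗[ℝ] InvFun (adGL F (Fin s)) →ₗ[ℝ] ℝ :=
  LinearMap.proj X ∘ₗ (InvFun (adProd (adProd (adGL F (Fin r)) (adGL F (Fin t)))
    (adGL F (Fin s)))).subtype ∘ₗ tensorToProd _ _ ∘ₗ (tensorToProd _ _).rTensor _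

/-- By linearity it suffices to treat pure tensors; there, freezing the last variable turns the
second factor into a scalar. -/
theorem eval₃_res (h : r + t = c) (X : (Matrix (Fin r) (Fin r) F × Matrix (Fin t) (Fin t) F) ×
    Matrix (Fin s) (Fin s) F) (T : InvFun (adGL F (Fin c)) ⊗[ℝ] InvFun (adGL F (Fin s))) :
    eval₃ X (((tensorEquiv (adGL F (Fin r)) (adGL F (Fin t))).symm.toLinearMap ∘ₗ
      (glParabolic F h).res).rTensor _ T) =
      ((glParabolic F h).res (InvFun.slice (tensorToProd _ _ T) X.2)).1 X.1 := by
  induction T with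
  | zero =>
    rw [map_zero, map_zero, map_zero, show InvFun.slice (0 : InvFun (adProd (adGL F (Fin c))
      (adGL F (Fin s)))) X.2 = 0 from rfl, map_zero]
    rfl
  | add T T' hT hT' =>
    rw [map_add, map_add, hT, hT', map_add, show InvFun.slice (tensorToProd _ _ T +
      tensorToProd _ _ T') X.2 = InvFun.slice (tensorToProd _ _ T) X.2 +
      InvFun.slice (tensorToProd _ _ T') X.2 from rfl, map_add]
    rfl
  | tmul f f' =>
    have h1 : InvFun.slice (tensorToProd _ _ (f ⊗ₜ f')) X.2 = f'.1 X.2 • f :=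
      Subtype.ext (funext fun Z => mul_comm _ _)
    rw [h1, map_smul, LinearMap.rTensor_tmul]
    change (tensorToProd (adGL F (Fin r)) (adGL F (Fin t)) ((tensorEquiv _ _).symm _)).1 X.1 *
      f'.1 X.2 = f'.1 X.2 * _
    rw [tensorToProd_symm, mul_comm]

namespace Position

variable (τ : Position i j k l)

open Classical in
/-- The contribution of a point of the orbit to a product in `A ⊗ B`. -/
noncomputable def prodTerm (S : (InvFun (adGL F (Fin τ.r)) ⊗[ℝ] InvFun (adGL F (Fin τ.t))) ⊗[ℝ]
      InvFun (adGL F (Fin τ.s)))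
    (T : InvFun (adGL F (Fin τ.j₁)) ⊗[ℝ] InvFun (adU F (2 * τ.j₂)))
    (Y : Matrix (Fin k) (Fin k) F × unitaryLie F (2 * l)) : ℝ :=
  if Y.1.BlockTriangular (blk3 τ.r τ.j₁) ∧ Y.2.1.BlockTriangular (uBlk τ.hl) then
    eval₃ ((Y.1.submatrix τ.symm.e₁ τ.symm.e₁, omegaMat F (Y.1.submatrix τ.symm.e₃ τ.symm.e₃)),
      (uBlocks F τ.hl Y.2).1) S * (tensorToProd _ _ T).1
        (Y.1.submatrix τ.symm.e₂ τ.symm.e₂, (uBlocks F τ.hl Y.2).2)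
  else 0

theorem prodTerm_add_left (S S') (T : InvFun (adGL F (Fin τ.j₁)) ⊗[ℝ] InvFun (adU F (2 * τ.j₂))) (Y) :
    τ.prodTerm (S + S') T Y = τ.prodTerm S T Y + τ.prodTerm S' T Y := by
  unfold prodTerm
  split_ifs
  · rw [map_add, add_mul]
  · rw [add_zero]

theorem prodTerm_add_right (S) (T T' : InvFun (adGL F (Fin τ.j₁)) ⊗[ℝ] InvFun (adU F (2 * τ.j₂))) (Y) :
    τ.prodTerm S (T + T') Y = τ.prodTerm S T Y + τ.prodTerm S T' Y := by
  unfold prodTerm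
  split_ifs
  · rw [map_add, ← mul_add]; rfl
  · rw [add_zero]

theorem prodTerm_zero_left (T : InvFun (adGL F (Fin τ.j₁)) ⊗[ℝ] InvFun (adU F (2 * τ.j₂))) (Y) :
    τ.prodTerm 0 T Y = 0 := by
  unfold prodTerm
  rw [map_zero, zero_mul, ite_self]

theorem prodTerm_zero_right (S) (Y) :
    τ.prodTerm S (0 : InvFun (adGL F (Fin τ.j₁)) ⊗[ℝ] InvFun (adU F (2 * τ.j₂))) Y = 0 := by
  unfold prodTerm
  rw [map_zero, show ((0 : InvFun (adProd (adGL F (Fin τ.j₁)) (adU F (2 * τ.j₂)))).1 _) = 0 from rfl,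
    mul_zero, ite_self]

/-- Both sides are linear in `S` and `T`, so pure tensors suffice. The product in `A` comes in the
order `r, t, j₁`, while the double coset has the blocks in the order `r, j₁, t`; `ind3_perm`
exchanges the last two. Then both sides are averages of the same integrand. -/
theorem evAB_twistedTriple (S : (InvFun (adGL F (Fin τ.r)) ⊗[ℝ] InvFun (adGL F (Fin τ.t))) ⊗[ℝ]
      InvFun (adGL F (Fin τ.s)))
    (T : InvFun (adGL F (Fin τ.j₁)) ⊗[ℝ] InvFun (adU F (2 * τ.j₂)))
    (Y : Matrix (Fin k) (Fin k) F × unitaryLie F (2 * l)) :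
    evAB k l Y (twistedTriple F (TensorProduct.map (TensorProduct.map (lofA F τ.r) (lofA F τ.t))
      (lofA F τ.s) S) (TensorProduct.map (lofA F τ.j₁) (lofB F τ.j₂) T)) =
      ((blockUpper F (blk3 τ.r τ.j₁ : Fin k → ℕ)).index : ℝ) * (uParabolic F τ.hl).P.index *
        avg fun g : GL (Fin k) F × unitaryGrp F (2 * l) =>
          τ.prodTerm S T (adProd (adGL F (Fin k)) (adU F (2 * l)) g⁻¹ Y) := by
  induction S with
  | zero => simp only [prodTerm_zero_left, avg_zero, map_zero, LinearMap.zero_apply, mul_zero]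
  | add S S' hS hS' =>
    simp only [prodTerm_add_left, avg_add, map_add, LinearMap.add_apply, mul_add, hS, hS']
  | tmul S u₃ =>
    induction S with
    | zero =>
      simp only [TensorProduct.zero_tmul, prodTerm_zero_left, avg_zero, map_zero,
        LinearMap.zero_apply, mul_zero]
    | add S S' hS hS' =>
      simp only [TensorProduct.add_tmul, prodTerm_add_left, avg_add, map_add, LinearMap.add_apply,
        mul_add, hS, hS']
    | tmul u₁ u₂ =>
      induction T with
      | zero => simp only [prodTerm_zero_right, avg_zero, map_zero, mul_zero]
      | add T T' hT hT' => simp only [prodTerm_add_right, avg_add, map_add, mul_add, hT, hT']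
      | tmul u v =>
        have h₁ : τ.r + τ.t + τ.j₁ = k := by have := τ.hk; omega
        simp only [TensorProduct.map_tmul]
        rw [twistedTriple_tmul, omega_lof, nabla_lof, nabla_lof, nablaTilde_lof, evAB_tmul,
          lofA_ind_apply h₁, lofB_ind_apply τ.hl, ← ind3, ind3_perm rfl h₁ rfl τ.hk, ind3_apply,
          indFun, Parabolic.ind_apply, mul_mul_mul_comm, avg_mul_avg, avg_prod fun g :
            GL (Fin k) F × unitaryGrp F (2 * l) => τ.prodTerm _ _ _]
        refine congrArg _ (avg_congr fun g => avg_congr fun g' => ?_)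
        change _ = τ.prodTerm _ _ (adGL F (Fin k) g⁻¹ Y.1, adU F (2 * l) g'⁻¹ Y.2)
        generalize adGL F (Fin k) g⁻¹ Y.1 = X
        generalize adU F (2 * l) g'⁻¹ Y.2 = Z
        have e₁ : (glBlocks F rfl (glBlocks F τ.hk X).1).1 = X.submatrix τ.symm.e₁ τ.symm.e₁ := by
          rw [funext (τ.symm.e₁_eq rfl τ.hk)]; rfl
        have e₂ : (glBlocks F rfl (glBlocks F τ.hk X).1).2 = X.submatrix τ.symm.e₂ τ.symm.e₂ := by
          rw [funext (τ.symm.e₂_eq rfl τ.hk)]; rfl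
        have e₃ : (glBlocks F τ.hk X).2 = X.submatrix τ.symm.e₃ τ.symm.e₃ := by
          rw [funext (τ.symm.e₃_eq rfl τ.hk)]; rfl
        rw [e₁, e₂, e₃, prodTerm]
        by_cases hZ : Z.1.BlockTriangular (uBlk τ.hl)
        · rw [show (uParabolic F τ.hl).extend _ Z = _ from if_pos hZ]
          by_cases hX : X.BlockTriangular (blk3 τ.r τ.j₁)
          · simp only [hX, hZ, and_self, if_true]
            exact (by intros; ring : ∀ c₁ c c₂ c₃ d : ℝ, c₁ * c * c₂ * (c₃ * d) =
              c₁ * c₂ * c₃ * (c * d)) (u₁.1 _) _ _ _ _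
          · simp only [hX, false_and, if_false, zero_mul]
        · rw [show (uParabolic F τ.hl).extend _ Z = _ from if_neg hZ]
          simp only [hZ, and_false, if_false, mul_zero]

/-- The double coset restricts `a` to blocks in the order `r, s, t`, whereas the iterated coproduct
uses `r, t, s`; `res3_perm` identifies the two. -/
theorem prodTerm_res (a : InvFun (adGL F (Fin i))) (b : InvFun (adU F (2 * j)))
    (h₁ : τ.r + τ.t = c) (h : c + τ.s = i) (Y : Matrix (Fin k) (Fin k) F × unitaryLie F (2 * l)) :
    τ.prodTerm (((tensorEquiv (adGL F (Fin τ.r)) (adGL F (Fin τ.t))).symm.toLinearMap ∘ₗ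
      (glParabolic F h₁).res).rTensor _ ((tensorEquiv (adGL F (Fin c)) (adGL F (Fin τ.s))).symm
        ((glParabolic F h).res a))) ((tensorEquiv (adGL F (Fin τ.j₁)) (adU F (2 * τ.j₂))).symm
          ((uParabolic F τ.hj).res b)) Y = τ.term a b Y := by
  rw [prodTerm, term, eval₃_res, tensorToProd_symm, tensorToProd_symm, glueA, ← res3_eq_avgNil,
    res3_perm rfl τ.hi h₁ h, res3]

end Position

theorem evAB_twistedTriple_ne {r s t j₁ j₂ : ℕ} (h : ¬ (r + t + j₁ = k ∧ s + j₂ = l))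
    (S : (InvFun (adGL F (Fin r)) ⊗[ℝ] InvFun (adGL F (Fin t))) ⊗[ℝ] InvFun (adGL F (Fin s)))
    (T : InvFun (adGL F (Fin j₁)) ⊗[ℝ] InvFun (adU F (2 * j₂)))
    (Y : Matrix (Fin k) (Fin k) F × unitaryLie F (2 * l)) :
    evAB k l Y (twistedTriple F (TensorProduct.map (TensorProduct.map (lofA F r) (lofA F t))
      (lofA F s) S) (TensorProduct.map (lofA F j₁) (lofB F j₂) T)) = 0 := by
  induction S with
  | zero => simp only [map_zero, LinearMap.zero_apply]
  | add S S' hS hS' => simp only [map_add, LinearMap.add_apply, hS, hS', add_zero]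
  | tmul S u₃ =>
    induction S with
    | zero => simp only [TensorProduct.zero_tmul, map_zero, LinearMap.zero_apply]
    | add S S' hS hS' =>
      simp only [TensorProduct.add_tmul, map_add, LinearMap.add_apply, hS, hS', add_zero]
    | tmul u₁ u₂ =>
      induction T with
      | zero => simp only [map_zero]
      | add T T' hT hT' => simp only [map_add, hT, hT', add_zero]
      | tmul u v =>
        simp only [TensorProduct.map_tmul]
        rw [twistedTriple_tmul, omega_lof, nabla_lof, nabla_lof, nablaTilde_lof]
        exact evAB_map_lof_ne h Y (_ ⊗ₜ _)

/-- The decompositions of `i` into three parts and of `j` into two parts with the prescribed degrees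
`k` and `l` of the result are the relative positions; all other terms vanish by degree. -/
theorem sum_antidiagonal_eq_sum_position [Fintype (Position i j k l)]
    (f : ∀ (x : Finset.HasAntidiagonal.antidiagonal i)
      (_ : Finset.HasAntidiagonal.antidiagonal x.1.1)
      (_ : Finset.HasAntidiagonal.antidiagonal j), ℝ) (g : Position i j k l → ℝ)
    (h₀ : ∀ x z y, ¬ (z.1.1 + z.1.2 + y.1.1 = k ∧ x.1.2 + y.1.2 = l) → f x z y = 0)
    (h₁ : ∀ τ : Position i j k l, f
      ⟨(τ.r + τ.t, τ.s), Finset.HasAntidiagonal.mem_antidiagonal.2 (by have := τ.hi; simp only; omega)⟩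
      ⟨(τ.r, τ.t), Finset.HasAntidiagonal.mem_antidiagonal.2 rfl⟩
      ⟨(τ.j₁, τ.j₂), Finset.HasAntidiagonal.mem_antidiagonal.2 τ.hj⟩ = g τ) :
    ∑ x, ∑ z, ∑ y, f x z y = ∑ τ, g τ := by
  have e : ∑ x, ∑ z, ∑ y, f x z y = ∑ p : (x : Finset.HasAntidiagonal.antidiagonal i) ×
      Finset.HasAntidiagonal.antidiagonal x.1.1 × Finset.HasAntidiagonal.antidiagonal j,
      f p.1 p.2.1 p.2.2 := by
    rw [Fintype.sum_sigma]
    simp only [Fintype.sum_prod_type]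
  rw [e]
  symm
  refine Fintype.sum_of_injective (fun τ : Position i j k l =>
    ⟨⟨(τ.r + τ.t, τ.s), Finset.HasAntidiagonal.mem_antidiagonal.2
      (by have := τ.hi; simp only; omega)⟩,
      ⟨(τ.r, τ.t), Finset.HasAntidiagonal.mem_antidiagonal.2 rfl⟩,
      ⟨(τ.j₁, τ.j₂), Finset.HasAntidiagonal.mem_antidiagonal.2 τ.hj⟩⟩) ?_ _ _ ?_
    fun τ => (h₁ τ).symm
  · intro τ τ' h
    have h2 := congrArg (fun p : (x : Finset.HasAntidiagonal.antidiagonal i) ×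
      Finset.HasAntidiagonal.antidiagonal x.1.1 × Finset.HasAntidiagonal.antidiagonal j =>
        (p.1.1.2, p.2.1.1.1)) h
    simp only [Prod.mk.injEq] at h2
    exact Position.ext_of_le h2.2 h2.1
  · rintro ⟨⟨⟨c, s⟩, hx⟩, ⟨⟨r, t⟩, hz⟩, ⟨⟨j₁, j₂⟩, hy⟩⟩ hp
    refine h₀ _ _ _ fun ⟨hk, hl⟩ => hp ?_
    simp only at hk hl hz
    rw [Finset.HasAntidiagonal.mem_antidiagonal] at hx hy
    have hz' := Finset.HasAntidiagonal.mem_antidiagonal.1 hz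
    simp only at hx hy hz'
    subst hz'
    exact ⟨⟨r, s, t, j₁, j₂, by omega, hy, by omega, hl⟩, rfl⟩

theorem ext_tmul_lof {R ι κ P : Type*} [CommSemiring R] [DecidableEq ι] [DecidableEq κ]
    {M : ι → Type*} {N : κ → Type*} [∀ i, AddCommMonoid (M i)] [∀ i, AddCommMonoid (N i)]
    [∀ i, Module R (M i)] [∀ i, Module R (N i)] [AddCommMonoid P] [Module R P]
    (f g : (DirectSum ι M) ⊗[R] (DirectSum κ N) →ₗ[R] P)
    (h : ∀ i j a b, f (DirectSum.lof R ι M i a ⊗ₜ DirectSum.lof R κ N j b) =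
      g (DirectSum.lof R ι M i a ⊗ₜ DirectSum.lof R κ N j b)) : f = g := by
  refine TensorProduct.ext (DirectSum.linearMap_ext R fun i => LinearMap.ext fun a =>
    DirectSum.linearMap_ext R fun j => LinearMap.ext fun b => h i j a b)

theorem evAB_odot (a : InvFun (adGL F (Fin i))) (b : InvFun (adU F (2 * j)))
    [Fintype (Position i j k l)] (Y : Matrix (Fin k) (Fin k) F × unitaryLie F (2 * l)) :
    evAB k l Y (odot F (lofA F i a ⊗ₜ deltaTilde F (lofB F j b))) =
      ∑ τ : Position i j k l, ((blockUpper F (blk3 τ.r τ.j₁ : Fin k → ℕ)).index : ℝ) *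
        (uParabolic F τ.hl).P.index * avg fun g : GL (Fin k) F × unitaryGrp F (2 * l) =>
          τ.term a b (adProd (adGL F (Fin k)) (adU F (2 * l)) g⁻¹ Y) := by
  rw [odot_lof, deltaTilde_lof]
  simp only [map_sum, LinearMap.sum_apply]
  refine sum_antidiagonal_eq_sum_position _ _ (fun x z y h => evAB_twistedTriple_ne h _ _ Y)
    fun τ => ?_
  refine (τ.evAB_twistedTriple _ _ Y).trans (congrArg _ (avg_congr fun g => ?_))
  exact τ.prodTerm_res a b rfl _ _

/-- Compare values in each bidegree on homogeneous elements. If `k + l = i + j`, both sides are the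
same sum over relative positions; otherwise there are no positions and both sides vanish. -/
theorem deltaTilde_nablaTilde (h2 : (2 : F) ≠ 0) (a : AlgA F) (b : ModB F) :
    deltaTilde F (nablaTilde F (a ⊗ₜ[ℝ] b)) = odot F (a ⊗ₜ[ℝ] deltaTilde F b) := by
  refine LinearMap.congr_fun (ext_tmul_lof (deltaTilde F ∘ₗ nablaTilde F)
    (odot F ∘ₗ TensorProduct.map LinearMap.id (deltaTilde F)) fun i j a b => ?_) (a ⊗ₜ b)
  refine eq_of_evAB fun k l Y => ?_
  change evAB k l Y (deltaTilde F (nablaTilde F (lofA F i a ⊗ₜ[ℝ] lofB F j b))) =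
    evAB k l Y (odot F (lofA F i a ⊗ₜ[ℝ] deltaTilde F (lofB F j b)))
  have := Fintype.ofFinite (Position i j k l)
  rw [evAB_odot, nablaTilde_lof]
  by_cases h : k + l = i + j
  · rw [evAB_deltaTilde h, res_ind_apply h2 rfl h (existsUnique_position h2 rfl h)]
  · have : IsEmpty (Position i j k l) := ⟨fun τ => h (by
      have h₁ := τ.hi
      have h₂ := τ.hj
      have h₃ := τ.hk
      have h₄ := τ.hl
      omega)⟩
    rw [evAB_deltaTilde_ne h, Fintype.sum_empty]

end Main

/-- A finite field of characteristic 2 has an even number of elements. -/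
theorem two_ne_zero_of_odd {F : Type*} [Field F] [Finite F] {q : ℕ} (hq : Odd q)
    (hF : Nat.card F = q ^ 2) : (2 : F) ≠ 0 := fun h => by
  have := Fintype.ofFinite F
  have h2 : ringChar F = 2 := (CharP.ringChar_of_prime_eq_zero Nat.prime_two (by exact_mod_cast h))
  have h3 := FiniteField.even_card_of_char_two h2
  rw [← Nat.card_eq_fintype_card, hF] at h3
  exact Nat.not_even_iff_odd.2 (hq.pow (n := 2)) (Nat.even_iff.2 h3)

end LieInv

/-- A field with `q²` elements exists only for a prime power `q`, so only oddness has to be assumed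
separately. -/
theorem mainTheorem4 {F : Type*} [Field F] [Finite F] (q : ℕ) (hq : Odd q)
    (hF : Nat.card F = q ^ 2) :
    letI : StarRing F := LieInv.frobeniusStar q hF
    ∀ (a : LieInv.AlgA F) (b : LieInv.ModB F),
      LieInv.deltaTilde F (LieInv.nablaTilde F (a ⊗ₜ[ℝ] b)) =
        LieInv.odot F (a ⊗ₜ[ℝ] LieInv.deltaTilde F b) := by
  letI : StarRing F := LieInv.frobeniusStar q hF
  exact LieInv.deltaTilde_nablaTilde (LieInv.two_ne_zero_of_odd hq hF)
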